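/- **Conventions.** Let $\Gamma$ be the circle $S^1=[0,1]/(0\sim 1)$ or a closed interval $[a,b]$, $0\le a<b$. An exchange transformation of $n$ subintervals of $\Gamma$ ($n$-CET, respectively $n$-IET) is an injective map $T:\bigcup_{i=1}^n I_i\to\Gamma$, where $I_1,\dots,I_n$ are pairwise disjoint open subintervals whose closures cover $\Gamma$ (in the case $\Gamma=[a,b]$: intervals $(s,t)$ with $a\le s<t\le b$), $T$ is an isometry on each $I_i$, and $T$ has no continuous extension to an open set properly containing $\mathrm{Dom}(T)=\bigcup_i I_i$ (open in $S^1$, respectively an open subset of $\mathbb R$ contained in $[a,b]$). It has $f$ flips if it reverses the orientation of exactly $f$ of the $I_i$. The orbit of $p$ is $\{T^k(p): k\in\mathbb Z,\ p\in\mathrm{Dom}(T^k)\}$; $T$ is transitive if some orbit is dense in $\Gamma$, and minimal if moreover every point of $\Gamma$ (other than the endpoints $a,b$ if $\Gamma=[a,b]$) has an infinite orbit; $T$ is uniquely ergodic if Lebesgue measure is, up to a scalar multiple, the only finite $T$-invariant Borel measure on $\Gamma$. $\mathcal I(n,f)$ and $\mathcal C(n,f)$ denote the sets of transitive $n$-IETs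 and $n$-CETs with $f$ flips. A signed permutation $p=\theta\pi$ ($\theta\in\{-1,1\}^n$, $\pi\in S_n$) is written as the tuple $(\theta_i\pi_i)_i$; it is irreducible if $\pi(\{1,\dots,k\})=\{1,\dots,k\}$, $1\le k\le n$, only for $k=n$. For $\lambda\in\mathbb R_{>0}^n$, $|\lambda|=\sum\lambda_i$, let $\mathcal E(\lambda,p)$ be the map on $[0,|\lambda|]$ which sends the $i$-th of the consecutive open intervals of lengths $\lambda_1,\dots,\lambda_n$ isometrically onto the $\pi_i$-th interval of the image partition, preserving orientation iff $\theta_i=1$. Put $m=\pi^{-1}(n)$. If $\lambda_m\ne\lambda_n$, Rauzy induction sends $(\lambda,p)$ to the pair $(\lambda',p')$ such that $\mathcal E(\lambda',p')$ is the first return map of $\mathcal E(\lambda,p)$ on $(0,|\lambda|-\min(\lambda_m,\lambda_n))$. The graph $\mathcal G_n$ has as vertices the irreducible signed permutations on $n$ symbols and edges $p\to a(p)$ (type $a$), $p\to b(p)$ (type $b$) between vertices, where: * if $\theta_n=1$, then $a(p)_i=\theta_i\pi_i$ for $\pi_i\le\pi_n$, $a(p)_i=\theta_i(\pi_n+1)$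 for $\pi_i=n$, and $a(p)_i=\theta_i(\pi_i+1)$ otherwise; if $\theta_n=-1$, then $a(p)_i=\theta_i\pi_i$ for $\pi_i\le\pi_n-1$, $a(p)_i=-\theta_i\pi_n$ for $\pi_i=n$, and $a(p)_i=\theta_i(\pi_i+1)$ otherwise (in each definition the first applicable case is used); * if $\theta_m=1$, then $b(p)_i=\theta_i\pi_i$ for $i\le m$, $b(p)_{m+1}=\theta_n\pi_n$, and $b(p)_i=\theta_{i-1}\pi_{i-1}$ for $i>m+1$; if $\theta_m=-1$, then $b(p)_i=\theta_i\pi_i$ for $i<m$, $b(p)_m=-\theta_n\pi_n$, and $b(p)_i=\theta_{i-1}\pi_{i-1}$ for $i>m$. With $E_{ij}$ the matrix units and $E$ the identity, the transition matrices are $M_a(p)=E+E_{n,m}$ and $M_b(p)=\sum_{i\le m}E_{i,i}+E_{n,s}+\sum_{i=m}^{n-1}E_{i,i+1}$, $s=m+(1+\theta_m)/2$. A cycle $\gamma=(p^{(0)},\dots,p^{(N)}=p^{(0)})$, $N\ge 1$, with edge types $t_1,\dots,t_N$, is special if some positive power of its product matrix $M_\gamma=M_{t_1}(p^{(0)})\cdots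 M_{t_N}(p^{(N-1)})$ has only positive entries. **Theorem.** The cycle $\gamma$ of length $9$ of $\mathcal G_4$ that starts at $p^{(0)}=(-3,+4,+1,-2)$ and has type itinerary $a,b,a,b,b,a,b,a,b$ exists (that is, this path in $\mathcal G_4$ closes up) and is special, with product matrix $$M=\begin{pmatrix}2&2&3&2\\0&1&1&1\\1&1&2&1\\1&2&3&3\end{pmatrix}.$$ Let $\sigma$ be the Perron–Frobenius eigenvalue of $M$ (positive, simple, of maximum modulus) and $\lambda$ the eigenvector, $M\lambda=\sigma\lambda$, with positive entries of sum $1$. Then $T=\mathcal E(\lambda,p^{(0)})$ is a minimal, uniquely ergodic $4$-IET of $[0,1]$ with two flips. It is self-induced along $\gamma$: Rauzy induction can be iterated forever on $(\lambda,p^{(0)})$, the sequence of signed permutations obtained is the periodic path generated by $\gamma$, every nine steps divide the length vector by $\sigma$, and the first return map of $T$ on $(0,1/\sigma)$ is $\mathcal E(\lambda/\sigma,p^{(0)})$. If the endpoints of $[0,1]$ are identified, $T$ induces (after continuous extension to the point where its discontinuity disappears) a minimal, uniquely ergodic $3$-CET with two flips. In particular, $\mathcal I(4,2)\ne\emptyset$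 and $\mathcal C(3,2)\ne\emptyset$. -/

import Mathlib

open Set MeasureTheory

noncomputable section

namespace ExchangeMaps

/-! ### Partially defined self-maps and their dynamics -/

/-- A map defined on the subset `dom` of `X`, with values in `X`.
The values of `map` outside `dom` carry no meaning and are never used. -/
structure PartialMap (X : Type*) where
  dom : Set X
  map : X → X

variable {X : Type*}

/-- `x ∈ Dom (T ^ k)`: the first `k` iterates of `T` at `x` are defined. -/
def PartialMap.InIterDom (T : PartialMap X) (k : ℕ) (x : X) : Prop :=
  ∀ j < k, T.map^[j] x ∈ T.dom

/-- The orbit of `p`: all the points `T ^ k (p)`, `k ∈ ℤ`, that are defined.  A point `q` is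
`T ^ (-k) (p)` when `T ^ k (q)` is defined and equal to `p` (our maps are injective). -/
def PartialMap.orbit (T : PartialMap X) (p : X) : Set X :=
  {q | ∃ k : ℕ, T.InIterDom k p ∧ T.map^[k] p = q} ∪
    {q | ∃ k : ℕ, T.InIterDom k q ∧ T.map^[k] q = p}

/-- Some orbit of `T` is dense in the phase space `Γ`. -/
def IsTransitive [TopologicalSpace X] (Γ : Set X) (T : PartialMap X) : Prop :=
  ∃ p ∈ Γ, Γ ⊆ closure (T.orbit p)

/-- A transitive map without finite orbits.  On the circle all points are considered.  On
`Γ = [a, b]` the map is defined on open intervals, so that each endpoint is, trivially, an orbit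
by itself; the condition concerns the points of the interior `(a, b)`. -/
def IsMinimalExchange [TopologicalSpace X] (Γ : Set X) (T : PartialMap X) : Prop :=
  IsTransitive Γ T ∧ ∀ p ∈ interior Γ, (T.orbit p).Infinite

/-- The measure `μ` is invariant: `μ (T⁻¹ A) = μ A` for every Borel set `A`. -/
def IsInvariant [MeasurableSpace X] (T : PartialMap X) (μ : Measure X) : Prop :=
  ∀ A : Set X, MeasurableSet A → μ {x | x ∈ T.dom ∧ T.map x ∈ A} = μ A

/-- Lebesgue measure on `Γ` is invariant, and every finite invariant Borel measure on `Γ` is a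
scalar multiple of it. -/
def IsUniquelyErgodic [MeasureSpace X] (Γ : Set X) (T : PartialMap X) : Prop :=
  IsInvariant T (volume.restrict Γ) ∧
    ∀ μ : Measure X, IsFiniteMeasure μ → μ Γᶜ = 0 → IsInvariant T μ →
      ∃ c : NNReal, μ = c • volume.restrict Γ

/-- The first return of `x` to `B` under `T` is defined and happens at time `k ≥ 1`. -/
def ReturnsAt (T : PartialMap X) (B : Set X) (x : X) (k : ℕ) : Prop :=
  1 ≤ k ∧ T.InIterDom k x ∧ T.map^[k] x ∈ B ∧ ∀ j, 1 ≤ j → j < k → T.map^[j] x ∉ B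

/-- `R` is the Poincaré first return map induced by `T` on `B`. -/
def IsFirstReturnMap (T : PartialMap X) (B : Set X) (R : PartialMap X) : Prop :=
  (∀ x, x ∈ R.dom ↔ x ∈ B ∧ ∃ k, ReturnsAt T B x k) ∧
    ∀ x ∈ B, ∀ k, ReturnsAt T B x k → R.map x = T.map^[k] x

/-! ### Interval and circle exchange transformations -/

/-- `T` reverses the orientation of the interval `J`, on which it is an isometry. -/
def ReversesOn [AddCommGroup X] (T : PartialMap X) (J : Set X) : Prop :=
  ∃ c : X, ∀ x ∈ J, T.map x = c - x

/-- `T` is an exchange transformation, with `n` subintervals and `f` flips, of the phase space `Γ`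
(circle or closed interval) whose open subintervals are the members of `intervals`: it is an
injective map `⋃ Iᵢ → Γ`, where `I₁, …, Iₙ` are disjoint open subintervals whose closures cover `Γ`,
an isometry on each `Iᵢ`, without continuous extension to a bigger open set, and it reverses the
orientation of exactly `f` of the `Iᵢ`. -/
def IsExchange [AddCommGroup X] [PseudoMetricSpace X] (Γ : Set X) (intervals : Set (Set X))
    (n f : ℕ) (T : PartialMap X) : Prop :=
  ∃ I : Fin n → Set X,
    (∀ i, I i ∈ intervals) ∧
    (∀ i j, i ≠ j → Disjoint (I i) (I j)) ∧
    Γ ⊆ closure (⋃ i, I i) ∧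
    T.dom = ⋃ i, I i ∧
    MapsTo T.map T.dom Γ ∧
    InjOn T.map T.dom ∧
    (∀ i, ∀ x ∈ I i, ∀ y ∈ I i, dist (T.map x) (T.map y) = dist x y) ∧
    (∀ U : Set X, IsOpen U → U ⊆ Γ → T.dom ⊆ U →
      ∀ g : X → X, ContinuousOn g U → EqOn g T.map T.dom → U = T.dom) ∧
    {i | ReversesOn T (I i)}.ncard = f

/-- `T` is an `n`-IET of `[a, b]` with `f` flips. -/
def IsIET (a b : ℝ) (n f : ℕ) (T : PartialMap ℝ) : Prop :=
  IsExchange (Icc a b) {J | ∃ s t : ℝ, a ≤ s ∧ s < t ∧ t ≤ b ∧ J = Ioo s t} n f T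

/-- `T` is an `n`-CET with `f` flips: an exchange transformation of the circle `ℝ / ℤ`. -/
def IsCET (n f : ℕ) (T : PartialMap UnitAddCircle) : Prop :=
  IsExchange univ
    {J | ∃ s t : ℝ, s < t ∧ t ≤ s + 1 ∧ J = (fun x : ℝ => (x : UnitAddCircle)) '' Ioo s t} n f T

/-- The set `𝓘(n, f)` of transitive IETs of `n` subintervals with `f` flips. -/
def transitiveIETs (n f : ℕ) : Set (PartialMap ℝ) :=
  {T | ∃ a b : ℝ, 0 ≤ a ∧ a < b ∧ IsIET a b n f T ∧ IsTransitive (Icc a b) T}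

/-- The set `𝓒(n, f)` of transitive CETs of `n` subintervals with `f` flips. -/
def transitiveCETs (n f : ℕ) : Set (PartialMap UnitAddCircle) :=
  {T | IsCET n f T ∧ IsTransitive univ T}

/-- `S` is induced by the IET `T` of `[0, 1]` on the circle obtained by identifying `0` and `1`:
it is continuous on its domain and agrees there with the projection of `T`.  (Its domain may also
contain points of the circle at which the discontinuity of `T` disappears.) -/
def IsEndpointIdentification (T : PartialMap ℝ) (S : PartialMap UnitAddCircle) : Prop :=
  (∀ x ∈ T.dom, (x : UnitAddCircle) ∈ S.dom ∧ S.map (x : UnitAddCircle) = (T.map x : ℝ)) ∧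
    ContinuousOn S.map S.dom

/-! ### Signed permutations and Rauzy transitions -/

/-- A signed permutation `θ π` of `n` symbols.  Positions and values are numbered from `0` in
`perm`, and from `1` in `val` and `entry`. -/
@[ext]
structure SignedPerm (n : ℕ) where
  perm : Equiv.Perm (Fin n)
  sign : Fin n → ℤˣ

/-- The value `π i ∈ {1, …, n}`. -/
def SignedPerm.val {n : ℕ} (p : SignedPerm n) (i : Fin n) : ℤ := ((p.perm i : ℕ) : ℤ) + 1

/-- The component `θ i * π i` of the `n`-tuple of integers that represents `θ π`. -/
def SignedPerm.entry {n : ℕ} (p : SignedPerm n) (i : Fin n) : ℤ := (p.sign i : ℤ) * p.val i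

/-- `π {1, …, k} = {1, …, k}` (with `1 ≤ k ≤ n`) only for `k = n`. -/
def SignedPerm.Irreducible {n : ℕ} (p : SignedPerm n) : Prop :=
  ∀ k : ℕ, 1 ≤ k → k ≤ n → p.perm '' {i : Fin n | (i : ℕ) < k} = {i : Fin n | (i : ℕ) < k} → k = n

/-- The position `π⁻¹(n)` of the largest value. -/
def SignedPerm.top {n : ℕ} (p : SignedPerm (n + 1)) : Fin (n + 1) := p.perm.symm (Fin.last n)

/-- The two types of edges of the Rauzy graph. -/
inductive EdgeType
  | a
  | b

/-- The tuple `a (θ π)`. -/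
def SignedPerm.transA {n : ℕ} (p : SignedPerm (n + 1)) (i : Fin (n + 1)) : ℤ :=
  if p.sign (Fin.last n) = 1 then
    if p.val i ≤ p.val (Fin.last n) then p.entry i
    else if p.val i = n + 1 then p.sign i * (p.val (Fin.last n) + 1)
    else p.sign i * (p.val i + 1)
  else
    if p.val i ≤ p.val (Fin.last n) - 1 then p.entry i
    else if p.val i = n + 1 then -(p.sign i * p.val (Fin.last n))
    else p.sign i * (p.val i + 1)

/-- The tuple `b (θ π)`. -/
def SignedPerm.transB {n : ℕ} (p : SignedPerm (n + 1)) (i : Fin (n + 1)) : ℤ :=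
  if p.sign p.top = 1 then
    if i ≤ p.top then p.entry i
    else if (i : ℕ) = p.top + 1 then p.entry (Fin.last n)
    else p.entry ⟨(i : ℕ) - 1, by omega⟩
  else
    if i < p.top then p.entry i
    else if i = p.top then -p.entry (Fin.last n)
    else p.entry ⟨(i : ℕ) - 1, by omega⟩

/-- The transition maps `a` and `b`, on tuples. -/
def SignedPerm.trans {n : ℕ} (p : SignedPerm (n + 1)) : EdgeType → Fin (n + 1) → ℤ
  | EdgeType.a => p.transA
  | EdgeType.b => p.transB

/-- The transition matrices `M_a = E + E_{n, π⁻¹(n)}` and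
`M_b = ∑_{i ≤ π⁻¹(n)} E_{i,i} + E_{n,s} + ∑_{π⁻¹(n) ≤ i < n} E_{i,i+1}`, where `s` is
`π⁻¹(n) + 1` or `π⁻¹(n)` according to whether the sign at `π⁻¹(n)` is `1` or `-1`. -/
def SignedPerm.transMatrix {n : ℕ} (p : SignedPerm (n + 1)) :
    EdgeType → Matrix (Fin (n + 1)) (Fin (n + 1)) ℤ
  | EdgeType.a => Matrix.of fun i j =>
      (if i = j then 1 else 0) + (if i = Fin.last n ∧ j = p.top then 1 else 0)
  | EdgeType.b => Matrix.of fun i j =>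
      (if i = j ∧ i ≤ p.top then 1 else 0) +
      (if i = Fin.last n ∧ (j : ℕ) = p.top + (if p.sign p.top = 1 then 1 else 0) then 1 else 0) +
      (if p.top ≤ i ∧ (j : ℕ) = i + 1 then 1 else 0)

/-- `(p, q)` is an edge of type `t` of the graph `𝓖ₙ`, whose vertices are the irreducible signed
permutations. -/
def IsEdge {n : ℕ} (t : EdgeType) (p q : SignedPerm (n + 1)) : Prop :=
  p.Irreducible ∧ q.Irreducible ∧ q.entry = p.trans t

/-- `γ` is a (directed) cycle of length `N` in `𝓖ₙ` with type itinerary `t`. -/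
def IsCycle {n N : ℕ} (γ : Fin (N + 1) → SignedPerm (n + 1)) (t : Fin N → EdgeType) : Prop :=
  0 < N ∧ (∀ i : Fin N, IsEdge (t i) (γ i.castSucc) (γ i.succ)) ∧ γ (Fin.last N) = γ 0

/-- The product `M_{t₁}(p⁽⁰⁾) * M_{t₂}(p⁽¹⁾) * ⋯ * M_{t_N}(p⁽ᴺ⁻¹⁾)`. -/
def productMatrix {n N : ℕ} (γ : Fin (N + 1) → SignedPerm (n + 1)) (t : Fin N → EdgeType) :
    Matrix (Fin (n + 1)) (Fin (n + 1)) ℤ :=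
  (List.ofFn fun i : Fin N => (γ i.castSucc).transMatrix (t i)).prod

/-- Some power `A ^ k`, `k ≥ 1`, has only positive entries. -/
def EventuallyPositive {m : ℕ} (A : Matrix (Fin m) (Fin m) ℤ) : Prop :=
  ∃ k : ℕ, 1 ≤ k ∧ ∀ i j, 0 < (A ^ k) i j

/-- A cycle whose product matrix is eventually positive. -/
def IsSpecialCycle {n N : ℕ} (γ : Fin (N + 1) → SignedPerm (n + 1)) (t : Fin N → EdgeType) :
    Prop :=
  IsCycle γ t ∧ EventuallyPositive (productMatrix γ t)

/-- `σ` is a positive, simple eigenvalue of `A` of maximum modulus, and `v` is an eigenvector for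
it in the open simplex `{v | vᵢ > 0, ∑ vᵢ = 1}`. -/
def IsPerronFrobenius {m : ℕ} (A : Matrix (Fin m) (Fin m) ℤ) (σ : ℝ) (v : Fin m → ℝ) : Prop :=
  0 < σ ∧
  (A.map (fun z : ℤ => (z : ℝ))).charpoly.rootMultiplicity σ = 1 ∧
  (∀ z : ℂ, (A.map (fun w : ℤ => (w : ℂ))).charpoly.IsRoot z → ‖z‖ ≤ σ) ∧
  (∀ i, 0 < v i) ∧ ∑ i, v i = 1 ∧
  (A.map (fun z : ℤ => (z : ℝ))).mulVec v = σ • v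

/-! ### The IET with given lengths and signed permutation, and Rauzy induction -/

/-- Left endpoint of the domain interval `I i`. -/
def leftEnd {n : ℕ} (l : Fin n → ℝ) (i : Fin n) : ℝ := ∑ j with j < i, l j

/-- Left endpoint of the range interval `J (π i)`, the image of `I i`. -/
def imageLeftEnd {n : ℕ} (l : Fin n → ℝ) (p : SignedPerm n) (i : Fin n) : ℝ :=
  ∑ j with p.perm j < p.perm i, l j

/-- The open domain interval `I i`, of length `l i`. -/
def subinterval {n : ℕ} (l : Fin n → ℝ) (i : Fin n) : Set ℝ :=
  Ioo (leftEnd l i) (leftEnd l i + l i)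

/-- The interval exchange `𝓔(l, θ π)` of `[0, ∑ lᵢ]`: it maps `I i` isometrically onto `J (π i)`,
preserving the orientation if `θ i = 1` and reversing it if `θ i = -1`. -/
def exchange {n : ℕ} (l : Fin n → ℝ) (p : SignedPerm n) : PartialMap ℝ where
  dom := ⋃ i, subinterval l i
  map x := ∑ i, (subinterval l i).indicator
    (fun x => if p.sign i = 1 then imageLeftEnd l p i + (x - leftEnd l i)
      else imageLeftEnd l p i + (leftEnd l i + l i - x)) x

/-- Rauzy induction sends `(l, p)` to `(l', p')`: the lengths `l_n` and `l_{π⁻¹(n)}` differ, and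
`𝓔(l', p')` is the first return map of `𝓔(l, p)` on the interval obtained by cutting off on the
right a piece as long as the shorter of the two. -/
def IsRauzyStep {n : ℕ} (l : Fin (n + 1) → ℝ) (p : SignedPerm (n + 1))
    (l' : Fin (n + 1) → ℝ) (p' : SignedPerm (n + 1)) : Prop :=
  (∀ i, 0 < l i) ∧ (∀ i, 0 < l' i) ∧ l p.top ≠ l (Fin.last n) ∧
    IsFirstReturnMap (exchange l p)
      (Ioo 0 (∑ i, l i - min (l p.top) (l (Fin.last n)))) (exchange l' p')

/-- The periodic path `p⁽ʲ⁾ = p⁽ʲ ᵐᵒᵈ ᴺ⁾` generated by a cycle of length `N`. -/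
def periodicPath {n N : ℕ} [NeZero N] (γ : Fin (N + 1) → SignedPerm (n + 1)) (j : ℕ) :
    SignedPerm (n + 1) :=
  γ (Fin.ofNat N j).castSucc

/-- `𝓔(l, p⁽⁰⁾)` is self-induced along the cycle `γ = (p⁽⁰⁾, …, p⁽ᴺ⁾)` with scaling factor `σ`:
it is infinitely renormalisable, the corresponding path is the periodic path generated by `γ`,
every `N` steps of Rauzy induction divide the lengths by `σ`, and its first return map on the
interval from `0` to `|l| / σ` is its own copy scaled by `1 / σ`. -/
def IsSelfInduced {n N : ℕ} [NeZero N] (γ : Fin (N + 1) → SignedPerm (n + 1)) (σ : ℝ)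
    (l : Fin (n + 1) → ℝ) : Prop :=
  (∃ s : ℕ → Fin (n + 1) → ℝ, s 0 = l ∧
    (∀ j, IsRauzyStep (s j) (periodicPath γ j) (s (j + 1)) (periodicPath γ (j + 1))) ∧
    ∀ j, s (j + N) = σ⁻¹ • s j) ∧
  IsFirstReturnMap (exchange l (γ 0)) (Ioo 0 ((∑ i, l i) / σ)) (exchange (σ⁻¹ • l) (γ 0))

end ExchangeMaps

end

/-!
An interval exchange is described by a `Gluing`: a family of labelled intervals, each with its
position in the domain, its position in the image, its length and its orientation.  In this form a
step of Rauzy induction changes the data of two labels only (`Gluing.stepA`, `Gluing.stepB`), and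
every return time to the shorter interval is `1` or `2`, so that the first return map is computed
directly (`Gluing.isFirstReturnMap_stepA`, `Gluing.isFirstReturnMap_stepB`).

**Self-induction.**  For each of the nine edges of the cycle and arbitrary positive lengths `l`
after the step, the lengths before the step are `stepMatrix r` times `l` (`rauzyRel_cycle`).  The
characteristic polynomial of the product matrix `M` is `(X - 1) (X ^ 3 - 7 X ^ 2 + 5 X - 1)`; its
Perron-Frobenius eigenvalue `σ` is the root of the cubic factor between `6` and `7`.  Going
backwards along the cycle from `λ / σ` leads to `M (λ / σ) = λ`, so that Rauzy induction from the
eigenvector `λ` follows the cycle forever and the intervals of induction shrink to the point `0`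
(`isRenormalizable_cycle`, `isSelfInduced_cycle`).

**Infinite orbits.**  A union of orbits that meets the open interval meets the intervals `(0, L j)`
of all inductions.  As `L j` tends to `0`, it is infinite
(`IsRenormalizable.infinite_of_isSaturated`).

**Unique ergodicity.**  A finite invariant measure has no atoms, because points of an orbit have the
same mass and orbits are infinite.  Its distribution function `F` is therefore equivariant
(`equivariant_of_isInvariant`): its increments over a subinterval and over the image of the
subinterval agree.  Equivariance is inherited by the induced exchanges, and the increments of `F`
over the exchanged intervals are transformed by the same matrices as the lengths.  Hence the vector
of increments has nonnegative preimages under all powers of `M`, which forces it to be a multiple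
`c • λ` of the eigenvector (`exists_eq_smul_of_positive`).  The function `F x - c * x` is then
equivariant and vanishes at all ends of the exchanged intervals, at all stages of the induction.
For such a function, a value attained anywhere is attained, up to sign, in every interval
`[0, L j]`, where it is small because `F` is increasing.  So `F x = c * x`
(`IsRenormalizable.eq_mul_of_vanishesAtEnds`), and the measure is a multiple of Lebesgue measure.

**Transitivity.**  The restriction of Lebesgue measure to the points whose forward orbit meets a
given interval is invariant, hence a multiple of Lebesgue measure.  So almost every orbit is dense
(`isTransitive_of_isUniquelyErgodic`).

**The circle.**  The second and third subintervals are moved to the last and the first place of the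
image with their orientations preserved; after the endpoints of `[0, 1]` are identified, both are
moved by the same rotation, and with the point between them they form one arc (`arc`).  The other
two arcs are flipped.  Away from that point and from the identified endpoints the two exchanges
correspond to each other (`exchange_iff_circleExchange`), so that minimality and unique ergodicity
carry over.
-/

namespace ExchangeMaps

/-! ### Two-step first return maps -/

lemma returnsAt_unique {X : Type*} {T : PartialMap X} {B : Set X} {x : X} {k k' : ℕ}
    (h : ReturnsAt T B x k) (h' : ReturnsAt T B x k') : k = k' := by
  rcases lt_trichotomy k k' with hlt | heq | hlt
  · exact absurd h.2.2.1 (h'.2.2.2 k h.1 hlt)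
  · exact heq
  · exact absurd h'.2.2.1 (h.2.2.2 k' h'.1 hlt)

/-- A criterion for first return maps all of whose return times are `1` or `2`: points of
`B` outside the domain of `R` leave `B` for a point where `T` is undefined, or `T` is undefined at
them. -/
lemma isFirstReturnMap_of_le_two {X : Type*} {T R : PartialMap X} {B : Set X}
    (h1 : ∀ x ∈ R.dom, x ∈ B ∧ x ∈ T.dom ∧ (T.map x ∈ B ∧ R.map x = T.map x ∨
      T.map x ∉ B ∧ T.map x ∈ T.dom ∧ T.map (T.map x) ∈ B ∧ R.map x = T.map (T.map x)))
    (h2 : ∀ x ∈ B, x ∈ T.dom → x ∈ R.dom ∨ (T.map x ∉ B ∧ T.map x ∉ T.dom)) :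
    IsFirstReturnMap T B R := by
  have key : ∀ x ∈ R.dom, ∃ k, ReturnsAt T B x k ∧ R.map x = T.map^[k] x := by
    intro x hx
    obtain ⟨-, hd, ⟨hB, hR⟩ | ⟨hB, hd', hB', hR⟩⟩ := h1 x hx
    · refine ⟨1, ⟨le_rfl, ?_, hB, fun j h1 h2 => by omega⟩, hR⟩
      intro j hj
      obtain rfl : j = 0 := by omega
      exact hd
    · refine ⟨2, ⟨by norm_num, ?_, hB', ?_⟩, hR⟩
      · intro j hj
        have : j = 0 ∨ j = 1 := by omega
        rcases this with rfl | rfl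
        · exact hd
        · exact hd'
      · intro j h1 h2
        obtain rfl : j = 1 := by omega
        exact hB
  have dom : ∀ x ∈ B, ∀ k, ReturnsAt T B x k → x ∈ R.dom := by
    intro x hx k hk
    have hd : x ∈ T.dom := hk.2.1 0 (by have := hk.1; omega)
    rcases h2 x hx hd with h | ⟨h, h'⟩
    · exact h
    · have hk1 : k ≠ 1 := by
        rintro rfl
        exact h hk.2.2.1
      exact absurd (hk.2.1 1 (by have := hk.1; omega)) h'
  refine ⟨fun x => ⟨fun hx => ⟨(h1 x hx).1, ?_⟩, ?_⟩, ?_⟩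
  · obtain ⟨k, hk, -⟩ := key x hx
    exact ⟨k, hk⟩
  · rintro ⟨hx, k, hk⟩
    exact dom x hx k hk
  · intro x hx k hk
    obtain ⟨k', hk', hR⟩ := key x (dom x hx k hk)
    rw [returnsAt_unique hk hk', hR]

/-! ### Gluing data and Rauzy steps -/

/-- The data of an interval exchange, with arbitrarily labelled intervals: the interval with label
`i` starts at `x i`, has length `len i`, and is mapped isometrically onto the interval that starts
at `y i`, with orientation given by `sign i`. -/
@[ext]
structure Gluing (ι : Type*) where
  x : ι → ℝ
  y : ι → ℝ
  len : ι → ℝ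
  sign : ι → ℤˣ

namespace Gluing

variable {ι : Type*}

/-- The isometry of the real line by which the interval labelled `i` is moved. -/
noncomputable def move (D : Gluing ι) (i : ι) (z : ℝ) : ℝ :=
  if D.sign i = 1 then D.y i + (z - D.x i) else D.y i + (D.x i + D.len i - z)

/-- The partial map `T` is the exchange described by `D`. -/
structure Realizes (T : PartialMap ℝ) (D : Gluing ι) : Prop where
  dom : T.dom = ⋃ i, Ioo (D.x i) (D.x i + D.len i)
  map : ∀ i, ∀ z ∈ Ioo (D.x i) (D.x i + D.len i), T.map z = D.move i z

/-- The intervals lie in `[0, L]`, have positive lengths, and the last one in the domain is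
labelled `n`, the last one in the image is labelled `m ≠ n`. -/
structure IsLast (D : Gluing ι) (n m : ι) (L : ℝ) : Prop where
  ne : m ≠ n
  len_pos : ∀ i, 0 < D.len i
  x_nonneg : ∀ i, 0 ≤ D.x i
  y_nonneg : ∀ i, 0 ≤ D.y i
  x_le : ∀ i, i ≠ n → D.x i + D.len i ≤ D.x n
  y_le : ∀ i, i ≠ m → D.y i + D.len i ≤ D.y m
  x_last : D.x n + D.len n = L
  y_last : D.y m + D.len m = L

/-- The same exchange with labels permuted. -/
def relabel (D : Gluing ι) (e : Equiv.Perm ι) : Gluing ι :=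
  ⟨D.x ∘ e, D.y ∘ e, D.len ∘ e, D.sign ∘ e⟩

section
variable [DecidableEq ι]

/-- Rauzy induction when the last image interval, labelled `m`, is shorter than the last domain
interval, labelled `n`.  The label `n` keeps the left part of its domain interval; the image of `m`
is sent by the exchange into the image of `n`. -/
def stepA (D : Gluing ι) (n m : ι) : Gluing ι where
  x := D.x
  y i := if i = n then (if D.sign n = 1 then D.y n else D.y n + D.len m)
    else if i = m then (if D.sign n = 1 then D.y n + D.len n - D.len m else D.y n) else D.y i
  len i := if i = n then D.len n - D.len m else D.len i
  sign i := if i = m then D.sign m * D.sign n else D.sign i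

/-- Rauzy induction when the last domain interval, labelled `n`, is shorter than the last image
interval, labelled `m`.  The part of the domain interval of `m` that falls on the last domain
interval receives the label `n`. -/
def stepB (D : Gluing ι) (n m : ι) : Gluing ι where
  x i := if i = m then (if D.sign m = 1 then D.x m else D.x m + D.len n)
    else if i = n then (if D.sign m = 1 then D.x m + D.len m - D.len n else D.x m) else D.x i
  y := D.y
  len i := if i = m then D.len m - D.len n else D.len i
  sign i := if i = n then D.sign n * D.sign m else D.sign i

end

variable {D : Gluing ι} {T R : PartialMap ℝ} {n m : ι} {L : ℝ}

lemma move_mem {i : ι} {z : ℝ} (hz : z ∈ Ioo (D.x i) (D.x i + D.len i)) :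
    D.move i z ∈ Ioo (D.y i) (D.y i + D.len i) := by
  unfold move
  obtain ⟨h1, h2⟩ := hz
  split_ifs <;> constructor <;> linarith

lemma exists_move_eq {i : ι} {w : ℝ} (hw : w ∈ Ioo (D.y i) (D.y i + D.len i)) :
    ∃ z ∈ Ioo (D.x i) (D.x i + D.len i), D.move i z = w := by
  unfold move
  obtain ⟨h1, h2⟩ := hw
  by_cases h : D.sign i = 1
  · exact ⟨D.x i + (w - D.y i), ⟨by linarith, by linarith⟩, by rw [if_pos h]; ring⟩
  · exact ⟨D.x i + D.len i - (w - D.y i), ⟨by linarith, by linarith⟩, by rw [if_neg h]; ring⟩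

lemma Realizes.mem_dom (hT : Realizes T D) {i : ι} {z : ℝ}
    (hz : z ∈ Ioo (D.x i) (D.x i + D.len i)) : z ∈ T.dom := by
  rw [hT.dom]
  exact mem_iUnion.2 ⟨i, hz⟩

lemma Realizes.of_relabel {e : Equiv.Perm ι} (hT : Realizes T (D.relabel e)) : Realizes T D where
  dom := by
    rw [hT.dom]
    exact e.surjective.iUnion_comp fun i => Ioo (D.x i) (D.x i + D.len i)
  map i z hz := by
    have := hT.map (e.symm i) z (by simpa [relabel] using hz)
    simpa [relabel, move] using this

lemma IsLast.x_le_sub (h : D.IsLast n m L) (i : ι) (hi : i ≠ n) :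
    D.x i + D.len i ≤ L - D.len n := by
  have := h.x_le i hi
  have := h.x_last
  linarith

lemma IsLast.y_le_sub (h : D.IsLast n m L) (i : ι) (hi : i ≠ m) :
    D.y i + D.len i ≤ L - D.len m := by
  have := h.y_le i hi
  have := h.y_last
  linarith

/-- Every orbit in `(0, L)` meets the interval on which Rauzy induction takes place. -/
lemma exists_mem_of_not_mem_induced (h : D.IsLast n m L) (hne : D.len m ≠ D.len n)
    (hT : Realizes T D) {z : ℝ} (hz : z ∈ Ioo 0 L)
    (hz' : z ∉ Ioo 0 (L - min (D.len m) (D.len n))) :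
    (z ∈ T.dom ∧ T.map z ∈ Ioo 0 (L - min (D.len m) (D.len n))) ∨
      ∃ w ∈ T.dom, w ∈ Ioo 0 (L - min (D.len m) (D.len n)) ∧ T.map w = z := by
  have hxn := h.x_last
  have hym := h.y_last
  have hl := h.len_pos
  have hyn := h.y_le_sub n h.ne.symm
  have hxm := h.x_le_sub m h.ne
  have hge : L - min (D.len m) (D.len n) ≤ z := by
    by_contra hlt
    exact hz' ⟨hz.1, not_le.1 hlt⟩
  have hmin := min_le_left (D.len m) (D.len n)
  have hmin' := min_le_right (D.len m) (D.len n)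
  rcases eq_or_ne z (D.x n) with heq | hzn
  · have hlt : D.len n < D.len m := by
      rcases lt_or_gt_of_ne hne with h1 | h1
      · rw [min_eq_left h1.le] at hge
        linarith
      · exact h1
    right
    obtain ⟨w, hw, he⟩ := exists_move_eq (D := D) (i := m) (w := z)
      ⟨by linarith, by linarith [hz.2]⟩
    exact ⟨w, hT.mem_dom hw, ⟨by linarith [hw.1, h.x_nonneg m], by linarith [hw.2]⟩,
      by rw [hT.map m w hw, he]⟩
  · left
    have hzI : z ∈ Ioo (D.x n) (D.x n + D.len n) :=
      ⟨lt_of_le_of_ne (by linarith) hzn.symm, by linarith [hz.2]⟩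
    have hm := move_mem hzI
    refine ⟨hT.mem_dom hzI, ?_⟩
    rw [hT.map n z hzI]
    exact ⟨by linarith [hm.1, h.y_nonneg n], by linarith [hm.2]⟩

variable [DecidableEq ι]

/-- Only the points of the interval `m` leave the shorter interval under `T`; they return after
passing once more through the interval `n`. -/
lemma isFirstReturnMap_stepA (h : D.IsLast n m L) (hlt : D.len m < D.len n) (hT : Realizes T D)
    (hR : Realizes R (D.stepA n m)) : IsFirstReturnMap T (Ioo 0 (L - D.len m)) R := by
  have hxn := h.x_last
  have hym := h.y_last
  have hx0 := h.x_nonneg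
  have hy0 := h.y_nonneg
  have hl := h.len_pos
  have hyn := h.y_le_sub n h.ne.symm
  apply isFirstReturnMap_of_le_two
  · intro z hz
    rw [hR.dom] at hz
    obtain ⟨i, hz⟩ := mem_iUnion.1 hz
    have hRz := hR.map i z hz
    by_cases hin : i = n
    · subst hin
      simp only [stepA, if_true] at hz
      have hz' : z ∈ Ioo (D.x i) (D.x i + D.len i) := ⟨hz.1, by linarith [hz.2, hl m]⟩
      have hTz := hT.map i z hz'
      have hm := move_mem hz'
      refine ⟨⟨by linarith [hx0 i, hz.1], by linarith [hz.2]⟩, hT.mem_dom hz', Or.inl ⟨?_, ?_⟩⟩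
      · rw [hTz]
        exact ⟨by linarith [hm.1, hy0 i], by linarith [hm.2]⟩
      · rw [hTz, hRz]
        simp only [stepA, move, if_true, if_neg h.ne.symm]
        split_ifs <;> ring
    · by_cases him : i = m
      · subst him
        simp only [stepA, if_neg hin] at hz
        have hTz := hT.map i z hz
        have hm := move_mem hz
        have hm' : D.move i z ∈ Ioo (D.x n) (D.x n + D.len n) :=
          ⟨by linarith [hm.1], by linarith [hm.2]⟩
        have hTz' := hT.map n _ hm'
        have hm2 := move_mem hm'
        have hxi := h.x_le_sub i hin
        refine ⟨⟨by linarith [hx0 i, hz.1], by linarith [hz.2]⟩, hT.mem_dom hz, Or.inr ?_⟩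
        rw [hTz, hTz']
        refine ⟨fun hB => by linarith [hB.2, hm.1], hT.mem_dom hm',
          ⟨by linarith [hm2.1, hy0 n], by linarith [hm2.2]⟩, ?_⟩
        rw [hRz]
        simp only [stepA, move, if_true, if_neg hin]
        rcases Int.units_eq_one_or (D.sign n) with h1 | h1 <;>
          rcases Int.units_eq_one_or (D.sign i) with h2 | h2 <;>
          simp [h1, h2] <;> linarith
      · simp only [stepA, if_neg hin] at hz
        have hTz := hT.map i z hz
        have hm := move_mem hz
        have hxi := h.x_le_sub i hin
        have hyi := h.y_le_sub i him
        refine ⟨⟨by linarith [hx0 i, hz.1], by linarith [hz.2]⟩, hT.mem_dom hz, Or.inl ⟨?_, ?_⟩⟩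
        · rw [hTz]
          exact ⟨by linarith [hm.1, hy0 i], by linarith [hm.2]⟩
        · rw [hTz, hRz]
          simp only [stepA, move, if_neg hin, if_neg him]
  · intro z hzB hz
    left
    rw [hT.dom] at hz
    obtain ⟨i, hz⟩ := mem_iUnion.1 hz
    apply hR.mem_dom (i := i)
    by_cases hin : i = n
    · subst hin
      simp only [stepA, if_true]
      exact ⟨hz.1, by linarith [hzB.2]⟩
    · simpa only [stepA, if_neg hin] using hz

/-- Only the points of one of the two parts of the interval `m` leave the shorter interval
under `T`; they fall on the interval `n`, whose image lies in the shorter interval. -/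
lemma isFirstReturnMap_stepB (h : D.IsLast n m L) (hlt : D.len n < D.len m) (hT : Realizes T D)
    (hR : Realizes R (D.stepB n m)) : IsFirstReturnMap T (Ioo 0 (L - D.len n)) R := by
  have hxn := h.x_last
  have hym := h.y_last
  have hx0 := h.x_nonneg
  have hy0 := h.y_nonneg
  have hl := h.len_pos
  have hyn := h.y_le_sub n h.ne.symm
  have hxm := h.x_le_sub m h.ne
  have hcut : ∀ z ∈ T.dom, z ≠ L - D.len n := by
    intro z hz he
    rw [hT.dom] at hz
    obtain ⟨i, hz⟩ := mem_iUnion.1 hz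
    by_cases hin : i = n
    · subst hin
      linarith [hz.1]
    · linarith [hz.2, h.x_le_sub i hin]
  apply isFirstReturnMap_of_le_two
  · intro z hz
    rw [hR.dom] at hz
    obtain ⟨i, hz⟩ := mem_iUnion.1 hz
    have hRz := hR.map i z hz
    by_cases him : i = m
    · subst him
      simp only [stepB, if_true] at hz
      have hz' : z ∈ Ioo (D.x i) (D.x i + D.len i) := by
        split_ifs at hz <;> exact ⟨by linarith [hz.1, hl n], by linarith [hz.2, hl n]⟩
      have hTz := hT.map i z hz'
      have hm := move_mem hz'
      refine ⟨⟨by linarith [hx0 i, hz'.1], by linarith [hz'.2]⟩, hT.mem_dom hz',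
        Or.inl ⟨?_, ?_⟩⟩
      · rw [hTz]
        refine ⟨by linarith [hm.1, hy0 i], ?_⟩
        unfold move
        split_ifs at hz ⊢ <;> linarith [hz.1, hz.2]
      · rw [hTz, hRz]
        simp only [stepB, move, if_true, if_neg h.ne]
        split_ifs <;> ring
    · by_cases hin : i = n
      · subst hin
        simp only [stepB, if_neg him, if_true] at hz
        have hz' : z ∈ Ioo (D.x m) (D.x m + D.len m) := by
          split_ifs at hz <;> exact ⟨by linarith [hz.1, hl i], by linarith [hz.2, hl i]⟩
        have hTz := hT.map m z hz'
        have hm := move_mem hz'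
        have hm' : D.move m z ∈ Ioo (D.x i) (D.x i + D.len i) := by
          refine ⟨?_, by linarith [hm.2]⟩
          unfold move
          split_ifs at hz ⊢ <;> linarith [hz.1, hz.2]
        have hTz' := hT.map i _ hm'
        have hm2 := move_mem hm'
        refine ⟨⟨by linarith [hx0 m, hz'.1], by linarith [hz'.2]⟩, hT.mem_dom hz', Or.inr ?_⟩
        rw [hTz, hTz']
        refine ⟨fun hB => by linarith [hB.2, hm'.1], hT.mem_dom hm',
          ⟨by linarith [hm2.1, hy0 i], by linarith [hm2.2]⟩, ?_⟩
        rw [hRz]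
        simp only [stepB, move, if_true, if_neg him]
        rcases Int.units_eq_one_or (D.sign m) with h1 | h1 <;>
          rcases Int.units_eq_one_or (D.sign i) with h2 | h2 <;>
          simp [h1, h2] <;> linarith
      · simp only [stepB, if_neg hin, if_neg him] at hz
        have hTz := hT.map i z hz
        have hm := move_mem hz
        have hxi := h.x_le_sub i hin
        have hyi := h.y_le_sub i him
        refine ⟨⟨by linarith [hx0 i, hz.1], by linarith [hz.2]⟩, hT.mem_dom hz, Or.inl ⟨?_, ?_⟩⟩
        · rw [hTz]
          exact ⟨by linarith [hm.1, hy0 i], by linarith [hm.2]⟩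
        · rw [hTz, hRz]
          simp only [stepB, move, if_neg hin, if_neg him]
  · intro z hzB hz
    rw [hT.dom] at hz
    obtain ⟨i, hz⟩ := mem_iUnion.1 hz
    by_cases hin : i = n
    · subst hin
      linarith [hz.1, hzB.2]
    by_cases him : i = m
    · subst him
      have hTz := hT.map i z hz
      -- the point that falls on the left end of the last domain interval never returns
      by_cases hc : D.move i z = L - D.len n
      · right
        rw [hTz]
        exact ⟨fun hB => by linarith [hB.2], fun hd => hcut _ hd hc⟩
      left
      unfold move at hc
      by_cases hs : D.sign i = 1
      · rw [if_pos hs] at hc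
        rcases lt_or_gt_of_ne hc with hc | hc
        · apply hR.mem_dom (i := i)
          simp only [stepB, if_true, if_pos hs]
          exact ⟨hz.1, by linarith⟩
        · apply hR.mem_dom (i := n)
          simp only [stepB, if_neg h.ne.symm, if_true, if_pos hs]
          exact ⟨by linarith, by linarith [hz.2]⟩
      · rw [if_neg hs] at hc
        rcases lt_or_gt_of_ne hc with hc | hc
        · apply hR.mem_dom (i := i)
          simp only [stepB, if_true, if_neg hs]
          exact ⟨by linarith, by linarith [hz.2]⟩
        · apply hR.mem_dom (i := n)
          simp only [stepB, if_neg h.ne.symm, if_true, if_neg hs]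
          exact ⟨by linarith [hz.1], by linarith⟩
    · left
      apply hR.mem_dom (i := i)
      simpa only [stepB, if_neg hin, if_neg him] using hz

end Gluing

/-! ### Functions that are equivariant under a gluing -/

namespace Gluing

variable {ι : Type*}

/-- The increments of `F` over subintervals of the interval `i` agree with the increments over
their images.  This is the property of the distribution function of an invariant measure without
atoms. -/
def Equivariant (D : Gluing ι) (F : ℝ → ℝ) : Prop :=
  ∀ i t, 0 ≤ t → t ≤ D.len i → F (D.y i + t) - F (D.y i) =
    if D.sign i = 1 then F (D.x i + t) - F (D.x i)
    else F (D.x i + D.len i) - F (D.x i + D.len i - t)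

/-- `F` vanishes at all the endpoints of the exchanged intervals and of their images. -/
def VanishesAtEnds (D : Gluing ι) (F : ℝ → ℝ) : Prop :=
  ∀ i, F (D.x i) = 0 ∧ F (D.x i + D.len i) = 0 ∧ F (D.y i) = 0 ∧ F (D.y i + D.len i) = 0

/-- The increments of `F` over the exchanged intervals. -/
def incr (D : Gluing ι) (F : ℝ → ℝ) (i : ι) : ℝ := F (D.x i + D.len i) - F (D.x i)

variable {D : Gluing ι} {n m : ι} {L : ℝ} {F : ℝ → ℝ}

lemma Equivariant.relabel (hF : D.Equivariant F) (e : Equiv.Perm ι) :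
    (D.relabel e).Equivariant F := fun i t h0 h1 => hF (e i) t h0 h1

lemma VanishesAtEnds.relabel (hF : D.VanishesAtEnds F) (e : Equiv.Perm ι) :
    (D.relabel e).VanishesAtEnds F := fun i => hF (e i)

/-- The equivariance relation for a subinterval that need not be adjacent to an endpoint. -/
lemma Equivariant.sub (hF : D.Equivariant F) {i : ι} {s t : ℝ} (hs : 0 ≤ s) (hst : s ≤ t)
    (ht : t ≤ D.len i) : F (D.y i + t) - F (D.y i + s) =
      if D.sign i = 1 then F (D.x i + t) - F (D.x i + s)
      else F (D.x i + D.len i - s) - F (D.x i + D.len i - t) := by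
  have h1 := hF i t (hs.trans hst) ht
  have h2 := hF i s hs (hst.trans ht)
  split_ifs at h1 h2 ⊢ <;> linarith

lemma Equivariant.image_incr (hF : D.Equivariant F) {i : ι} (hi : 0 ≤ D.len i) :
    F (D.y i + D.len i) - F (D.y i) = D.incr F i := by
  have := hF i (D.len i) hi le_rfl
  rw [this, incr]
  split_ifs
  · rfl
  · rw [add_sub_cancel_right]

variable [DecidableEq ι]

lemma Equivariant.stepA (hF : D.Equivariant F) (h : D.IsLast n m L) (hlt : D.len m < D.len n) :
    (D.stepA n m).Equivariant F := by
  have hxn := h.x_last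
  have hym := h.y_last
  have hl := h.len_pos
  intro i t h0 h1
  by_cases hin : i = n
  · subst hin
    simp only [Gluing.stepA, if_true, if_neg h.ne.symm] at h1 ⊢
    have hl' := hl m
    rcases Int.units_eq_one_or (D.sign i) with hs | hs
    · simpa [hs] using hF i t h0 (by linarith)
    · have := hF.sub (i := i) (s := D.len m) (t := D.len m + t) hl'.le (by linarith) (by linarith)
      simp [hs] at this ⊢
      convert this using 3 <;> ring
  · by_cases him : i = m
    · subst him
      simp only [Gluing.stepA, if_true, if_neg hin] at h1 ⊢
      have hi := hF i t h0 h1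
      have hi' := hF.sub (i := i) (s := D.len i - t) (t := D.len i) (by linarith) (by linarith)
        le_rfl
      have e1 : D.x i + D.len i - (D.len i - t) = D.x i + t := by ring
      have e2 : D.x i + D.len i - D.len i = D.x i := by ring
      have e3 : D.x i + (D.len i - t) = D.x i + D.len i - t := by ring
      rw [e1, e2, e3] at hi'
      have hn := hF.sub (i := n) (s := D.len n - D.len i) (t := D.len n - D.len i + t)
        (by linarith) (by linarith) (by linarith)
      have hn' := hF n t h0 (by linarith)
      have e4 : D.x n + (D.len n - D.len i) = D.y i := by linarith
      have e5 : D.x n + (D.len n - D.len i + t) = D.y i + t := by linarith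
      have e6 : D.x n + D.len n = D.y i + D.len i := by linarith
      have e7 : D.y i + D.len i - t = D.y i + (D.len i - t) := by ring
      have e8 : D.y n + (D.len n - D.len i + t) = D.y n + D.len n - D.len i + t := by ring
      have e9 : D.y n + (D.len n - D.len i) = D.y n + D.len n - D.len i := by ring
      rw [e4, e5, e8, e9] at hn
      rw [e6, e7] at hn'
      rcases Int.units_eq_one_or (D.sign n) with h1 | h1 <;>
        rcases Int.units_eq_one_or (D.sign i) with h2 | h2 <;>
        simp [h1, h2] at hi hi' hn hn' ⊢ <;> linarith
    · simp only [Gluing.stepA, if_neg hin, if_neg him] at h1 ⊢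
      exact hF i t h0 h1

lemma Equivariant.stepB (hF : D.Equivariant F) (h : D.IsLast n m L) (hlt : D.len n < D.len m) :
    (D.stepB n m).Equivariant F := by
  have hxn := h.x_last
  have hym := h.y_last
  have hl := h.len_pos
  intro i t h0 h1
  by_cases him : i = m
  · subst him
    simp only [Gluing.stepB, if_true, if_neg h.ne] at h1 ⊢
    have hl' := hl n
    have := hF i t h0 (by linarith)
    rcases Int.units_eq_one_or (D.sign i) with hs | hs
    · simpa [hs] using this
    · simp [hs] at this ⊢
      convert this using 3
  · by_cases hin : i = n
    · subst hin
      simp only [Gluing.stepB, if_true, if_neg him] at h1 ⊢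
      have hi := hF i t h0 h1
      -- the domain interval of `i` is the right end of the image interval of `m`
      have hm := hF.sub (i := m) (s := D.len m - D.len i) (t := D.len m - D.len i + t)
        (by linarith) (by linarith) (by linarith)
      have hm' := hF.sub (i := m) (s := D.len m - t) (t := D.len m)
        (by linarith) (by linarith) le_rfl
      have e1 : D.y m + (D.len m - D.len i + t) = D.x i + t := by linarith
      have e2 : D.y m + (D.len m - D.len i) = D.x i := by linarith
      have e3 : D.y m + D.len m = D.x i + D.len i := by linarith
      have e4 : D.y m + (D.len m - t) = D.x i + D.len i - t := by linarith
      have e5 : D.x m + D.len m - (D.len m - D.len i) = D.x m + D.len i := by ring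
      have e6 : D.x m + D.len m - (D.len m - D.len i + t) = D.x m + D.len i - t := by ring
      have e7 : D.x m + (D.len m - D.len i + t) = D.x m + D.len m - D.len i + t := by ring
      have e8 : D.x m + (D.len m - D.len i) = D.x m + D.len m - D.len i := by ring
      have e9 : D.x m + D.len m - (D.len m - t) = D.x m + t := by ring
      have e10 : D.x m + D.len m - D.len m = D.x m := by ring
      have e11 : D.x m + (D.len m - t) = D.x m + D.len m - t := by ring
      have e12 : D.x m + D.len m - D.len i + D.len i = D.x m + D.len m := by ring
      rw [e1, e2, e5, e6, e7, e8] at hm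
      rw [e3, e4, e9, e10, e11] at hm'
      rcases Int.units_eq_one_or (D.sign m) with h1 | h1 <;>
        rcases Int.units_eq_one_or (D.sign i) with h2 | h2 <;>
        simp [h1, h2, e12] at hi hm hm' ⊢ <;> linarith
    · simp only [Gluing.stepB, if_neg hin, if_neg him] at h1 ⊢
      exact hF i t h0 h1

lemma VanishesAtEnds.stepA (hN : D.VanishesAtEnds F) (hF : D.Equivariant F) (h : D.IsLast n m L)
    (hlt : D.len m < D.len n) : (D.stepA n m).VanishesAtEnds F := by
  have hxn := h.x_last
  have hym := h.y_last
  have hl := h.len_pos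
  have e1 : D.x n + (D.len n - D.len m) = D.y m := by linarith
  have e1' : D.x n + D.len n - D.len m = D.y m := by linarith
  have hn1 := hF n (D.len m) (hl m).le hlt.le
  have hn2 := hF n (D.len n - D.len m) (by linarith) (by linarith [hl m])
  obtain ⟨a1, a2, a3, a4⟩ := hN n
  obtain ⟨b1, b2, b3, b4⟩ := hN m
  intro i
  by_cases hin : i = n
  · subst hin
    simp only [Gluing.stepA, if_true]
    rw [e1] at hn2 ⊢
    rw [e1'] at hn1
    rcases Int.units_eq_one_or (D.sign i) with hs | hs
    · simp [hs] at hn1 hn2 ⊢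
      exact ⟨a1, b3, a3, by linarith⟩
    · simp [hs] at hn1 hn2 ⊢
      exact ⟨a1, b3, by linarith, a4⟩
  · by_cases him : i = m
    · subst him
      simp only [Gluing.stepA, if_true, if_neg hin]
      rw [e1] at hn2
      rw [e1'] at hn1
      rcases Int.units_eq_one_or (D.sign n) with hs | hs
      · simp [hs] at hn1 hn2 ⊢
        rw [show D.y n + D.len n - D.len i = D.y n + (D.len n - D.len i) by ring]
        exact ⟨b1, b2, by linarith, a4⟩
      · simp [hs] at hn1 hn2 ⊢
        exact ⟨b1, b2, a3, by linarith⟩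
    · simpa only [Gluing.stepA, if_neg hin, if_neg him] using hN i

lemma VanishesAtEnds.stepB (hN : D.VanishesAtEnds F) (hF : D.Equivariant F) (h : D.IsLast n m L)
    (hlt : D.len n < D.len m) : (D.stepB n m).VanishesAtEnds F := by
  have hxn := h.x_last
  have hym := h.y_last
  have hl := h.len_pos
  have e1 : D.y m + (D.len m - D.len n) = D.x n := by linarith
  have hm := hF m (D.len m - D.len n) (by linarith) (by linarith [hl n])
  obtain ⟨a1, a2, a3, a4⟩ := hN n
  obtain ⟨b1, b2, b3, b4⟩ := hN m
  rw [e1] at hm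
  have e2 : D.x m + (D.len m - D.len n) = D.x m + D.len m - D.len n := by ring
  have e3 : D.x m + D.len m - (D.len m - D.len n) = D.x m + D.len n := by ring
  rw [e2, e3] at hm
  intro i
  by_cases him : i = m
  · subst him
    simp only [Gluing.stepB, if_true]
    rw [e1]
    rcases Int.units_eq_one_or (D.sign i) with hs | hs
    · simp [hs] at hm ⊢
      rw [e2]
      exact ⟨b1, by linarith, b3, a1⟩
    · simp [hs] at hm ⊢
      exact ⟨by linarith, b2, b3, a1⟩
  · by_cases hin : i = n
    · subst hin
      simp only [Gluing.stepB, if_true, if_neg him]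
      rcases Int.units_eq_one_or (D.sign m) with hs | hs
      · simp [hs] at hm ⊢
        exact ⟨by linarith, b2, a3, a4⟩
      · simp [hs] at hm ⊢
        exact ⟨b1, by linarith, a3, a4⟩
    · simpa only [Gluing.stepB, if_neg hin, if_neg him] using hN i

lemma Equivariant.incr_stepA (hF : D.Equivariant F) (h : D.IsLast n m L) :
    (D.stepA n m).incr F = Function.update (D.incr F) n (D.incr F n - D.incr F m) := by
  have hm := hF.image_incr (h.len_pos m).le
  have hxn := h.x_last
  have hym := h.y_last
  have e1 : D.x n + (D.len n - D.len m) = D.y m := by linarith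
  have e2 : D.x n + D.len n = D.y m + D.len m := by linarith
  funext i
  by_cases hin : i = n
  · subst hin
    rw [Function.update_self, ← hm]
    simp only [incr, Gluing.stepA, if_true]
    rw [e1, e2]
    ring
  · rw [Function.update_of_ne hin]
    simp only [incr, Gluing.stepA, if_neg hin]

lemma Equivariant.incr_stepB (hF : D.Equivariant F) (h : D.IsLast n m L)
    (hlt : D.len n < D.len m) :
    (D.stepB n m).incr F = Function.update (D.incr F) m (D.incr F m - D.incr F n) := by
  have hxn := h.x_last
  have hym := h.y_last
  have hn := h.len_pos n
  have hi := hF.image_incr (h.len_pos m).le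
  have hm := hF m (D.len m - D.len n) (by linarith) (by linarith [h.len_pos n])
  have e1 : D.y m + (D.len m - D.len n) = D.x n := by linarith
  have e3 : D.y m + D.len m = D.x n + D.len n := by linarith
  have e5 : D.x m + D.len n + (D.len m - D.len n) = D.x m + D.len m := by ring
  have e6 : D.x m + (D.len m - D.len n) = D.x m + D.len m - D.len n := by ring
  have e7 : D.x m + D.len m - (D.len m - D.len n) = D.x m + D.len n := by ring
  have e8 : D.x m + D.len m - D.len n + D.len n = D.x m + D.len m := by ring
  rw [e1, e6, e7] at hm
  rw [e3] at hi
  unfold incr at hi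
  funext i
  by_cases him : i = m
  · subst him
    rw [Function.update_self]
    simp only [incr, Gluing.stepB, if_true]
    rcases Int.units_eq_one_or (D.sign i) with hs | hs <;> simp [hs, e5, e6] at hm ⊢ <;> linarith
  · rw [Function.update_of_ne him]
    by_cases hin : i = n
    · subst hin
      simp only [incr, Gluing.stepB, if_true, if_neg him]
      rcases Int.units_eq_one_or (D.sign m) with hs | hs <;> simp [hs, e8] at hm ⊢ <;> linarith
    · simp only [incr, Gluing.stepB, if_neg hin, if_neg him]

omit [DecidableEq ι] in
/-- An equivariant function that vanishes at the ends of an interval takes equal or opposite values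
at a point and at its image, so that its values are attained, up to sign, in the shorter interval of
the induction. -/
lemma Equivariant.exists_abs_eq (hF : D.Equivariant F) (hN : D.VanishesAtEnds F)
    (h : D.IsLast n m L) (hne : D.len m ≠ D.len n) {z : ℝ} (hz : z ∈ Icc 0 L) :
    ∃ w ∈ Icc 0 (L - min (D.len m) (D.len n)), |F w| = |F z| := by
  have hxn := h.x_last
  have hym := h.y_last
  have hl := h.len_pos
  have hyn := h.y_le_sub n h.ne.symm
  have hxm := h.x_le_sub m h.ne
  have hx0 := h.x_nonneg
  have hy0 := h.y_nonneg
  by_cases hzc : z ≤ L - min (D.len m) (D.len n)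
  · exact ⟨z, ⟨hz.1, hzc⟩, rfl⟩
  push Not at hzc
  obtain ⟨a1, a2, a3, a4⟩ := hN n
  obtain ⟨b1, b2, b3, b4⟩ := hN m
  rcases lt_or_gt_of_ne hne with hlt | hlt
  · rw [min_eq_left hlt.le] at hzc ⊢
    have hm := hF m (z - D.y m) (by linarith) (by linarith [hz.2])
    rw [add_sub_cancel] at hm
    rcases Int.units_eq_one_or (D.sign m) with hs | hs <;> simp [hs] at hm
    · exact ⟨D.x m + (z - D.y m), ⟨by linarith [hx0 m], by linarith [hz.2]⟩,
        by congr 1; linarith⟩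
    · exact ⟨D.x m + D.len m - (z - D.y m), ⟨by linarith [hx0 m, hz.2], by linarith [hl m]⟩,
        by rw [← abs_neg]; congr 1; linarith⟩
  · rw [min_eq_right hlt.le] at hzc ⊢
    rcases Int.units_eq_one_or (D.sign n) with hs | hs
    · have hn := hF n (z - D.x n) (by linarith) (by linarith [hz.2])
      rw [add_sub_cancel] at hn
      simp [hs] at hn
      exact ⟨D.y n + (z - D.x n), ⟨by linarith [hy0 n], by linarith [hz.2]⟩,
        by congr 1; linarith⟩
    · have hn := hF n (D.x n + D.len n - z) (by linarith [hz.2]) (by linarith)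
      rw [sub_sub_cancel] at hn
      simp [hs] at hn
      exact ⟨D.y n + (D.x n + D.len n - z), ⟨by linarith [hy0 n, hz.2], by linarith [hl n]⟩,
        by rw [← abs_neg]; congr 1; linarith⟩

end Gluing

/-! ### Interval exchanges as gluings -/

section
variable {n : ℕ} {l : Fin n → ℝ}

lemma sum_lt_add_le_sum_lt (hl : ∀ i, 0 ≤ l i) (f : Equiv.Perm (Fin n)) {i k : Fin n}
    (hik : f i < f k) : (∑ j with f j < f i, l j) + l i ≤ ∑ j with f j < f k, l j := by
  rw [add_comm, ← Finset.sum_insert (s := Finset.univ.filter fun j => f j < f i) (a := i) (by simp)]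
  apply Finset.sum_le_sum_of_subset_of_nonneg
  · intro j hj
    simp only [Finset.mem_insert, Finset.mem_filter, Finset.mem_univ, true_and] at hj ⊢
    rcases hj with rfl | hj
    · exact hik
    · exact hj.trans hik
  · exact fun j _ _ => hl j

lemma sum_lt_add_eq_sum (f : Equiv.Perm (Fin n)) {i : Fin n} (hi : ∀ k, f k ≤ f i) :
    (∑ j with f j < f i, l j) + l i = ∑ j, l j := by
  rw [add_comm, ← Finset.sum_insert (s := Finset.univ.filter fun j => f j < f i) (a := i) (by simp)]
  apply Finset.sum_congr _ fun _ _ => rfl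
  ext j
  simp only [Finset.mem_insert, Finset.mem_filter, Finset.mem_univ, true_and, iff_true]
  rcases (hi j).eq_or_lt with h | h
  · exact Or.inl (f.injective h)
  · exact Or.inr h

/-- The gluing that describes the interval exchange `𝓔(l, p)`. -/
def gluing (l : Fin n → ℝ) (p : SignedPerm n) : Gluing (Fin n) :=
  ⟨leftEnd l, imageLeftEnd l p, l, p.sign⟩

lemma leftEnd_add_le (hl : ∀ i, 0 ≤ l i) {i k : Fin n} (hik : i < k) :
    leftEnd l i + l i ≤ leftEnd l k :=
  sum_lt_add_le_sum_lt hl (Equiv.refl _) hik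

lemma subinterval_disjoint (hl : ∀ i, 0 ≤ l i) {i k : Fin n} (hik : i ≠ k) :
    Disjoint (subinterval l i) (subinterval l k) := by
  rw [Set.disjoint_left]
  rintro z ⟨h1, h2⟩ ⟨h3, h4⟩
  rcases lt_or_gt_of_ne hik with h | h
  · linarith [leftEnd_add_le hl h]
  · linarith [leftEnd_add_le hl h]

lemma realizes_exchange (hl : ∀ i, 0 ≤ l i) (p : SignedPerm n) :
    Gluing.Realizes (exchange l p) (gluing l p) where
  dom := rfl
  map i z hz := by
    change z ∈ subinterval l i at hz
    simp only [exchange]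
    rw [Finset.sum_eq_single i]
    · rw [indicator_of_mem hz]
      rfl
    · intro k _ hk
      rw [indicator_of_notMem]
      exact fun hzk => Set.disjoint_left.1 (subinterval_disjoint hl hk) hzk hz
    · simp

end

lemma isLast_gluing {n : ℕ} {l : Fin (n + 1) → ℝ} (hl : ∀ i, 0 < l i) (p : SignedPerm (n + 1))
    (hp : p.top ≠ Fin.last n) : (gluing l p).IsLast (Fin.last n) p.top (∑ i, l i) := by
  have hl' : ∀ i, 0 ≤ l i := fun i => (hl i).le
  have htop : p.perm p.top = Fin.last n := p.perm.apply_symm_apply _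
  refine ⟨hp, hl, fun i => ?_, fun i => ?_, ?_, ?_, ?_, ?_⟩
  · simp only [gluing, leftEnd]
    exact Finset.sum_nonneg' hl'
  · simp only [gluing, imageLeftEnd]
    exact Finset.sum_nonneg' hl'
  · exact fun i hi => leftEnd_add_le hl' (Fin.lt_last_iff_ne_last.2 hi)
  · intro i hi
    apply sum_lt_add_le_sum_lt hl'
    rw [htop, Fin.lt_last_iff_ne_last]
    exact fun h => hi (p.perm.injective (h.trans htop.symm))
  · exact sum_lt_add_eq_sum (Equiv.refl _) fun k => Fin.le_last k
  · exact sum_lt_add_eq_sum p.perm fun k => by rw [htop]; exact Fin.le_last _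

/-! ### Renormalizable exchanges -/

section
variable {ι : Type*} [DecidableEq ι] [Fintype ι]

/-- Rauzy induction sends the exchange `D` of `[0, L]` to the exchange `D'` of `[0, L']`, after a
permutation of the labels, and the matrix `A` computes increments over the old intervals from
increments over the new ones. -/
def RauzyRel (A : Matrix ι ι ℝ) (D : Gluing ι) (L : ℝ) (D' : Gluing ι) (L' : ℝ) : Prop :=
  ∃ (n m : ι) (e : Equiv.Perm ι), D.IsLast n m L ∧ L' = L - min (D.len m) (D.len n) ∧
    ((D.len m < D.len n ∧ D' = (D.stepA n m).relabel e ∧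
        ∀ v, v = A.mulVec (Function.update v n (v n - v m) ∘ e)) ∨
      (D.len n < D.len m ∧ D' = (D.stepB n m).relabel e ∧
        ∀ v, v = A.mulVec (Function.update v m (v m - v n) ∘ e)))

namespace RauzyRel

variable {A : Matrix ι ι ℝ} {D D' : Gluing ι} {L L' : ℝ} {F : ℝ → ℝ}

lemma isFirstReturnMap (h : RauzyRel A D L D' L') {T R : PartialMap ℝ} (hT : Gluing.Realizes T D)
    (hR : Gluing.Realizes R D') : IsFirstReturnMap T (Ioo 0 L') R := by
  obtain ⟨n, m, e, hD, rfl, ⟨hlt, rfl, -⟩ | ⟨hlt, rfl, -⟩⟩ := h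
  · rw [min_eq_left hlt.le]
    exact Gluing.isFirstReturnMap_stepA hD hlt hT hR.of_relabel
  · rw [min_eq_right hlt.le]
    exact Gluing.isFirstReturnMap_stepB hD hlt hT hR.of_relabel

lemma exists_mem (h : RauzyRel A D L D' L') {T : PartialMap ℝ} (hT : Gluing.Realizes T D) {z : ℝ}
    (hz : z ∈ Ioo 0 L) (hz' : z ∉ Ioo 0 L') :
    (z ∈ T.dom ∧ T.map z ∈ Ioo 0 L') ∨ ∃ w ∈ T.dom, w ∈ Ioo 0 L' ∧ T.map w = z := by
  obtain ⟨n, m, e, hD, rfl, h⟩ := h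
  refine Gluing.exists_mem_of_not_mem_induced hD ?_ hT hz hz'
  rcases h with ⟨hlt, -⟩ | ⟨hlt, -⟩
  · exact hlt.ne
  · exact hlt.ne'

lemma equivariant (h : RauzyRel A D L D' L') (hF : D.Equivariant F) : D'.Equivariant F := by
  obtain ⟨n, m, e, hD, rfl, ⟨hlt, rfl, -⟩ | ⟨hlt, rfl, -⟩⟩ := h
  · exact (hF.stepA hD hlt).relabel e
  · exact (hF.stepB hD hlt).relabel e

lemma vanishesAtEnds (h : RauzyRel A D L D' L') (hF : D.Equivariant F)
    (hN : D.VanishesAtEnds F) : D'.VanishesAtEnds F := by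
  obtain ⟨n, m, e, hD, rfl, ⟨hlt, rfl, -⟩ | ⟨hlt, rfl, -⟩⟩ := h
  · exact (hN.stepA hF hD hlt).relabel e
  · exact (hN.stepB hF hD hlt).relabel e

lemma exists_abs_eq (h : RauzyRel A D L D' L') (hF : D.Equivariant F) (hN : D.VanishesAtEnds F)
    {z : ℝ} (hz : z ∈ Icc 0 L) : ∃ w ∈ Icc 0 L', |F w| = |F z| := by
  obtain ⟨n, m, e, hD, rfl, h⟩ := h
  refine hF.exists_abs_eq hN hD ?_ hz
  rcases h with ⟨hlt, -⟩ | ⟨hlt, -⟩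
  · exact hlt.ne
  · exact hlt.ne'

lemma incr_eq (h : RauzyRel A D L D' L') (hF : D.Equivariant F) :
    D.incr F = A.mulVec (D'.incr F) := by
  obtain ⟨n, m, e, hD, rfl, ⟨hlt, rfl, hA⟩ | ⟨hlt, rfl, hA⟩⟩ := h
  · have := hF.incr_stepA hD
    conv_lhs => rw [hA (D.incr F)]
    rw [← this]
    rfl
  · have := hF.incr_stepB hD hlt
    conv_lhs => rw [hA (D.incr F)]
    rw [← this]
    rfl

lemma apply_end_eq_zero (h : RauzyRel A D L D' L') (hN : D.VanishesAtEnds F) : F L = 0 := by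
  obtain ⟨n, m, e, hD, -⟩ := h
  rw [← hD.x_last]
  exact (hN n).2.1

lemma pos (h : RauzyRel A D L D' L') : 0 < L := by
  obtain ⟨n, m, e, hD, -⟩ := h
  rw [← hD.x_last]
  linarith [hD.x_nonneg n, hD.len_pos n]

lemma le (h : RauzyRel A D L D' L') : L' ≤ L := by
  obtain ⟨n, m, e, hD, rfl, -⟩ := h
  linarith [le_min (hD.len_pos m).le (hD.len_pos n).le]

lemma len_pos (h : RauzyRel A D L D' L') (i : ι) : 0 < D.len i := by
  obtain ⟨n, m, e, hD, -⟩ := h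
  exact hD.len_pos i

end RauzyRel

/-- `T 0` is an interval exchange on which Rauzy induction can be iterated forever, producing the
maps `T j` on `[0, L j]`, with lengths that tend to `0`. -/
structure IsRenormalizable (T : ℕ → PartialMap ℝ) (D : ℕ → Gluing ι) (L : ℕ → ℝ)
    (A : ℕ → Matrix ι ι ℝ) : Prop where
  realizes : ∀ j, Gluing.Realizes (T j) (D j)
  rel : ∀ j, RauzyRel (A j) (D j) (L j) (D (j + 1)) (L (j + 1))
  tendsto : Filter.Tendsto L Filter.atTop (nhds 0)

/-- The set `O` is a union of orbits of `T`. -/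
def IsSaturated {X : Type*} (T : PartialMap X) (O : Set X) : Prop :=
  ∀ x ∈ T.dom, T.map x ∈ O ↔ x ∈ O

lemma IsSaturated.iterate {X : Type*} {T : PartialMap X} {O : Set X} (hO : IsSaturated T O)
    {k : ℕ} {x : X} (hx : T.InIterDom k x) : T.map^[k] x ∈ O ↔ x ∈ O := by
  induction k with
  | zero => rfl
  | succ k ih =>
    rw [Function.iterate_succ_apply', hO _ (hx k (Nat.lt_succ_self k)),
      ih fun j hj => hx j (by omega)]

lemma IsSaturated.firstReturn {X : Type*} {T R : PartialMap X} {O B : Set X}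
    (hO : IsSaturated T O) (hR : IsFirstReturnMap T B R) : IsSaturated R O := by
  intro x hx
  obtain ⟨hB, k, hk⟩ := (hR.1 x).1 hx
  rw [hR.2 x hB k hk, hO.iterate hk.2.1]

namespace IsRenormalizable

variable {T : ℕ → PartialMap ℝ} {D : ℕ → Gluing ι} {L : ℕ → ℝ} {A : ℕ → Matrix ι ι ℝ}
  {F : ℝ → ℝ}

lemma isSaturated (h : IsRenormalizable T D L A) {O : Set ℝ} (hO : IsSaturated (T 0) O) (j : ℕ) :
    IsSaturated (T j) O := by
  induction j with
  | zero => exact hO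
  | succ j ih => exact ih.firstReturn ((h.rel j).isFirstReturnMap (h.realizes j) (h.realizes _))

/-- A union of orbits that meets the open interval meets all the intervals of the successive
inductions. -/
lemma exists_mem_of_isSaturated (h : IsRenormalizable T D L A) {O : Set ℝ}
    (hO : IsSaturated (T 0) O) (hne : ∃ x ∈ O, x ∈ Ioo 0 (L 0)) (j : ℕ) :
    ∃ x ∈ O, x ∈ Ioo 0 (L j) := by
  induction j with
  | zero => exact hne
  | succ j ih =>
    obtain ⟨x, hxO, hx⟩ := ih
    by_cases hx' : x ∈ Ioo 0 (L (j + 1))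
    · exact ⟨x, hxO, hx'⟩
    rcases (h.rel j).exists_mem (h.realizes j) hx hx' with ⟨hd, hT⟩ | ⟨w, hd, hw, rfl⟩
    · exact ⟨_, (h.isSaturated hO j x hd).2 hxO, hT⟩
    · exact ⟨w, (h.isSaturated hO j w hd).1 hxO, hw⟩

/-- There are points of `O` in the interval of induction below the smallest positive element of a
finite `O`. -/
lemma infinite_of_isSaturated (h : IsRenormalizable T D L A) {O : Set ℝ}
    (hO : IsSaturated (T 0) O) (hne : ∃ x ∈ O, x ∈ Ioo 0 (L 0)) : O.Infinite := by
  intro hfin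
  have hfin' : (O ∩ Ioi 0).Finite := hfin.subset inter_subset_left
  obtain ⟨x, hxO, hx⟩ := hne
  obtain ⟨y, hy, hmin⟩ := hfin'.exists_minimalFor id _ ⟨x, hxO, hx.1⟩
  obtain ⟨j, hj⟩ := (h.tendsto.eventually (gt_mem_nhds hy.2)).exists
  obtain ⟨w, hwO, hw⟩ := h.exists_mem_of_isSaturated hO ⟨x, hxO, hx⟩ j
  have := hmin (j := w) ⟨hwO, hw.1⟩ (hw.2.trans hj).le
  exact absurd (this.trans_lt (hw.2.trans hj)) (lt_irrefl _)

lemma equivariant (h : IsRenormalizable T D L A) (hF : (D 0).Equivariant F) (j : ℕ) :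
    (D j).Equivariant F := by
  induction j with
  | zero => exact hF
  | succ j ih => exact (h.rel j).equivariant ih

lemma vanishesAtEnds (h : IsRenormalizable T D L A) (hF : (D 0).Equivariant F)
    (hN : (D 0).VanishesAtEnds F) (j : ℕ) : (D j).VanishesAtEnds F := by
  induction j with
  | zero => exact hN
  | succ j ih => exact (h.rel j).vanishesAtEnds (h.equivariant hF j) ih

lemma exists_abs_eq (h : IsRenormalizable T D L A) (hF : (D 0).Equivariant F)
    (hN : (D 0).VanishesAtEnds F) {z : ℝ} (hz : z ∈ Icc 0 (L 0)) (j : ℕ) :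
    ∃ w ∈ Icc 0 (L j), |F w| = |F z| := by
  induction j with
  | zero => exact ⟨z, hz, rfl⟩
  | succ j ih =>
    obtain ⟨w, hw, he⟩ := ih
    obtain ⟨w', hw', he'⟩ :=
      (h.rel j).exists_abs_eq (h.equivariant hF j) (h.vanishesAtEnds hF hN j) hw
    exact ⟨w', hw', he'.trans he⟩

/-- An increasing equivariant function whose values at the ends of the exchanged intervals are
proportional to the ends themselves is linear: its deviation from linearity at any point is also
attained at points of arbitrarily short intervals `[0, L j]`. -/
lemma eq_mul_of_vanishesAtEnds (h : IsRenormalizable T D L A) (hmono : Monotone F) (h0 : F 0 = 0)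
    {c : ℝ} (hF : (D 0).Equivariant fun x => F x - c * x)
    (hN : (D 0).VanishesAtEnds fun x => F x - c * x) {z : ℝ} (hz : z ∈ Icc 0 (L 0)) :
    F z = c * z := by
  have hbound : ∀ j, |F z - c * z| ≤ 2 * |c| * L j := by
    intro j
    obtain ⟨w, hw, he⟩ := h.exists_abs_eq hF hN hz j
    have hL : F (L j) - c * L j = 0 := (h.rel j).apply_end_eq_zero (h.vanishesAtEnds hF hN j)
    rw [← he]
    have h1 : 0 ≤ F w := h0 ▸ hmono hw.1
    have h2 : F w ≤ F (L j) := hmono hw.2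
    have h3 : |F w| ≤ |c| * L j := by
      rw [abs_of_nonneg h1]
      have := mul_le_mul_of_nonneg_right (le_abs_self c) (h.rel j).pos.le
      linarith
    have h4 : |c * w| ≤ |c| * L j := by
      rw [abs_mul, abs_of_nonneg hw.1]
      exact mul_le_mul_of_nonneg_left hw.2 (abs_nonneg c)
    have := abs_sub (F w) (c * w)
    linarith
  have hlim : Filter.Tendsto (fun j => 2 * |c| * L j) Filter.atTop (nhds 0) := by
    simpa using h.tendsto.const_mul (2 * |c|)
  have := ge_of_tendsto' hlim hbound
  linarith [abs_eq_zero.1 (le_antisymm this (abs_nonneg _))]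

lemma incr_nonneg (h : IsRenormalizable T D L A) (hmono : Monotone F) (j : ℕ) (i : ι) :
    0 ≤ (D j).incr F i :=
  sub_nonneg.2 (hmono (by linarith [(h.rel j).len_pos i]))

lemma incr_eq (h : IsRenormalizable T D L A) (hF : (D 0).Equivariant F) (j : ℕ) :
    (D j).incr F = (A j).mulVec ((D (j + 1)).incr F) :=
  (h.rel j).incr_eq (h.equivariant hF j)

end IsRenormalizable

end

/-! ### The cycle -/

/-- The signed permutation with one-line notation `f`, inverse permutation `g` and signs `s`. -/
def SignedPerm.mk' (f g : Fin 4 → Fin 4) (s : Fin 4 → ℤˣ) (h : ∀ i, g (f i) = i := by decide)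
    (h' : ∀ i, f (g i) = i := by decide) : SignedPerm 4 :=
  ⟨⟨f, g, h, h'⟩, s⟩

/-- The vertices of the cycle. -/
def cycleVertex : Fin 10 → SignedPerm 4 :=
  ![
    .mk' ![2, 3, 0, 1] ![2, 3, 0, 1] ![-1, 1, 1, -1],
    .mk' ![3, 1, 0, 2] ![2, 1, 3, 0] ![-1, -1, 1, -1],
    .mk' ![2, 3, 1, 0] ![3, 2, 0, 1] ![1, -1, -1, 1],
    .mk' ![3, 1, 2, 0] ![3, 1, 2, 0] ![1, -1, -1, 1],
    .mk' ![3, 0, 1, 2] ![1, 2, 3, 0] ![1, 1, -1, -1],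
    .mk' ![3, 2, 0, 1] ![2, 3, 1, 0] ![1, -1, 1, -1],
    .mk' ![1, 3, 0, 2] ![2, 0, 3, 1] ![-1, -1, 1, -1],
    .mk' ![1, 2, 3, 0] ![3, 0, 1, 2] ![-1, 1, -1, 1],
    .mk' ![2, 3, 1, 0] ![3, 2, 0, 1] ![-1, 1, -1, 1],
    .mk' ![2, 3, 0, 1] ![2, 3, 0, 1] ![-1, 1, 1, -1]]

/-- The types of the edges of the cycle. -/
def cycleType : Fin 9 → EdgeType :=
  ![.a, .b, .a, .b, .b, .a, .b, .a, .b]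

lemma cycleVertex_zero_entry : (cycleVertex 0).entry = ![-3, 4, 1, -2] := by
  decide

lemma irreducible_cycleVertex : ∀ i, (cycleVertex i).Irreducible := by
  intro i k h1 h2 h
  by_contra hne
  have h3 : k < 4 := by omega
  rw [Set.ext_iff] at h
  simp only [mem_image, mem_ofPred_eq] at h
  revert i
  interval_cases k <;> decide

lemma isCycle_cycleVertex : IsCycle cycleVertex cycleType := by
  refine ⟨by norm_num, fun i => ⟨irreducible_cycleVertex _, irreducible_cycleVertex _, ?_⟩, rfl⟩
  revert i
  decide

lemma transMatrix_cycleVertex : ∀ i : Fin 9, (cycleVertex i.castSucc).transMatrix (cycleType i) =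
    (![
    !![1, 0, 0, 0; 0, 1, 0, 0; 0, 0, 1, 0; 0, 1, 0, 1],
    !![1, 1, 0, 0; 0, 0, 1, 0; 0, 0, 0, 1; 1, 0, 0, 0],
    !![1, 0, 0, 0; 0, 1, 0, 0; 0, 0, 1, 0; 0, 1, 0, 1],
    !![1, 1, 0, 0; 0, 0, 1, 0; 0, 0, 0, 1; 0, 1, 0, 0],
    !![1, 1, 0, 0; 0, 0, 1, 0; 0, 0, 0, 1; 0, 1, 0, 0],
    !![1, 0, 0, 0; 0, 1, 0, 0; 0, 0, 1, 0; 1, 0, 0, 1],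
    !![1, 0, 0, 0; 0, 1, 1, 0; 0, 0, 0, 1; 0, 1, 0, 0],
    !![1, 0, 0, 0; 0, 1, 0, 0; 0, 0, 1, 0; 0, 0, 1, 1],
    !![1, 0, 0, 0; 0, 1, 1, 0; 0, 0, 0, 1; 0, 0, 1, 0]] : Fin 9 → Matrix (Fin 4) (Fin 4) ℤ) i := by
  decide

/-- The product matrix of the cycle. -/
abbrev cycleMatrix : Matrix (Fin 4) (Fin 4) ℤ :=
  !![2, 2, 3, 2; 0, 1, 1, 1; 1, 1, 2, 1; 1, 2, 3, 3]

lemma productMatrix_cycleVertex : productMatrix cycleVertex cycleType = cycleMatrix := by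
  unfold productMatrix
  simp only [transMatrix_cycleVertex]
  decide

lemma eventuallyPositive_cycleMatrix : EventuallyPositive cycleMatrix := by
  refine ⟨2, by norm_num, fun i j => ?_⟩
  fin_cases i <;> fin_cases j <;> simp [pow_two]

/-- The label `π⁻¹(4)` of the last interval of the image, at the start of each edge of the cycle. -/
def cycleTop : Fin 9 → Fin 4 := ![1, 0, 1, 0, 0, 0, 1, 2, 1]

/-- The permutation that renumbers the intervals from left to right after each step of the cycle; it
sends a new position to the label before the step.  It is the identity for type `a`; for type `b`,
the interval labelled last now lies next to the interval labelled `cycleTop`. -/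
def cycleRelabel : Fin 9 → Equiv.Perm (Fin 4) :=
  ![1, ⟨![3, 0, 1, 2], ![1, 2, 3, 0], by decide, by decide⟩,
    1, ⟨![0, 3, 1, 2], ![0, 2, 3, 1], by decide, by decide⟩,
    ⟨![0, 3, 1, 2], ![0, 2, 3, 1], by decide, by decide⟩,
    1, ⟨![0, 3, 1, 2], ![0, 2, 3, 1], by decide, by decide⟩,
    1, ⟨![0, 1, 3, 2], ![0, 1, 3, 2], by decide, by decide⟩]

/-- The transition matrix of an edge of the cycle, with real entries. -/
def stepMatrix (r : Fin 9) : Matrix (Fin 4) (Fin 4) ℝ :=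
  ((cycleVertex r.castSucc).transMatrix (cycleType r)).map (fun z : ℤ => (z : ℝ))

lemma cycleVertex_top (r : Fin 9) : (cycleVertex r.castSucc).top = cycleTop r := by
  revert r
  decide

lemma stepMatrix_mulVec (r : Fin 9) (v : Fin 4 → ℝ) : (stepMatrix r).mulVec v =
    (![![v 0, v 1, v 2, v 1 + v 3], ![v 0 + v 1, v 2, v 3, v 0], ![v 0, v 1, v 2, v 1 + v 3],
      ![v 0 + v 1, v 2, v 3, v 1], ![v 0 + v 1, v 2, v 3, v 1], ![v 0, v 1, v 2, v 0 + v 3],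
      ![v 0, v 1 + v 2, v 3, v 1], ![v 0, v 1, v 2, v 2 + v 3], ![v 0, v 1 + v 2, v 3, v 2]] :
      Fin 9 → Fin 4 → ℝ) r := by
  unfold stepMatrix
  rw [transMatrix_cycleVertex]
  funext i
  fin_cases r <;> fin_cases i <;> simp [Matrix.mulVec, dotProduct, Fin.sum_univ_four]

lemma stepMatrix_mulVec_pos (r : Fin 9) {l : Fin 4 → ℝ} (hl : ∀ i, 0 < l i) (i : Fin 4) :
    0 < (stepMatrix r).mulVec l i := by
  have h0 := hl 0
  have h1 := hl 1
  have h2 := hl 2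
  have h3 := hl 3
  rw [stepMatrix_mulVec]
  fin_cases r <;> fin_cases i <;> simp <;> linarith

lemma gluing_apply (l : Fin 4 → ℝ) (p : SignedPerm 4) :
    gluing l p = ⟨![0, l 0, l 0 + l 1, l 0 + l 1 + l 2],
      fun i => (if p.perm 0 < p.perm i then l 0 else 0) +
      (if p.perm 1 < p.perm i then l 1 else 0) + (if p.perm 2 < p.perm i then l 2 else 0) +
      (if p.perm 3 < p.perm i then l 3 else 0), l, p.sign⟩ := by
  ext i
  · simp only [gluing, leftEnd, Finset.sum_filter, Fin.sum_univ_four]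
    fin_cases i <;> simp
  · simp only [gluing, imageLeftEnd, Finset.sum_filter, Fin.sum_univ_four]
  · rfl
  · rfl

lemma cycleVertex_perm (k : Fin 10) (i : Fin 4) : (cycleVertex k).perm i =
    (![![2, 3, 0, 1], ![3, 1, 0, 2], ![2, 3, 1, 0], ![3, 1, 2, 0], ![3, 0, 1, 2], ![3, 2, 0, 1],
      ![1, 3, 0, 2], ![1, 2, 3, 0], ![2, 3, 1, 0], ![2, 3, 0, 1]] :
      Fin 10 → Fin 4 → Fin 4) k i := by
  revert k i
  decide

lemma cycleVertex_sign (k : Fin 10) : (cycleVertex k).sign =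
    (![![-1, 1, 1, -1], ![-1, -1, 1, -1], ![1, -1, -1, 1], ![1, -1, -1, 1], ![1, 1, -1, -1],
      ![1, -1, 1, -1], ![-1, -1, 1, -1], ![-1, 1, -1, 1], ![-1, 1, -1, 1], ![-1, 1, 1, -1]] :
      Fin 10 → Fin 4 → ℤˣ) k := by
  revert k
  decide

set_option maxHeartbeats 1000000 in
/-- For the edges of type `a`, the gluing at the end of the edge results from the gluing at its
start, whose lengths are given by the transition matrix. -/
lemma gluing_stepA (r : Fin 9) (hr : cycleType r = .a) (l : Fin 4 → ℝ) :
    gluing l (cycleVertex r.succ) = ((gluing ((stepMatrix r).mulVec l)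
      (cycleVertex r.castSucc)).stepA 3 (cycleTop r)).relabel (cycleRelabel r) := by
  simp only [gluing_apply, cycleVertex_perm, cycleVertex_sign, stepMatrix_mulVec]
  fin_cases r <;> simp [cycleType] at hr <;> ext i <;> fin_cases i <;>
    simp [Gluing.relabel, Gluing.stepA, cycleTop, cycleRelabel] <;> ring

set_option maxHeartbeats 1000000 in
/-- The analogue of `gluing_stepA` for the edges of type `b`. -/
lemma gluing_stepB (r : Fin 9) (hr : cycleType r = .b) (l : Fin 4 → ℝ) :
    gluing l (cycleVertex r.succ) = ((gluing ((stepMatrix r).mulVec l)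
      (cycleVertex r.castSucc)).stepB 3 (cycleTop r)).relabel (cycleRelabel r) := by
  simp only [gluing_apply, cycleVertex_perm, cycleVertex_sign, stepMatrix_mulVec]
  fin_cases r <;> simp [cycleType] at hr <;> ext i <;> fin_cases i <;>
    simp [Gluing.relabel, Gluing.stepB, cycleTop, cycleRelabel] <;> ring

/-- The matrices of the cycle are those of Rauzy induction on the corresponding exchanges, for
arbitrary positive lengths `l` after the induction step. -/
lemma rauzyRel_cycle (r : Fin 9) {l : Fin 4 → ℝ} (hl : ∀ i, 0 < l i) :
    RauzyRel (stepMatrix r)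
      (gluing ((stepMatrix r).mulVec l) (cycleVertex r.castSucc)) (∑ i, (stepMatrix r).mulVec l i)
      (gluing l (cycleVertex r.succ)) (∑ i, l i) := by
  have h0 := hl 0
  have h1 := hl 1
  have h2 := hl 2
  have h3 := hl 3
  have hlast := isLast_gluing (stepMatrix_mulVec_pos r hl) (cycleVertex r.castSucc)
    (by revert r; decide)
  rw [cycleVertex_top] at hlast
  refine ⟨_, _, cycleRelabel r, hlast, ?_, ?_⟩
  · change ∑ i, l i = _ - min ((stepMatrix r).mulVec l _) ((stepMatrix r).mulVec l _)
    rw [stepMatrix_mulVec, Fin.sum_univ_four, Fin.sum_univ_four]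
    fin_cases r <;> simp [cycleTop, h0.le, h1.le, h2.le, h3.le] <;> ring
  · rcases ht : cycleType r with _ | _
    · refine Or.inl ⟨?_, gluing_stepA r ht l, fun v => ?_⟩
      · change (stepMatrix r).mulVec l _ < (stepMatrix r).mulVec l _
        rw [stepMatrix_mulVec]
        fin_cases r <;> simp [cycleType] at ht <;> simpa [cycleTop]
      · rw [stepMatrix_mulVec]
        funext i
        fin_cases r <;> simp [cycleType] at ht <;> fin_cases i <;>
          simp [cycleTop, cycleRelabel, Function.update]
    · refine Or.inr ⟨?_, gluing_stepB r ht l, fun v => ?_⟩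
      · change (stepMatrix r).mulVec l _ < (stepMatrix r).mulVec l _
        rw [stepMatrix_mulVec]
        fin_cases r <;> simp [cycleType] at ht <;> simpa [cycleTop]
      · rw [stepMatrix_mulVec]
        funext i
        fin_cases r <;> simp [cycleType] at ht <;> fin_cases i <;>
          simp [cycleTop, cycleRelabel, Function.update]

/-! ### Composition of first return maps -/

section
variable {X : Type*} {T R : PartialMap X} {B : Set X}

/-- Iterates of the first return map are iterates of `T`, and the intermediate visits to `B` are
intermediate iterates of the first return map. -/
lemma IsFirstReturnMap.exists_iterate (hR : IsFirstReturnMap T B R) {x : X} (k : ℕ)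
    (hk : R.InIterDom k x) : ∃ K, (K = 0 ↔ k = 0) ∧ T.InIterDom K x ∧ T.map^[K] x = R.map^[k] x ∧
      ∀ j, 1 ≤ j → j < K → T.map^[j] x ∈ B → ∃ i, 1 ≤ i ∧ i < k ∧ T.map^[j] x = R.map^[i] x := by
  induction k with
  | zero => exact ⟨0, Iff.rfl, fun j hj => by omega, rfl, fun j _ hj => by omega⟩
  | succ k ih =>
    obtain ⟨K, h0, hdom, heq, hvis⟩ := ih fun j hj => hk j (by omega)
    obtain ⟨hy, m, hm⟩ := (hR.1 _).1 (hk k (Nat.lt_succ_self k))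
    have hm1 := hm.1
    have hadd : ∀ j, T.map^[K + j] x = T.map^[j] (R.map^[k] x) := by
      intro j
      rw [add_comm, Function.iterate_add_apply, heq]
    refine ⟨K + m, by omega, ?_, ?_, ?_⟩
    · intro j hj
      by_cases hjK : j < K
      · exact hdom j hjK
      · obtain ⟨j', rfl⟩ := Nat.exists_eq_add_of_le (not_lt.1 hjK)
        rw [hadd]
        exact hm.2.1 j' (by omega)
    · rw [hadd, Function.iterate_succ_apply', hR.2 _ hy m hm]
    · intro j hj1 hj hB
      rcases lt_trichotomy j K with hjK | rfl | hjK
      · obtain ⟨i, h1, h2, h3⟩ := hvis j hj1 hjK hB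
        exact ⟨i, h1, by omega, h3⟩
      · exact ⟨k, by omega, by omega, heq⟩
      · obtain ⟨j', rfl⟩ := Nat.exists_eq_add_of_le hjK.le
        rw [hadd] at hB
        exact absurd hB (hm.2.2.2 j' (by omega) (by omega))

/-- Every visit of an orbit of `T` to `B` is an iterate of the first return map. -/
lemma IsFirstReturnMap.exists_iterate' (hR : IsFirstReturnMap T B R) (K : ℕ) :
    ∀ x ∈ B, T.InIterDom K x → T.map^[K] x ∈ B →
      ∃ k, (k = 0 ↔ K = 0) ∧ R.InIterDom k x ∧ R.map^[k] x = T.map^[K] x ∧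
        ∀ i, 1 ≤ i → i < k → ∃ j, 1 ≤ j ∧ j < K ∧ R.map^[i] x = T.map^[j] x := by
  classical
  induction K using Nat.strong_induction_on with
  | _ K ih =>
    intro x hx hdom hB
    rcases Nat.eq_zero_or_pos K with rfl | hK
    · exact ⟨0, Iff.rfl, fun j hj => by omega, rfl, fun j _ hj => by omega⟩
    have hex : ∃ m, 1 ≤ m ∧ T.map^[m] x ∈ B := ⟨K, hK, hB⟩
    obtain ⟨hm1, hmB⟩ := Nat.find_spec hex
    have hmin := fun j => Nat.find_min (m := j) hex
    have hmK := Nat.find_min' hex ⟨hK, hB⟩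
    generalize Nat.find hex = m at hm1 hmB hmin hmK
    have hm : ReturnsAt T B x m :=
      ⟨hm1, fun j hj => hdom j (by omega), hmB, fun j h1 h2 h3 => hmin j h2 ⟨h1, h3⟩⟩
    have hxR : x ∈ R.dom := (hR.1 x).2 ⟨hx, m, hm⟩
    have hRx : R.map x = T.map^[m] x := hR.2 x hx m hm
    obtain ⟨K', rfl⟩ := Nat.exists_eq_add_of_le hmK
    have hadd : ∀ j, T.map^[m + j] x = T.map^[j] (R.map x) := by
      intro j
      rw [add_comm, Function.iterate_add_apply, hRx]
    obtain ⟨k, h0, hkd, hke, hvis⟩ := ih K' (by omega) (R.map x) (hRx ▸ hmB)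
      (fun j hj => by rw [← hadd]; exact hdom _ (by omega)) (by rwa [← hadd])
    refine ⟨k + 1, by omega, ?_, ?_, ?_⟩
    · intro j hj
      rcases j with _ | j
      · exact hxR
      · exact hkd j (by omega)
    · rw [hadd, ← hke, Function.iterate_succ_apply]
    · intro i hi1 hi
      obtain ⟨i, rfl⟩ := Nat.exists_eq_add_of_le' hi1
      rcases Nat.eq_zero_or_pos i with rfl | hi0
      · exact ⟨m, hm1, by omega, hRx⟩
      · obtain ⟨j, h1, h2, h3⟩ := hvis i hi0 (by omega)
        exact ⟨m + j, by omega, by omega, by rw [hadd, ← h3, Function.iterate_succ_apply]⟩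

/-- The first return map of a first return map is a first return map. -/
lemma IsFirstReturnMap.trans {R' : PartialMap X} {B' : Set X} (hR : IsFirstReturnMap T B R)
    (hR' : IsFirstReturnMap R B' R') (hB : B' ⊆ B) : IsFirstReturnMap T B' R' := by
  have down : ∀ x ∈ B', ∀ k, ReturnsAt R B' x k →
      ∃ K, ReturnsAt T B' x K ∧ T.map^[K] x = R.map^[k] x := by
    rintro x hx k ⟨hk1, hkd, hkB, hkm⟩
    obtain ⟨K, h0, hd, he, hvis⟩ := hR.exists_iterate k hkd
    refine ⟨K, ⟨by omega, hd, he ▸ hkB, fun j hj1 hj hjB => ?_⟩, he⟩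
    obtain ⟨i, h1, h2, h3⟩ := hvis j hj1 hj (hB hjB)
    exact hkm i h1 h2 (h3 ▸ hjB)
  have up : ∀ x ∈ B', ∀ K, ReturnsAt T B' x K → ∃ k, ReturnsAt R B' x k := by
    rintro x hx K ⟨hk1, hkd, hkB, hkm⟩
    obtain ⟨k, h0, hd, he, hvis⟩ := hR.exists_iterate' K x (hB hx) hkd (hB hkB)
    refine ⟨k, ⟨by omega, hd, he ▸ hkB, fun i hi1 hi hiB => ?_⟩⟩
    obtain ⟨j, h1, h2, h3⟩ := hvis i hi1 hi
    exact hkm j h1 h2 (h3 ▸ hiB)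
  refine ⟨fun x => ?_, fun x hx K hK => ?_⟩
  · rw [hR'.1 x]
    refine and_congr_right fun hx => ⟨fun ⟨k, hk⟩ => ?_, fun ⟨K, hK⟩ => up x hx K hK⟩
    obtain ⟨K, hK, -⟩ := down x hx k hk
    exact ⟨K, hK⟩
  · obtain ⟨k, hk⟩ := up x hx K hK
    obtain ⟨K', hK', he⟩ := down x hx k hk
    rw [hR'.2 x hx k hk, ← he, returnsAt_unique hK hK']

end

lemma IsRenormalizable.isFirstReturnMap {ι : Type*} [DecidableEq ι] [Fintype ι]
    {T : ℕ → PartialMap ℝ} {D : ℕ → Gluing ι} {L : ℕ → ℝ} {A : ℕ → Matrix ι ι ℝ}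
    (h : IsRenormalizable T D L A) (j : ℕ) :
    IsFirstReturnMap (T 0) (Ioo 0 (L (j + 1))) (T (j + 1)) := by
  have step := fun j => (h.rel j).isFirstReturnMap (h.realizes j) (h.realizes (j + 1))
  induction j with
  | zero => exact step 0
  | succ j ih => exact ih.trans (step (j + 1)) (Ioo_subset_Ioo_right (RauzyRel.le (h.rel (j + 1))))

/-! ### Self-induction along the cycle -/

lemma Gluing.IsLast.unique {ι : Type*} {D : Gluing ι} {n m n' m' : ι} {L : ℝ}
    (h : D.IsLast n m L) (h' : D.IsLast n' m' L) : n = n' ∧ m = m' := by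
  constructor
  · by_contra hne
    linarith [h'.x_le n hne, h.x_last, h'.x_last, h'.len_pos n']
  · by_contra hne
    linarith [h'.y_le m hne, h.y_last, h'.y_last, h'.len_pos m']

lemma RauzyRel.isRauzyStep {n : ℕ} {A : Matrix (Fin (n + 1)) (Fin (n + 1)) ℝ}
    {l l' : Fin (n + 1) → ℝ} {p p' : SignedPerm (n + 1)}
    (h : RauzyRel A (gluing l p) (∑ i, l i) (gluing l' p') (∑ i, l' i)) (hl : ∀ i, 0 < l i)
    (hl' : ∀ i, 0 < l' i) (hp : p.top ≠ Fin.last n) : IsRauzyStep l p l' p' := by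
  have hret := h.isFirstReturnMap (realizes_exchange (fun i => (hl i).le) p)
    (realizes_exchange (fun i => (hl' i).le) p')
  obtain ⟨a, b, e, hlast, hsum, hcase⟩ := h
  obtain ⟨rfl, rfl⟩ := hlast.unique (isLast_gluing hl p hp)
  refine ⟨hl, hl', ?_, hsum ▸ hret⟩
  rcases hcase with ⟨hlt, -⟩ | ⟨hlt, -⟩
  · exact hlt.ne
  · exact hlt.ne'

lemma stepMatrix_prod_mulVec (v : Fin 4 → ℝ) : (stepMatrix 0).mulVec ((stepMatrix 1).mulVec
    ((stepMatrix 2).mulVec ((stepMatrix 3).mulVec ((stepMatrix 4).mulVec ((stepMatrix 5).mulVec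
    ((stepMatrix 6).mulVec ((stepMatrix 7).mulVec ((stepMatrix 8).mulVec v)))))))) =
      (cycleMatrix.map (fun z : ℤ => (z : ℝ))).mulVec v := by
  simp only [stepMatrix_mulVec]
  funext i
  fin_cases i <;> simp [Matrix.mulVec, dotProduct, Fin.sum_univ_four] <;> ring

/-- The lengths `k` steps before the end of the cycle, if they are `v` at its end. -/
def backLengths (v : Fin 4 → ℝ) : ℕ → Fin 4 → ℝ
  | 0 => v
  | k + 1 => (stepMatrix (Fin.ofNat 9 (8 - k))).mulVec (backLengths v k)

lemma backLengths_pos {v : Fin 4 → ℝ} (hv : ∀ i, 0 < v i) (k : ℕ) (i : Fin 4) :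
    0 < backLengths v k i := by
  induction k generalizing i with
  | zero => exact hv i
  | succ k ih => exact stepMatrix_mulVec_pos _ ih i

lemma backLengths_nine (v : Fin 4 → ℝ) :
    backLengths v 9 = (cycleMatrix.map (fun z : ℤ => (z : ℝ))).mulVec v :=
  stepMatrix_prod_mulVec v

/-- The lengths after `j` steps of Rauzy induction that starts with an eigenvector `v` of the
matrix of the cycle, with eigenvalue `σ`. -/
noncomputable def cycleLengths (σ : ℝ) (v : Fin 4 → ℝ) (j : ℕ) : Fin 4 → ℝ :=
  σ⁻¹ ^ (j / 9) • backLengths (σ⁻¹ • v) (9 - j % 9)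

section
variable {σ : ℝ} {v : Fin 4 → ℝ}

lemma backLengths_nine_eq (hσ : 0 < σ)
    (hv : (cycleMatrix.map (fun z : ℤ => (z : ℝ))).mulVec v = σ • v) :
    backLengths (σ⁻¹ • v) 9 = v := by
  rw [backLengths_nine, Matrix.mulVec_smul, hv, smul_smul, inv_mul_cancel₀ hσ.ne', one_smul]

lemma cycleLengths_zero (hσ : 0 < σ)
    (hv : (cycleMatrix.map (fun z : ℤ => (z : ℝ))).mulVec v = σ • v) :
    cycleLengths σ v 0 = v := by
  simp [cycleLengths, backLengths_nine_eq hσ hv]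

lemma cycleLengths_add_nine (j : ℕ) : cycleLengths σ v (j + 9) = σ⁻¹ • cycleLengths σ v j := by
  unfold cycleLengths
  rw [Nat.add_div_right _ (by norm_num), Nat.add_mod_right, smul_smul, pow_succ']

lemma cycleLengths_pos (hσ : 0 < σ) (hpos : ∀ i, 0 < v i) (j : ℕ) (i : Fin 4) :
    0 < cycleLengths σ v j i :=
  mul_pos (pow_pos (inv_pos.2 hσ) _)
    (backLengths_pos (fun i => mul_pos (inv_pos.2 hσ) (hpos i)) _ i)

lemma cycleLengths_eq (hσ : 0 < σ)
    (hv : (cycleMatrix.map (fun z : ℤ => (z : ℝ))).mulVec v = σ • v) (j : ℕ) :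
    cycleLengths σ v j = (stepMatrix (Fin.ofNat 9 j)).mulVec (cycleLengths σ v (j + 1)) := by
  have hr : Fin.ofNat 9 j = Fin.ofNat 9 (j % 9) := by
    ext
    simp
  have hlt : j % 9 < 9 := Nat.mod_lt _ (by norm_num)
  have hback : backLengths (σ⁻¹ • v) (9 - j % 9) =
      (stepMatrix (Fin.ofNat 9 j)).mulVec (backLengths (σ⁻¹ • v) (8 - j % 9)) := by
    rw [show 9 - j % 9 = (8 - j % 9) + 1 by omega, backLengths,
      show 8 - (8 - j % 9) = j % 9 by omega, ← hr]
  unfold cycleLengths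
  rw [hback, ← Matrix.mulVec_smul]
  congr 1
  by_cases h8 : j % 9 = 8
  · rw [show (j + 1) / 9 = j / 9 + 1 by omega, show (j + 1) % 9 = 0 by omega, h8, pow_succ,
      backLengths_nine_eq hσ hv, ← smul_smul]
    rfl
  · rw [show (j + 1) / 9 = j / 9 by omega, show (j + 1) % 9 = j % 9 + 1 by omega,
      show 9 - (j % 9 + 1) = 8 - j % 9 by omega]

lemma periodicPath_succ (j : ℕ) :
    periodicPath cycleVertex (j + 1) = cycleVertex (Fin.ofNat 9 j).succ := by
  have h : ∀ r : Fin 9, cycleVertex (r + 1).castSucc = cycleVertex r.succ := by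
    intro r
    fin_cases r <;> rfl
  rw [← h]
  unfold periodicPath
  congr 2
  ext
  simp [Fin.val_add]

lemma rauzyRel_cycleLengths (hσ : 0 < σ) (hpos : ∀ i, 0 < v i)
    (hv : (cycleMatrix.map (fun z : ℤ => (z : ℝ))).mulVec v = σ • v) (j : ℕ) :
    RauzyRel (stepMatrix (Fin.ofNat 9 j))
      (gluing (cycleLengths σ v j) (periodicPath cycleVertex j)) (∑ i, cycleLengths σ v j i)
      (gluing (cycleLengths σ v (j + 1)) (periodicPath cycleVertex (j + 1)))
      (∑ i, cycleLengths σ v (j + 1) i) := by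
  rw [periodicPath_succ, cycleLengths_eq hσ hv j]
  exact rauzyRel_cycle _ (cycleLengths_pos hσ hpos (j + 1))

lemma tendsto_sum_cycleLengths (hσ : 1 < σ) (hpos : ∀ i, 0 < v i)
    (hv : (cycleMatrix.map (fun z : ℤ => (z : ℝ))).mulVec v = σ • v) :
    Filter.Tendsto (fun j => ∑ i, cycleLengths σ v j i) Filter.atTop (nhds 0) := by
  have hsub : Filter.Tendsto (fun k : ℕ => 9 * k) Filter.atTop Filter.atTop :=
    Filter.tendsto_id.const_mul_atTop' (by norm_num)
  refine (tendsto_iff_tendsto_subseq_of_antitone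
    (antitone_nat_of_succ_le fun j => (rauzyRel_cycleLengths (by linarith) hpos hv j).le) hsub).2 ?_
  have hpow : ∀ k, ∑ i, cycleLengths σ v (9 * k) i = σ⁻¹ ^ k * ∑ i, cycleLengths σ v 0 i := by
    intro k
    induction k with
    | zero => simp
    | succ k ih =>
      rw [show 9 * (k + 1) = 9 * k + 9 by ring, cycleLengths_add_nine]
      simp only [Pi.smul_apply, smul_eq_mul]
      rw [← Finset.mul_sum, ih, pow_succ']
      ring
  change Filter.Tendsto (fun k => ∑ i, cycleLengths σ v (9 * k) i) _ _
  simp only [hpow]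
  simpa using (tendsto_pow_atTop_nhds_zero_of_lt_one (inv_nonneg.2 (by linarith))
    (inv_lt_one_of_one_lt₀ hσ)).mul_const (∑ i, cycleLengths σ v 0 i)

lemma isRenormalizable_cycle (hσ : 1 < σ) (hpos : ∀ i, 0 < v i)
    (hv : (cycleMatrix.map (fun z : ℤ => (z : ℝ))).mulVec v = σ • v) :
    IsRenormalizable (fun j => exchange (cycleLengths σ v j) (periodicPath cycleVertex j))
      (fun j => gluing (cycleLengths σ v j) (periodicPath cycleVertex j))
      (fun j => ∑ i, cycleLengths σ v j i) (fun j => stepMatrix (Fin.ofNat 9 j)) where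
  realizes j := realizes_exchange (fun i => (cycleLengths_pos (by linarith) hpos j i).le) _
  rel := rauzyRel_cycleLengths (by linarith) hpos hv
  tendsto := tendsto_sum_cycleLengths hσ hpos hv

/-- The lengths of the infinite induction are `cycleLengths`, and its ninth map is the first return
map to the interval of length `(∑ i, v i) / σ`. -/
lemma isSelfInduced_cycle (hσ : 1 < σ) (hpos : ∀ i, 0 < v i)
    (hv : (cycleMatrix.map (fun z : ℤ => (z : ℝ))).mulVec v = σ • v) :
    IsSelfInduced cycleVertex σ v := by
  have hσ0 : 0 < σ := by linarith
  have h := isRenormalizable_cycle hσ hpos hv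
  refine ⟨⟨cycleLengths σ v, cycleLengths_zero hσ0 hv, fun j => ?_, cycleLengths_add_nine⟩, ?_⟩
  · refine (h.rel j).isRauzyStep (cycleLengths_pos hσ0 hpos j) (cycleLengths_pos hσ0 hpos _) ?_
    unfold periodicPath
    generalize Fin.ofNat 9 j = r
    revert r
    decide
  · have := h.isFirstReturnMap 8
    beta_reduce at this
    rw [cycleLengths_add_nine 0, cycleLengths_zero hσ0 hv] at this
    have hsum : (∑ i, v i) / σ = ∑ i, (σ⁻¹ • v) i := by
      simp only [Pi.smul_apply, smul_eq_mul]
      rw [← Finset.mul_sum, div_eq_inv_mul]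
    rw [hsum]
    exact this
end

/-! ### Positive matrices contract to a ray -/

section
variable {ι : Type*} [Fintype ι]

/-- A nonnegative vector with nonnegative preimages under all powers of a positive stochastic matrix
is constant: the preimages are bounded, since each entry enters every average with weight at least
`δ`, and each application of the matrix contracts the oscillation by `1 - δ`. -/
lemma exists_const_of_stochastic [Nonempty ι] {P : ι → ι → ℝ} {δ : ℝ} (hδ : 0 < δ)
    (hP : ∀ i j, δ ≤ P i j) (hsum : ∀ i, ∑ j, P i j = 1) {r : ℕ → ι → ℝ} (hr : ∀ k i, 0 ≤ r k i)
    (hrec : ∀ k i, r k i = ∑ j, P i j * r (k + 1) j) : ∃ c, ∀ i, r 0 i = c := by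
  have hP0 : ∀ i j, 0 ≤ P i j := fun i j => hδ.le.trans (hP i j)
  obtain ⟨i₀⟩ := ‹Nonempty ι›
  have hδ1 : δ ≤ 1 := by
    rw [← hsum i₀]
    exact (hP i₀ i₀).trans (Finset.single_le_sum (f := P i₀) (fun j _ => hP0 i₀ j)
      (Finset.mem_univ i₀))
  have lower : ∀ k c, (∀ i, c ≤ r (k + 1) i) → ∀ i, c ≤ r k i := by
    intro k c hc i
    rw [hrec, ← one_mul c, ← hsum i, Finset.sum_mul]
    exact Finset.sum_le_sum fun j _ => mul_le_mul_of_nonneg_left (hc j) (hP0 i j)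
  have lower' : ∀ k c, (∀ i, c ≤ r k i) → ∀ i, c ≤ r 0 i := by
    intro k
    induction k with
    | zero => exact fun c hc => hc
    | succ k ih => exact fun c hc => ih c (lower k c hc)
  have bound : ∀ k j, r (k + 1) j ≤ r 0 i₀ / δ := by
    intro k j
    rw [le_div_iff₀ hδ, mul_comm]
    refine lower' k _ (fun i => ?_) i₀
    rw [hrec k i]
    exact (mul_le_mul_of_nonneg_right (hP i j) (hr _ _)).trans
      (Finset.single_le_sum (f := fun j => P i j * r (k + 1) j)
        (fun j _ => mul_nonneg (hP0 i j) (hr _ _)) (Finset.mem_univ j))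
  have contract : ∀ k K, (∀ i j, r (k + 1) i - r (k + 1) j ≤ K) →
      ∀ i j, r k i - r k j ≤ (1 - δ) * K := by
    intro k K hK i j
    have hK0 : 0 ≤ K := by simpa using hK i₀ i₀
    -- the smallest entry enters every average with weight at least `δ`
    obtain ⟨m, hm⟩ := exists_eq_ciInf_of_finite (f := r (k + 1))
    have hmin : ∀ i, r (k + 1) m ≤ r (k + 1) i := fun i =>
      hm ▸ ciInf_le (Set.finite_range _).bddBelow i
    have h1 := lower k _ hmin j
    have h2 : δ * K ≤ ∑ j, P i j * (r (k + 1) m + K - r (k + 1) j) := by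
      refine le_trans ?_ (Finset.single_le_sum
        (f := fun j => P i j * (r (k + 1) m + K - r (k + 1) j))
        (fun j _ => mul_nonneg (hP0 i j) (by linarith [hK j m])) (Finset.mem_univ m))
      rw [add_sub_cancel_left]
      exact mul_le_mul_of_nonneg_right (hP i m) hK0
    have h3 : ∑ j, P i j * (r (k + 1) m + K - r (k + 1) j) = r (k + 1) m + K - r k i := by
      simp only [mul_sub, Finset.sum_sub_distrib]
      rw [← Finset.sum_mul, hsum, one_mul, ← hrec]
    linarith
  have osc : ∀ k n i j, r n i - r n j ≤ (1 - δ) ^ k * (r 0 i₀ / δ) ∨ k = 0 ∧ n = 0 := by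
    intro k
    induction k with
    | zero =>
      intro n i j
      rcases n with _ | n
      · exact Or.inr ⟨rfl, rfl⟩
      · left
        linarith [bound n i, hr (n + 1) j]
    | succ k ih =>
      intro n i j
      left
      rw [pow_succ', mul_assoc]
      exact contract n _ (fun i j => (ih (n + 1) i j).resolve_right (by simp)) i j
  refine ⟨r 0 i₀, fun i => ?_⟩
  have hlim : Filter.Tendsto (fun k : ℕ => (1 - δ) ^ (k + 1) * (r 0 i₀ / δ)) Filter.atTop
      (nhds 0) := by
    simpa using ((tendsto_pow_atTop_nhds_zero_of_lt_one (by linarith) (by linarith)).comp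
      (Filter.tendsto_add_atTop_nat 1)).mul_const (r 0 i₀ / δ)
  have key : ∀ i j, r 0 i - r 0 j ≤ 0 := fun i j =>
    ge_of_tendsto' hlim fun k => (osc (k + 1) 0 i j).resolve_right (by simp)
  linarith [key i i₀, key i₀ i]

/-- If `A` is a positive matrix with positive eigenvector `v`, only the multiples of `v` have
nonnegative preimages under all powers of `A`. -/
lemma exists_eq_smul_of_positive {A : Matrix ι ι ℝ} (hA : ∀ i j, 0 < A i j) {v : ι → ℝ} {ρ : ℝ}
    (hρ : 0 < ρ) (hv : ∀ i, 0 < v i) (hAv : A.mulVec v = ρ • v) {w : ℕ → ι → ℝ}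
    (hw : ∀ k i, 0 ≤ w k i) (hrec : ∀ k, w k = A.mulVec (w (k + 1))) : ∃ c : ℝ, w 0 = c • v := by
  rcases isEmpty_or_nonempty ι with h | h
  · exact ⟨0, funext fun i => isEmptyElim i⟩
  have hpos : ∀ q : ι × ι, 0 < A q.1 q.2 * v q.2 / (ρ * v q.1) := fun q =>
    div_pos (mul_pos (hA _ _) (hv _)) (mul_pos hρ (hv _))
  obtain ⟨q, hq⟩ := Finite.exists_min fun q : ι × ι => A q.1 q.2 * v q.2 / (ρ * v q.1)
  obtain ⟨c, hc⟩ : ∃ c, ∀ i, ρ ^ 0 * w 0 i / v i = c := by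
    refine exists_const_of_stochastic (P := fun i j => A i j * v j / (ρ * v i))
      (r := fun k i => ρ ^ k * w k i / v i) (hpos q) (fun i j => hq (i, j)) ?_ ?_ ?_
    · intro i
      have := congrFun hAv i
      rw [← Finset.sum_div, div_eq_one_iff_eq (mul_pos hρ (hv i)).ne']
      exact this
    · exact fun k i => div_nonneg (mul_nonneg (pow_pos hρ k).le (hw k i)) (hv i).le
    · intro k i
      simp only [hrec k, Matrix.mulVec, dotProduct]
      rw [Finset.mul_sum, Finset.sum_div]
      refine Finset.sum_congr rfl fun j _ => ?_
      have h1 := (hv i).ne'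
      have h2 := (hv j).ne'
      field_simp
      ring
  refine ⟨c, funext fun i => ?_⟩
  have := hc i
  rw [pow_zero, one_mul, div_eq_iff (hv i).ne'] at this
  exact this

end

/-! ### The spectrum of the matrix of the cycle -/

open Polynomial in
lemma charpoly_cycleMatrix :
    cycleMatrix.charpoly = (X - 1) * (X ^ 3 - 7 * X ^ 2 + 5 * X - 1) := by
  have : cycleMatrix.charmatrix = !![X - 2, -2, -3, -2; 0, X - 1, -1, -1; -1, -1, X - 2, -1;
      -1, -2, -3, X - 3] := by
    ext1 i j
    fin_cases i <;> fin_cases j <;> simp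
  rw [Matrix.charpoly, this]
  simp [Matrix.det_succ_row_zero, Fin.sum_univ_succ, Fin.succAbove]
  ring

/-- The Perron-Frobenius eigenvalue of the matrix of the cycle. -/
lemma exists_cubic_root : ∃ σ : ℝ, 6 < σ ∧ σ < 7 ∧ σ ^ 3 - 7 * σ ^ 2 + 5 * σ - 1 = 0 := by
  have hc : ContinuousOn (fun x : ℝ => x ^ 3 - 7 * x ^ 2 + 5 * x - 1) (Icc 6 7) := by fun_prop
  obtain ⟨σ, hσ, h0⟩ := intermediate_value_Ioo (by norm_num) hc
    (show (0 : ℝ) ∈ Ioo _ _ by constructor <;> norm_num)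
  exact ⟨σ, hσ.1, hσ.2, h0⟩

section
variable {σ : ℝ}

/-- The other roots of the cubic factor are those of `z ^ 2 - (7 - σ) z + σ⁻¹`, in which `7 - σ` and
`σ⁻¹` are less than `1`. -/
lemma norm_le_of_isRoot (h6 : 6 < σ) (h7 : σ < 7) (hσ : σ ^ 3 - 7 * σ ^ 2 + 5 * σ - 1 = 0)
    {z : ℂ} (hz : (cycleMatrix.map (fun w : ℤ => (w : ℂ))).charpoly.IsRoot z) : ‖z‖ ≤ σ := by
  have hmap := Matrix.charpoly_map cycleMatrix (Int.castRingHom ℂ)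
  change (cycleMatrix.map (fun w : ℤ => (w : ℂ))).charpoly = _ at hmap
  rw [hmap, charpoly_cycleMatrix, Polynomial.IsRoot.def] at hz
  simp at hz
  rcases hz with hz | hz
  · rw [sub_eq_zero] at hz
    rw [hz]
    simp
    linarith
  have hσ' : (σ : ℂ) ^ 3 - 7 * (σ : ℂ) ^ 2 + 5 * σ - 1 = 0 := by exact_mod_cast hσ
  have hfac : (z - σ) * (z ^ 2 - (7 - σ) * z + (σ ^ 2 - 7 * σ + 5)) = 0 := by
    linear_combination hz - hσ'
  rcases mul_eq_zero.1 hfac with h | h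
  · rw [sub_eq_zero] at h
    rw [h, Complex.norm_real, Real.norm_of_nonneg (by linarith)]
  · set τ := σ ^ 2 - 7 * σ + 5 with hτ
    have hτσ : σ * τ = 1 := by rw [hτ]; linarith
    have hτ0 : 0 < τ := by
      by_contra hneg
      nlinarith
    have hτ1 : τ < 1 := by nlinarith
    have hz2 : z ^ 2 = ((7 - σ : ℝ) : ℂ) * z - (τ : ℂ) := by
      push_cast [hτ]
      linear_combination h
    have hn : ‖z‖ ^ 2 ≤ (7 - σ) * ‖z‖ + τ := by
      rw [← norm_pow, hz2]
      refine (norm_sub_le _ _).trans ?_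
      rw [norm_mul, Complex.norm_real, Complex.norm_real, Real.norm_of_nonneg (by linarith),
        Real.norm_of_nonneg hτ0.le]
    by_contra hgt
    push Not at hgt
    nlinarith

lemma rootMultiplicity_eq_one (h6 : 6 < σ) (hσ : σ ^ 3 - 7 * σ ^ 2 + 5 * σ - 1 = 0) :
    (cycleMatrix.map (fun z : ℤ => (z : ℝ))).charpoly.rootMultiplicity σ = 1 := by
  have hmap := Matrix.charpoly_map cycleMatrix (Int.castRingHom ℝ)
  change (cycleMatrix.map (fun w : ℤ => (w : ℝ))).charpoly = _ at hmap
  have hne : (cycleMatrix.map (fun w : ℤ => (w : ℝ))).charpoly ≠ 0 :=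
    (Matrix.charpoly_monic _).ne_zero
  have h1 := (Polynomial.rootMultiplicity_pos (x := σ) hne).2 (by
    rw [hmap, charpoly_cycleMatrix, Polynomial.IsRoot.def]
    simp [hσ])
  have h2 := (Polynomial.one_lt_rootMultiplicity_iff_isRoot (t := σ) hne).not.2 (by
    rw [hmap, charpoly_cycleMatrix]
    rintro ⟨-, h⟩
    rw [Polynomial.IsRoot.def] at h
    simp [Polynomial.derivative_mul, hσ] at h
    rcases h with h | h
    · linarith
    · nlinarith)
  omega

/-- The normalized Perron-Frobenius eigenvector of the matrix of the cycle.  Its direction is found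
by solving `M v = σ v` with `v 1 = 1`; the cubic equation gives `σ⁻¹ = σ ^ 2 - 7 σ + 5`. -/
noncomputable def perronVector (σ : ℝ) : Fin 4 → ℝ :=
  (2 * σ - 3 + σ⁻¹)⁻¹ • ![σ - 3 + σ⁻¹, 1, 2 - σ⁻¹, σ - 3 + σ⁻¹]

lemma perronVector_pos (h6 : 6 < σ) (i : Fin 4) : 0 < perronVector σ i := by
  have h0 : 0 < σ⁻¹ := inv_pos.2 (by linarith)
  have h1 : σ⁻¹ < 1 := inv_lt_one_of_one_lt₀ (by linarith)
  refine mul_pos (inv_pos.2 (by linarith)) ?_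
  fin_cases i <;> simp <;> linarith

lemma sum_perronVector (h6 : 6 < σ) : ∑ i, perronVector σ i = 1 := by
  have h0 : 0 < σ⁻¹ := inv_pos.2 (by linarith)
  simp only [perronVector, Pi.smul_apply, smul_eq_mul]
  rw [← Finset.mul_sum, Fin.sum_univ_four, inv_mul_eq_one₀ (by linarith)]
  simp
  ring

lemma mulVec_perronVector (hσ : σ ^ 3 - 7 * σ ^ 2 + 5 * σ - 1 = 0) :
    (cycleMatrix.map (fun z : ℤ => (z : ℝ))).mulVec (perronVector σ) = σ • perronVector σ := by
  have hi : σ⁻¹ = σ ^ 2 - 7 * σ + 5 := inv_eq_of_mul_eq_one_right (by linarith)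
  unfold perronVector
  rw [Matrix.mulVec_smul, smul_comm]
  congr 1
  rw [hi]
  funext i
  fin_cases i <;> simp [Matrix.mulVec, dotProduct, Fin.sum_univ_four] <;> linarith

lemma isPerronFrobenius (h6 : 6 < σ) (h7 : σ < 7) (hσ : σ ^ 3 - 7 * σ ^ 2 + 5 * σ - 1 = 0) :
    IsPerronFrobenius cycleMatrix σ (perronVector σ) :=
  ⟨by linarith, rootMultiplicity_eq_one h6 hσ, fun _ hz => norm_le_of_isRoot h6 h7 hσ hz,
    perronVector_pos h6, sum_perronVector h6, mulVec_perronVector hσ⟩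

end

/-! ### Orbits -/

section
variable {X : Type*} {T : PartialMap X}

lemma inIterDom_succ {k : ℕ} {x : X} :
    T.InIterDom (k + 1) x ↔ x ∈ T.dom ∧ T.InIterDom k (T.map x) := by
  constructor
  · exact fun h => ⟨h 0 (Nat.succ_pos k), fun j hj => h (j + 1) (by omega)⟩
  · rintro ⟨h0, h⟩ j hj
    rcases j with _ | j
    · exact h0
    · exact h j (by omega)

lemma inIterDom_succ' {k : ℕ} {x : X} :
    T.InIterDom (k + 1) x ↔ T.InIterDom k x ∧ T.map^[k] x ∈ T.dom := by
  constructor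
  · exact fun h => ⟨fun j hj => h j (by omega), h k (Nat.lt_succ_self k)⟩
  · rintro ⟨h, hk⟩ j hj
    rcases (Nat.lt_succ_iff_lt_or_eq.1 hj) with hj | rfl
    · exact h j hj
    · exact hk

lemma mem_orbit_self (p : X) : p ∈ T.orbit p :=
  Or.inl ⟨0, fun j hj => absurd hj (Nat.not_lt_zero j), rfl⟩

lemma isSaturated_orbit (hT : InjOn T.map T.dom) (p : X) : IsSaturated T (T.orbit p) := by
  intro x hx
  constructor
  · rintro (⟨k, hk, he⟩ | ⟨k, hk, he⟩)
    · rcases k with _ | k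
      · exact Or.inr ⟨1, inIterDom_succ.2 ⟨hx, fun j hj => absurd hj (Nat.not_lt_zero j)⟩, he.symm⟩
      · rw [inIterDom_succ'] at hk
        rw [Function.iterate_succ_apply'] at he
        exact Or.inl ⟨k, hk.1, hT hk.2 hx he⟩
    · exact Or.inr ⟨k + 1, inIterDom_succ.2 ⟨hx, hk⟩, he⟩
  · rintro (⟨k, hk, rfl⟩ | ⟨k, hk, he⟩)
    · exact Or.inl ⟨k + 1, inIterDom_succ'.2 ⟨hk, hx⟩, Function.iterate_succ_apply' _ _ _⟩
    · rcases k with _ | k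
      · exact Or.inl ⟨1, inIterDom_succ.2 ⟨he ▸ hx, fun j hj => absurd hj (Nat.not_lt_zero j)⟩,
          congrArg T.map he.symm⟩
      · exact Or.inr ⟨k, (inIterDom_succ.1 hk).2, he⟩

lemma IsSaturated.orbit_subset {O : Set X} (hO : IsSaturated T O) {p : X} (hp : p ∈ O) :
    T.orbit p ⊆ O := by
  rintro q (⟨k, hk, rfl⟩ | ⟨k, hk, rfl⟩)
  · exact (hO.iterate hk).2 hp
  · exact (hO.iterate hk).1 hp

/-- The points whose forward orbit meets `U`. -/
def forwardSaturation (T : PartialMap X) (U : Set X) : Set X :=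
  {x | ∃ k, T.InIterDom k x ∧ T.map^[k] x ∈ U}

lemma subset_forwardSaturation (U : Set X) : U ⊆ forwardSaturation T U :=
  fun _ hx => ⟨0, fun j hj => absurd hj (Nat.not_lt_zero j), hx⟩

lemma measurableSet_forwardSaturation [MeasurableSpace X]
    (hT : ∀ E, MeasurableSet E → MeasurableSet {x | x ∈ T.dom ∧ T.map x ∈ E}) {U : Set X}
    (hU : MeasurableSet U) : MeasurableSet (forwardSaturation T U) := by
  have : forwardSaturation T U = ⋃ k, {x | T.InIterDom k x ∧ T.map^[k] x ∈ U} := by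
    ext x
    simp [forwardSaturation]
  rw [this]
  refine MeasurableSet.iUnion fun k => ?_
  induction k with
  | zero =>
    convert hU using 1
    ext x
    exact and_iff_right fun j hj => absurd hj (Nat.not_lt_zero j)
  | succ k ih =>
    convert hT _ ih using 1
    ext x
    simp only [mem_ofPred_eq, inIterDom_succ, and_assoc]
    rfl

/-! ### Unique ergodicity implies transitivity -/

/-- The restriction of an invariant measure to the set of points with forward orbits through `U`
is invariant. -/
lemma IsInvariant.restrict_forwardSaturation [MeasurableSpace X]
    (hT : ∀ E, MeasurableSet E → MeasurableSet {x | x ∈ T.dom ∧ T.map x ∈ E}) {μ : Measure X}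
    [IsFiniteMeasure μ] (hμ : IsInvariant T μ) {U : Set X} (hU : MeasurableSet U) :
    IsInvariant T (μ.restrict (forwardSaturation T U)) := by
  have hA := measurableSet_forwardSaturation hT hU
  set A := forwardSaturation T U
  have hsub : {x | x ∈ T.dom ∧ T.map x ∈ A} ⊆ A := by
    rintro x ⟨hx, k, hk, hkU⟩
    exact ⟨k + 1, inIterDom_succ.2 ⟨hx, hk⟩, hkU⟩
  have hnull : μ (A \ {x | x ∈ T.dom ∧ T.map x ∈ A}) = 0 := by
    rw [measure_sdiff hsub (hT A hA).nullMeasurableSet (measure_ne_top _ _), hμ A hA, tsub_self]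
  intro E hE
  rw [Measure.restrict_apply (hT E hE), Measure.restrict_apply hE, ← hμ _ (hE.inter hA)]
  apply measure_congr
  refine Filter.EventuallyLE.antisymm ?_ ?_
  · have hae : ∀ᵐ x ∂μ, x ∉ A \ {x | x ∈ T.dom ∧ T.map x ∈ A} :=
      measure_eq_zero_iff_ae_notMem.1 hnull
    filter_upwards [hae] with x hx hx'
    obtain ⟨⟨hd, hE⟩, hxA⟩ := hx'
    by_contra hn
    exact hx ⟨hxA, fun h => hn ⟨hd, hE, h.2⟩⟩
  · refine Filter.Eventually.of_forall fun x hx => ?_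
    exact ⟨⟨hx.1, hx.2.1⟩, hsub ⟨hx.1, hx.2.2⟩⟩

end

/-- A uniquely ergodic map of the unit interval is transitive: by ergodicity of Lebesgue measure,
almost all forward orbits meet every interval with rational ends. -/
lemma isTransitive_of_isUniquelyErgodic {T : PartialMap ℝ}
    (hT : ∀ E, MeasurableSet E → MeasurableSet {x | x ∈ T.dom ∧ T.map x ∈ E})
    (h : IsUniquelyErgodic (Icc 0 1) T) : IsTransitive (Icc 0 1) T := by
  have hU : ∀ a b : ℚ, 0 ≤ (a : ℝ) → (a : ℝ) < b → (b : ℝ) ≤ 1 →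
      ∀ᵐ x ∂(volume.restrict (Icc (0 : ℝ) 1)), x ∈ forwardSaturation T (Ioo (a : ℝ) b) := by
    intro a b ha hab hb
    have hA := measurableSet_forwardSaturation hT (measurableSet_Ioo (a := (a : ℝ)) (b := b))
    have hinv := h.1.restrict_forwardSaturation hT (measurableSet_Ioo (a := (a : ℝ)) (b := b))
    have hsub := subset_forwardSaturation (T := T) (Ioo (a : ℝ) b)
    set A := forwardSaturation T (Ioo (a : ℝ) b)
    obtain ⟨c, hc⟩ := h.2 ((volume.restrict (Icc (0 : ℝ) 1)).restrict A) inferInstance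
      (le_antisymm ((Measure.restrict_apply_le _ _).trans_eq
        (by rw [Measure.restrict_apply measurableSet_Icc.compl]; simp)) zero_le) hinv
    have h1 := congrArg (fun μ : Measure ℝ => μ (Ioo (a : ℝ) b)) hc
    have h2 := congrArg (fun μ : Measure ℝ => μ Aᶜ) hc
    have hIoo : Ioo (a : ℝ) b ∩ Icc 0 1 = Ioo (a : ℝ) b :=
      inter_eq_left.2 fun x hx => ⟨by linarith [hx.1], by linarith [hx.2]⟩
    simp only [Measure.smul_apply] at h1 h2
    rw [Measure.restrict_apply measurableSet_Ioo, inter_eq_left.2 hsub,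
      Measure.restrict_apply measurableSet_Ioo, hIoo, Real.volume_Ioo] at h1
    rw [Measure.restrict_apply hA.compl, compl_inter_self, measure_empty] at h2
    have hc0 : c ≠ 0 := by
      rintro rfl
      rw [zero_smul, ENNReal.ofReal_eq_zero] at h1
      linarith
    rw [ae_iff]
    have h3 := h2.symm
    rw [ENNReal.smul_def, smul_eq_mul, mul_eq_zero] at h3
    exact h3.resolve_left (by simpa using hc0)
  have hall : ∀ᵐ x ∂(volume.restrict (Icc (0 : ℝ) 1)), ∀ a b : ℚ, 0 ≤ (a : ℝ) → (a : ℝ) < b →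
      (b : ℝ) ≤ 1 → x ∈ forwardSaturation T (Ioo (a : ℝ) b) := by
    simp only [ae_all_iff]
    exact hU
  have : (ae (volume.restrict (Icc (0 : ℝ) 1))).NeBot := by
    rw [ae_neBot, Ne, Measure.restrict_eq_zero]
    simp
  obtain ⟨x, hx, hxI⟩ := (hall.and (ae_restrict_mem measurableSet_Icc)).exists
  refine ⟨x, hxI, fun z hz => Metric.mem_closure_iff.2 fun ε hε => ?_⟩
  obtain ⟨a, ha1, ha2⟩ := exists_rat_btwn
    (show max 0 (z - ε) < min 1 (z + ε) from
      max_lt (lt_min (by norm_num) (by linarith [hz.1]))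
        (lt_min (by linarith [hz.2]) (by linarith)))
  obtain ⟨b, hb1, hb2⟩ := exists_rat_btwn ha2
  obtain ⟨h1, h2⟩ := max_lt_iff.1 ha1
  obtain ⟨h3, h4⟩ := lt_min_iff.1 hb2
  obtain ⟨k, hk, hkU⟩ := hx a b h1.le hb1 h3.le
  refine ⟨_, Or.inl ⟨k, hk, rfl⟩, ?_⟩
  rw [Real.dist_eq, abs_lt]
  constructor <;> linarith [hkU.1, hkU.2]

/-! ### Invariant measures of interval exchanges -/

namespace Gluing

variable {ι : Type*}

/-- The exchanged intervals, and their images, have positive lengths of sum `1` and are disjoint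
subintervals of `[0, 1]`. -/
structure IsPartition [Fintype ι] (D : Gluing ι) : Prop where
  len_pos : ∀ i, 0 < D.len i
  x_mem : ∀ i, 0 ≤ D.x i ∧ D.x i + D.len i ≤ 1
  y_mem : ∀ i, 0 ≤ D.y i ∧ D.y i + D.len i ≤ 1
  x_disjoint : ∀ i k, i ≠ k →
    Disjoint (Ioo (D.x i) (D.x i + D.len i)) (Ioo (D.x k) (D.x k + D.len k))
  y_disjoint : ∀ i k, i ≠ k →
    Disjoint (Ioo (D.y i) (D.y i + D.len i)) (Ioo (D.y k) (D.y k + D.len k))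
  sum_len : ∑ i, D.len i = 1

lemma move_injective (D : Gluing ι) (i : ι) : Function.Injective (D.move i) := by
  intro z w h
  unfold move at h
  split_ifs at h <;> linarith

lemma measurePreserving_move (D : Gluing ι) (i : ι) :
    MeasurePreserving (D.move i) volume volume := by
  by_cases h : D.sign i = 1
  · have : D.move i = fun z => (D.y i - D.x i) + z := by
      funext z
      simp only [move, if_pos h]
      ring
    rw [this]
    exact measurePreserving_add_left volume _
  · have : D.move i = fun z => (D.y i + D.x i + D.len i) - z := by
      funext z
      simp only [move, if_neg h]
      ring
    rw [this]
    exact Measure.measurePreserving_sub_left volume _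

lemma preimage_move {D : Gluing ι} {i : ι} {z : ℝ} :
    D.move i z ∈ Ioo (D.y i) (D.y i + D.len i) ↔ z ∈ Ioo (D.x i) (D.x i + D.len i) := by
  refine ⟨fun h => ?_, move_mem⟩
  obtain ⟨w, hw, he⟩ := exists_move_eq h
  rwa [← D.move_injective i he]

variable [Fintype ι] {D : Gluing ι} {T : PartialMap ℝ}

omit [Fintype ι] in
lemma Realizes.exists_of_mem (hT : Realizes T D) {z : ℝ} (hz : z ∈ T.dom) :
    ∃ i, z ∈ Ioo (D.x i) (D.x i + D.len i) ∧ T.map z = D.move i z ∧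
      T.map z ∈ Ioo (D.y i) (D.y i + D.len i) := by
  rw [hT.dom] at hz
  obtain ⟨i, hi⟩ := mem_iUnion.1 hz
  exact ⟨i, hi, hT.map i z hi, hT.map i z hi ▸ move_mem hi⟩

lemma IsPartition.injOn (hD : D.IsPartition) (hT : Realizes T D) : InjOn T.map T.dom := by
  intro z hz w hw h
  obtain ⟨i, hi, he, hm⟩ := hT.exists_of_mem hz
  obtain ⟨k, hk, he', hm'⟩ := hT.exists_of_mem hw
  have hik : i = k := by
    by_contra hne
    exact Set.disjoint_left.1 (hD.y_disjoint i k hne) hm (h ▸ hm')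
  subst hik
  exact D.move_injective i (by rw [← he, ← he', h])

lemma IsPartition.dom_subset (hD : D.IsPartition) (hT : Realizes T D) : T.dom ⊆ Ioo 0 1 := by
  intro z hz
  obtain ⟨i, hi, -⟩ := hT.exists_of_mem hz
  exact ⟨by linarith [hi.1, (hD.x_mem i).1], by linarith [hi.2, (hD.x_mem i).2]⟩

lemma IsPartition.map_mem (hD : D.IsPartition) (hT : Realizes T D) {z : ℝ} (hz : z ∈ T.dom) :
    T.map z ∈ Ioo 0 1 := by
  obtain ⟨i, -, -, hi⟩ := hT.exists_of_mem hz
  exact ⟨by linarith [hi.1, (hD.y_mem i).1], by linarith [hi.2, (hD.y_mem i).2]⟩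

omit [Fintype ι] in
lemma Realizes.preimage_eq (hT : Realizes T D) (E : Set ℝ) :
    {z | z ∈ T.dom ∧ T.map z ∈ E} =
      ⋃ i, D.move i ⁻¹' (E ∩ Ioo (D.y i) (D.y i + D.len i)) := by
  ext z
  simp only [mem_ofPred_eq, mem_iUnion, mem_preimage, mem_inter_iff, preimage_move]
  constructor
  · rintro ⟨hz, hE⟩
    rw [hT.dom] at hz
    obtain ⟨i, hi⟩ := mem_iUnion.1 hz
    exact ⟨i, hT.map i z hi ▸ hE, hi⟩
  · rintro ⟨i, hE, hi⟩
    exact ⟨hT.mem_dom hi, hT.map i z hi ▸ hE⟩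

lemma Realizes.measurableSet_preimage (hT : Realizes T D) {E : Set ℝ} (hE : MeasurableSet E) :
    MeasurableSet {z | z ∈ T.dom ∧ T.map z ∈ E} := by
  rw [hT.preimage_eq]
  exact MeasurableSet.iUnion fun i =>
    (D.measurePreserving_move i).measurable (hE.inter measurableSet_Ioo)

lemma IsPartition.isInvariant_volume (hD : D.IsPartition) (hT : Realizes T D) :
    IsInvariant T (volume.restrict (Icc 0 1)) := by
  intro E hE
  have hcover : (⋃ i, Ioo (D.y i) (D.y i + D.len i)) =ᵐ[volume] Icc (0 : ℝ) 1 := by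
    refine ae_eq_of_subset_of_measure_ge ?_ ?_ (MeasurableSet.iUnion fun i =>
      measurableSet_Ioo).nullMeasurableSet (by simp)
    · refine iUnion_subset fun i => Ioo_subset_Icc_self.trans (Icc_subset_Icc ?_ ?_)
      · exact (hD.y_mem i).1
      · exact (hD.y_mem i).2
    · rw [measure_iUnion (fun i k h => hD.y_disjoint i k h) fun i => measurableSet_Ioo,
        tsum_fintype]
      simp only [Real.volume_Ioo, Real.volume_Icc, add_sub_cancel_left]
      rw [← ENNReal.ofReal_sum_of_nonneg fun i _ => (hD.len_pos i).le, hD.sum_len, sub_zero]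
  have hsub : {z | z ∈ T.dom ∧ T.map z ∈ E} ⊆ Icc 0 1 := fun z hz =>
    Ioo_subset_Icc_self (hD.dom_subset hT hz.1)
  rw [Measure.restrict_apply (hT.measurableSet_preimage hE), inter_eq_left.2 hsub,
    Measure.restrict_apply hE, hT.preimage_eq, measure_iUnion, tsum_fintype]
  · have h1 : ∀ i, volume (D.move i ⁻¹' (E ∩ Ioo (D.y i) (D.y i + D.len i))) =
        volume (E ∩ Ioo (D.y i) (D.y i + D.len i)) := fun i =>
      (D.measurePreserving_move i).measure_preimage (hE.inter measurableSet_Ioo).nullMeasurableSet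
    simp only [h1]
    rw [← measure_congr (Filter.EventuallyEq.rfl.inter hcover), inter_iUnion, measure_iUnion,
      tsum_fintype]
    · exact fun i k h => (hD.y_disjoint i k h).mono inter_subset_right inter_subset_right
    · exact fun i => hE.inter measurableSet_Ioo
  · intro i k h
    refine (hD.x_disjoint i k h).mono ?_ ?_ <;> exact fun z hz => preimage_move.1 hz.2
  · exact fun i => (D.measurePreserving_move i).measurable (hE.inter measurableSet_Ioo)

end Gluing

section
variable {ι : Type*} [Fintype ι] {D : Gluing ι} {T : PartialMap ℝ}

lemma IsInvariant.measure_compl_dom {X : Type*} [MeasurableSpace X] {T : PartialMap X}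
    {μ : Measure X} [IsFiniteMeasure μ] (hμ : IsInvariant T μ) (hT : MeasurableSet T.dom) :
    μ T.domᶜ = 0 := by
  rw [measure_compl hT (measure_ne_top _ _), tsub_eq_zero_iff_le, ← hμ univ MeasurableSet.univ]
  simp

/-- If unions of orbits are infinite, points of an orbit, which have the same mass, have no mass. -/
lemma nullSingletonClass_of_isInvariant (hD : D.IsPartition) (hT : Gluing.Realizes T D)
    (hinf : ∀ O, IsSaturated T O → (∃ x ∈ O, x ∈ Ioo 0 1) → O.Infinite) {μ : Measure ℝ}
    [IsFiniteMeasure μ] (hμ : IsInvariant T μ) : NullSingletonClass μ where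
  measure_singleton x := by
    by_contra hx
    have hdom : MeasurableSet T.dom := by
      simpa using hT.measurableSet_preimage MeasurableSet.univ
    have hxd : x ∈ T.dom := by
      by_contra hn
      exact hx (measure_mono_null (singleton_subset_iff.2 hn) (hμ.measure_compl_dom hdom))
    have hsat : IsSaturated T {y | μ {y} = μ {x}} := by
      intro y hy
      have : {z | z ∈ T.dom ∧ T.map z ∈ ({T.map y} : Set ℝ)} = {y} := by
        ext z
        constructor
        · exact fun hz => hD.injOn hT hz.1 hy hz.2
        · rintro rfl
          exact ⟨hy, rfl⟩
      rw [mem_ofPred_eq, mem_ofPred_eq, ← hμ _ (measurableSet_singleton _), this]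
    have := hinf _ hsat ⟨x, rfl, hD.dom_subset hT hxd⟩
    exact measure_ne_top μ _ (this.meas_eq_top ⟨μ {x}, hx, fun y hy => le_of_eq hy.symm⟩)

lemma measureReal_Iic_sub {μ : Measure ℝ} [IsFiniteMeasure μ] [NullSingletonClass μ] {a b : ℝ}
    (h : a ≤ b) : μ.real (Iic b) - μ.real (Iic a) = μ.real (Ioo a b) := by
  rw [← measureReal_sdiff (Iic_subset_Iic.2 h) measurableSet_Iic, Iic_sdiff_Iic]
  exact measureReal_congr Ioo_ae_eq_Ioc.symm

/-- The distribution function of an invariant measure without atoms has equal increments over an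
interval and over its image. -/
lemma equivariant_of_isInvariant (hD : D.IsPartition) (hT : Gluing.Realizes T D) {μ : Measure ℝ}
    [IsFiniteMeasure μ] [NullSingletonClass μ] (hμ : IsInvariant T μ) :
    D.Equivariant fun z => μ.real (Iic z) := by
  intro i t h0 h1
  have key : ∀ a b, {z | z ∈ T.dom ∧ T.map z ∈ Ioo (D.y i) (D.y i + t)} = Ioo a b →
      μ.real (Ioo (D.y i) (D.y i + t)) = μ.real (Ioo a b) := by
    intro a b h
    rw [Measure.real, Measure.real, ← hμ _ measurableSet_Ioo, h]
  have hpre : ∀ z, (z ∈ T.dom ∧ T.map z ∈ Ioo (D.y i) (D.y i + t)) ↔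
      D.move i z ∈ Ioo (D.y i) (D.y i + t) := by
    intro z
    constructor
    · rintro ⟨hz, hz'⟩
      obtain ⟨k, hk, he, hm⟩ := hT.exists_of_mem hz
      have : k = i := by
        by_contra hne
        exact Set.disjoint_left.1 (hD.y_disjoint k i hne) hm ⟨hz'.1, by linarith [hz'.2]⟩
      subst this
      rwa [← he]
    · intro hz
      have hz' : z ∈ Ioo (D.x i) (D.x i + D.len i) :=
        Gluing.preimage_move.1 ⟨hz.1, by linarith [hz.2]⟩
      exact ⟨hT.mem_dom hz', by rwa [hT.map i z hz']⟩
  beta_reduce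
  rw [measureReal_Iic_sub (by linarith)]
  by_cases hs : D.sign i = 1
  · rw [if_pos hs, measureReal_Iic_sub (by linarith)]
    refine key _ _ (Set.ext fun z => (hpre z).trans ?_)
    simp only [Gluing.move, if_pos hs, mem_Ioo]
    constructor <;> rintro ⟨h1, h2⟩ <;> constructor <;> linarith
  · rw [if_neg hs, measureReal_Iic_sub (by linarith)]
    refine key _ _ (Set.ext fun z => (hpre z).trans ?_)
    simp only [Gluing.move, if_neg hs, mem_Ioo]
    constructor <;> rintro ⟨h1, h2⟩ <;> constructor <;> linarith

/-- Unique ergodicity, if the only increasing equivariant functions are linear. -/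
lemma isUniquelyErgodic_of_linear (hD : D.IsPartition) (hT : Gluing.Realizes T D)
    (hinf : ∀ O, IsSaturated T O → (∃ x ∈ O, x ∈ Ioo 0 1) → O.Infinite)
    (hlin : ∀ F : ℝ → ℝ, Monotone F → F 0 = 0 → D.Equivariant F →
      ∃ c, ∀ z ∈ Icc (0 : ℝ) 1, F z = c * z) : IsUniquelyErgodic (Icc 0 1) T := by
  refine ⟨hD.isInvariant_volume hT, fun μ _ hsupp hμ => ?_⟩
  have := nullSingletonClass_of_isInvariant hD hT hinf hμ
  have h0 : μ (Iic 0) = 0 := by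
    rw [← measure_congr Iio_ae_eq_Iic]
    refine measure_mono_null (fun x hx => ?_) hsupp
    exact fun h => absurd h.1 (not_le.2 hx)
  have hmono : Monotone fun z => μ.real (Iic z) := fun a b h =>
    measureReal_mono (Iic_subset_Iic.2 h)
  obtain ⟨c, hc⟩ := hlin _ hmono (by simp [Measure.real, h0])
    (equivariant_of_isInvariant hD hT hμ)
  have hc0 : 0 ≤ c := by
    have := hc 1 ⟨zero_le_one, le_rfl⟩
    rw [mul_one] at this
    rw [← this]
    exact measureReal_nonneg
  refine ⟨c.toNNReal, Measure.ext_of_Iic _ _ fun z => ?_⟩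
  rw [Measure.smul_apply, Measure.restrict_apply measurableSet_Iic]
  have hval : ∀ z ∈ Icc (0 : ℝ) 1, μ (Iic z) = ENNReal.ofReal (c * z) := by
    intro z hz
    rw [← hc z hz, ofReal_measureReal]
  rcases lt_or_ge z 0 with hz | hz
  · rw [measure_mono_null (Iic_subset_Iic.2 hz.le) h0]
    have : Iic z ∩ Icc (0 : ℝ) 1 = ∅ := by
      ext x
      simp only [mem_inter_iff, mem_Iic, mem_Icc, mem_empty_iff_false, iff_false]
      rintro ⟨h1, h2, -⟩
      linarith
    rw [this, measure_empty, smul_zero]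
  · have hinter : Iic z ∩ Icc (0 : ℝ) 1 = Icc 0 (min z 1) := by
      ext x
      simp only [mem_inter_iff, mem_Iic, mem_Icc, le_min_iff]
      tauto
    have hIic : μ (Iic z) = μ (Iic (min z 1)) := by
      refine le_antisymm ?_ (measure_mono (Iic_subset_Iic.2 (min_le_left _ _)))
      have : Iic z ⊆ Iic (min z 1) ∪ (Icc (0 : ℝ) 1)ᶜ := by
        intro x hx
        by_cases h : x ≤ 1
        · exact Or.inl (le_min hx h)
        · exact Or.inr fun h' => h h'.2
      refine (measure_mono this).trans ((measure_union_le _ _).trans_eq ?_)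
      rw [hsupp, add_zero]
    rw [hinter, hIic, hval _ ⟨le_min hz zero_le_one, min_le_right _ _⟩, Real.volume_Icc, sub_zero,
      ENNReal.ofReal_mul hc0, ENNReal.smul_def, smul_eq_mul, ENNReal.ofReal]

/-- Orbits are unions of orbits, so they are infinite; unique ergodicity provides a dense one. -/
lemma isMinimalExchange_of_isUniquelyErgodic (hD : D.IsPartition) (hT : Gluing.Realizes T D)
    (hinf : ∀ O, IsSaturated T O → (∃ x ∈ O, x ∈ Ioo 0 1) → O.Infinite)
    (h : IsUniquelyErgodic (Icc 0 1) T) : IsMinimalExchange (Icc 0 1) T := by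
  refine ⟨isTransitive_of_isUniquelyErgodic (fun E hE => hT.measurableSet_preimage hE) h,
    fun p hp => ?_⟩
  rw [interior_Icc] at hp
  exact hinf _ (isSaturated_orbit (hD.injOn hT) p) ⟨p, mem_orbit_self p, hp⟩

end

lemma isPartition_gluing {n : ℕ} {l : Fin n → ℝ} (hl : ∀ i, 0 < l i) (hsum : ∑ i, l i = 1)
    (p : SignedPerm n) : (gluing l p).IsPartition := by
  have hl' : ∀ i, 0 ≤ l i := fun i => (hl i).le
  have hbound : ∀ (f : Equiv.Perm (Fin n)) (i), (∑ j with f j < f i, l j) + l i ≤ 1 := by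
    intro f i
    rw [← hsum, add_comm,
      ← Finset.sum_insert (s := Finset.univ.filter fun j => f j < f i) (a := i) (by simp)]
    exact Finset.sum_le_univ_sum_of_nonneg hl'
  refine ⟨hl, fun i => ⟨?_, hbound (Equiv.refl _) i⟩, fun i => ⟨?_, hbound p.perm i⟩,
    fun i k h => subinterval_disjoint hl' h, fun i k h => ?_, hsum⟩
  · simp only [gluing, leftEnd]
    exact Finset.sum_nonneg' hl'
  · simp only [gluing, imageLeftEnd]
    exact Finset.sum_nonneg' hl'
  · rw [Set.disjoint_left]
    rintro z ⟨h1, h2⟩ ⟨h3, h4⟩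
    simp only [gluing, imageLeftEnd] at h1 h2 h3 h4
    rcases lt_or_gt_of_ne (p.perm.injective.ne h) with h | h
    · linarith [sum_lt_add_le_sum_lt hl' p.perm h]
    · linarith [sum_lt_add_le_sum_lt hl' p.perm h]

/-! ### Unique ergodicity and minimality of the exchange of the unit interval -/

lemma gluing_cycleVertex_zero (l : Fin 4 → ℝ) : gluing l (cycleVertex 0) =
    ⟨![0, l 0, l 0 + l 1, l 0 + l 1 + l 2], ![l 2 + l 3, l 0 + l 2 + l 3, 0, l 2], l,
      ![-1, 1, 1, -1]⟩ := by
  rw [gluing_apply, cycleVertex_sign]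
  ext i
  · rfl
  · fin_cases i <;> simp [cycleVertex_perm]
  · rfl
  · rfl

lemma Gluing.incr_sub_mul {ι : Type*} (D : Gluing ι) (F : ℝ → ℝ) (c : ℝ) (i : ι) :
    D.incr (fun x => F x - c * x) i = D.incr F i - c * D.len i := by
  simp only [Gluing.incr]
  ring

/-- Adding up the increments from left to right, over the intervals and over their images, shows
that `G` vanishes at all ends. -/
lemma vanishesAtEnds_of_incr_eq_zero {l : Fin 4 → ℝ} (hl : ∀ i, 0 < l i) {G : ℝ → ℝ}
    (hG : (gluing l (cycleVertex 0)).Equivariant G) (h0 : G 0 = 0)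
    (hinc : ∀ i, (gluing l (cycleVertex 0)).incr G i = 0) :
    (gluing l (cycleVertex 0)).VanishesAtEnds G := by
  have himg := fun i => (hG.image_incr (i := i) (hl i).le).trans (hinc i)
  have hx := hinc
  unfold Gluing.incr at hx
  rw [gluing_cycleVertex_zero] at himg hx ⊢
  have x0 := hx 0
  have x1 := hx 1
  have x2 := hx 2
  have x3 := hx 3
  have y0 := himg 0
  have y1 := himg 1
  have y2 := himg 2
  have y3 := himg 3
  have e1 : l 2 + l 3 + l 0 = l 0 + l 2 + l 3 := by ring
  have e2 : l 0 + l 2 + l 3 + l 1 = l 0 + l 1 + l 2 + l 3 := by ring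
  simp [h0, e1, e2] at x0 x1 x2 x3 y0 y1 y2 y3
  intro i
  fin_cases i <;> simp [h0, e1, e2] <;>
    (repeat' apply And.intro) <;> linarith

section
variable {σ : ℝ}

/-- An increasing function that is equivariant under the self-induced exchange is linear: its
increments over the exchanged intervals have nonnegative preimages under all powers of the matrix of
the cycle, so that they are proportional to the Perron-Frobenius eigenvector. -/
lemma exists_linear_of_equivariant (h6 : 6 < σ) (hσ : σ ^ 3 - 7 * σ ^ 2 + 5 * σ - 1 = 0)
    {F : ℝ → ℝ} (hmono : Monotone F) (h0 : F 0 = 0)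
    (hF : (gluing (perronVector σ) (cycleVertex 0)).Equivariant F) :
    ∃ c, ∀ z ∈ Icc (0 : ℝ) 1, F z = c * z := by
  have hpos := perronVector_pos h6
  have hv := mulVec_perronVector hσ
  have hren := isRenormalizable_cycle (by linarith) hpos hv
  have hl0 := cycleLengths_zero (by linarith) hv
  have hF' : (gluing (cycleLengths σ (perronVector σ) 0)
      (periodicPath cycleVertex 0)).Equivariant F := by
    rw [hl0]
    exact hF
  set D : ℕ → Gluing (Fin 4) := fun j =>
    gluing (cycleLengths σ (perronVector σ) j) (periodicPath cycleVertex j) with hD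
  set M : Matrix (Fin 4) (Fin 4) ℝ := cycleMatrix.map (fun z : ℤ => (z : ℝ)) with hM
  have hinc : ∀ k, (D (9 * k)).incr F = M.mulVec ((D (9 * (k + 1))).incr F) := by
    intro k
    have hr : ∀ r, Fin.ofNat 9 (9 * k + r) = Fin.ofNat 9 r := by
      intro r
      ext
      simp
    have hstep : ∀ r, (D (9 * k + r)).incr F =
        (stepMatrix (Fin.ofNat 9 r)).mulVec ((D (9 * k + (r + 1))).incr F) := by
      intro r
      have := hren.incr_eq hF' (9 * k + r)
      rwa [hr] at this
    rw [hM, ← stepMatrix_prod_mulVec]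
    refine (hstep 0).trans ?_
    rw [hstep 1, hstep 2, hstep 3, hstep 4, hstep 5, hstep 6, hstep 7, hstep 8]
    rfl
  obtain ⟨c, hc⟩ := exists_eq_smul_of_positive (A := M * M) (v := perronVector σ) (ρ := σ * σ)
    (w := fun k => (D (9 * (2 * k))).incr F)
    (fun i j => by
      rw [hM]
      fin_cases i <;> fin_cases j <;>
        simp [Matrix.mul_apply, Fin.sum_univ_four] <;> norm_num)
    (by nlinarith) hpos
    (by rw [← Matrix.mulVec_mulVec, hv, Matrix.mulVec_smul, hv, smul_smul])
    (fun k i => hren.incr_nonneg hmono _ i)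
    (fun k => by rw [← Matrix.mulVec_mulVec, hinc, hinc]; rfl)
  have hc' : (gluing (perronVector σ) (cycleVertex 0)).incr F = c • perronVector σ := by
    rw [← hc]
    simp only [mul_zero, hD, hl0]
    rfl
  refine ⟨c, fun z hz => ?_⟩
  have hG : (gluing (perronVector σ) (cycleVertex 0)).Equivariant fun x => F x - c * x := by
    intro i t h0 h1
    have := hF i t h0 h1
    split_ifs at this ⊢ <;> linarith
  have hN := vanishesAtEnds_of_incr_eq_zero hpos hG (by simp [h0]) fun i => by
    rw [Gluing.incr_sub_mul, hc']
    exact sub_self _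
  have hD0 : D 0 = gluing (perronVector σ) (cycleVertex 0) :=
    congrArg (fun v => gluing v (cycleVertex 0)) hl0
  refine hren.eq_mul_of_vanishesAtEnds hmono h0 (c := c) (hD0 ▸ hG) (hD0 ▸ hN) ?_
  simpa only [hl0, sum_perronVector h6] using hz

end

section
variable {σ : ℝ}

lemma infinite_of_isSaturated_exchange (h6 : 6 < σ) (hσ : σ ^ 3 - 7 * σ ^ 2 + 5 * σ - 1 = 0)
    (O : Set ℝ) (hO : IsSaturated (exchange (perronVector σ) (cycleVertex 0)) O)
    (hne : ∃ x ∈ O, x ∈ Ioo (0 : ℝ) 1) : O.Infinite := by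
  have hv := mulVec_perronVector hσ
  have hl0 := cycleLengths_zero (by linarith) hv
  refine (isRenormalizable_cycle (by linarith) (perronVector_pos h6) hv).infinite_of_isSaturated
    (O := O) ?_ ?_
  · rw [hl0]
    exact hO
  · rw [hl0, sum_perronVector h6]
    exact hne

lemma isUniquelyErgodic_exchange (h6 : 6 < σ) (hσ : σ ^ 3 - 7 * σ ^ 2 + 5 * σ - 1 = 0) :
    IsUniquelyErgodic (Icc 0 1) (exchange (perronVector σ) (cycleVertex 0)) :=
  isUniquelyErgodic_of_linear
    (isPartition_gluing (perronVector_pos h6) (sum_perronVector h6) _)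
    (realizes_exchange (fun i => (perronVector_pos h6 i).le) _)
    (infinite_of_isSaturated_exchange h6 hσ)
    fun _ hmono h0 hF => exists_linear_of_equivariant h6 hσ hmono h0 hF

lemma isMinimalExchange_exchange (h6 : 6 < σ) (hσ : σ ^ 3 - 7 * σ ^ 2 + 5 * σ - 1 = 0) :
    IsMinimalExchange (Icc 0 1) (exchange (perronVector σ) (cycleVertex 0)) :=
  isMinimalExchange_of_isUniquelyErgodic
    (isPartition_gluing (perronVector_pos h6) (sum_perronVector h6) _)
    (realizes_exchange (fun i => (perronVector_pos h6 i).le) _)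
    (infinite_of_isSaturated_exchange h6 hσ) (isUniquelyErgodic_exchange h6 hσ)

end

/-! ### The exchange of the interval has four subintervals and two flips -/

/-- A continuous extension of `f` from an open interval takes the values of `f` at the endpoints. -/
lemma eqOn_ends_of_continuousOn {Y : Type*} [TopologicalSpace Y] [T2Space Y] {V : Set ℝ}
    {f g : ℝ → Y} {a b : ℝ} (hab : a < b) (hg : ContinuousOn g V) (hf : Continuous f)
    (hV : Ioo a b ⊆ V) (heq : EqOn g f (Ioo a b)) {u : ℝ} (hu : u ∈ V) (hu' : u = a ∨ u = b) :
    g u = f u := by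
  have hcl : insert u (Ioo a b) ⊆ closure (Ioo a b) := by
    rw [closure_Ioo hab.ne]
    refine insert_subset ?_ Ioo_subset_Icc_self
    rcases hu' with rfl | rfl
    · exact left_mem_Icc.2 hab.le
    · exact right_mem_Icc.2 hab.le
  exact heq.of_subset_closure (hg.mono (insert_subset hu hV)) hf.continuousOn
    (subset_insert _ _) hcl (mem_insert _ _)

lemma Gluing.continuous_move {ι : Type*} (D : Gluing ι) (i : ι) : Continuous (D.move i) := by
  unfold Gluing.move
  split_ifs <;> fun_prop

/-- No continuous extension exists at the three inner ends, where the one-sided limits differ. -/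
lemma isIET_exchange {l : Fin 4 → ℝ} (hl : ∀ i, 0 < l i) (hsum : ∑ i, l i = 1) :
    IsIET 0 1 4 2 (exchange l (cycleVertex 0)) := by
  have hD := isPartition_gluing hl hsum (cycleVertex 0)
  have hT := realizes_exchange (fun i => (hl i).le) (cycleVertex 0)
  have h0 := hl 0
  have h1 := hl 1
  have h2 := hl 2
  have h3 := hl 3
  rw [Fin.sum_univ_four] at hsum
  generalize exchange l (cycleVertex 0) = T at hT
  rw [gluing_cycleVertex_zero] at hD hT
  set D : Gluing (Fin 4) := ⟨![0, l 0, l 0 + l 1, l 0 + l 1 + l 2],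
    ![l 2 + l 3, l 0 + l 2 + l 3, 0, l 2], l, ![-1, 1, 1, -1]⟩ with hDdef
  have hcover : ∀ z ∈ Icc (0 : ℝ) 1, ∃ i, z ∈ Icc (D.x i) (D.x i + D.len i) := by
    intro z hz
    rcases le_total z (l 0) with ha | ha
    · exact ⟨0, by simpa [hDdef] using ⟨hz.1, ha⟩⟩
    rcases le_total z (l 0 + l 1) with hb | hb
    · exact ⟨1, by simpa [hDdef] using ⟨ha, hb⟩⟩
    rcases le_total z (l 0 + l 1 + l 2) with hc | hc
    · exact ⟨2, by simpa [hDdef] using ⟨hb, hc⟩⟩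
    · exact ⟨3, by simpa [hDdef] using ⟨hc, by linarith [hz.2]⟩⟩
  refine ⟨fun i => Ioo (D.x i) (D.x i + D.len i), fun i => ⟨_, _, (hD.x_mem i).1,
    by linarith [hD.len_pos i], (hD.x_mem i).2, rfl⟩, hD.x_disjoint, ?_, hT.dom,
    fun z hz => Ioo_subset_Icc_self (hD.map_mem hT hz), hD.injOn hT, ?_, ?_, ?_⟩
  · intro z hz
    obtain ⟨i, hi⟩ := hcover z hz
    rw [← closure_Ioo (by linarith [hD.len_pos i])] at hi
    exact closure_mono (subset_iUnion (fun i => Ioo (D.x i) (D.x i + D.len i)) i) hi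
  · intro i z hz w hw
    rw [hT.map i z hz, hT.map i w hw, Real.dist_eq, Real.dist_eq]
    unfold Gluing.move
    split_ifs
    · congr 1
      ring
    · rw [← abs_neg]
      congr 1
      ring
  · intro U hU hUI hTU g hg hgT
    refine Subset.antisymm (fun u hu => ?_) hTU
    have hu01 : u ∈ Ioo (0 : ℝ) 1 := by
      rw [← interior_Icc]
      exact interior_maximal hUI hU hu
    have hIU : ∀ i, Ioo (D.x i) (D.x i + D.len i) ⊆ U := fun i z hz => hTU (hT.mem_dom hz)
    have hval : ∀ i, u = D.x i ∨ u = D.x i + D.len i → g u = D.move i u := fun i hi =>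
      eqOn_ends_of_continuousOn (by linarith [hD.len_pos i]) hg (D.continuous_move i) (hIU i)
        (fun z hz => (hgT (hT.mem_dom hz)).trans (hT.map i z hz)) hu hi
    -- a point of `U` outside the domain is one of the three inner ends, where `T` jumps
    have hjump : u ≠ l 0 ∧ u ≠ l 0 + l 1 ∧ u ≠ l 0 + l 1 + l 2 := by
      refine ⟨fun h => ?_, fun h => ?_, fun h => ?_⟩
      · have e0 := hval 0 (Or.inr (by simpa [hDdef] using h))
        have e1 := hval 1 (Or.inl (by simpa [hDdef] using h))
        simp [hDdef, Gluing.move] at e0 e1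
        linarith
      · have e0 := hval 1 (Or.inr (by simpa [hDdef] using h))
        have e1 := hval 2 (Or.inl (by simpa [hDdef] using h))
        simp [hDdef, Gluing.move] at e0 e1
        linarith
      · have e0 := hval 2 (Or.inr (by simpa [hDdef] using h))
        have e1 := hval 3 (Or.inl (by simpa [hDdef] using h))
        simp [hDdef, Gluing.move] at e0 e1
        linarith
    obtain ⟨i, hi1, hi2⟩ := hcover u (Ioo_subset_Icc_self hu01)
    refine hT.mem_dom (i := i) ⟨lt_of_le_of_ne hi1 fun h => ?_, lt_of_le_of_ne hi2 fun h => ?_⟩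
    · fin_cases i <;> simp [hDdef] at h
      · exact hu01.1.ne h
      · exact hjump.1 h.symm
      · exact hjump.2.1 h.symm
      · exact hjump.2.2 h.symm
    · fin_cases i <;> simp [hDdef] at h
      · exact hjump.1 h
      · exact hjump.2.1 h
      · exact hjump.2.2 h
      · linarith [hu01.2]
  · have hflip : ∀ i, ReversesOn T (Ioo (D.x i) (D.x i + D.len i)) ↔ D.sign i ≠ 1 := by
      intro i
      have hli := hD.len_pos i
      constructor
      · rintro ⟨c, hc⟩ hs
        have e1 : D.x i + D.len i / 3 ∈ Ioo (D.x i) (D.x i + D.len i) := ⟨by linarith, by linarith⟩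
        have e2 : D.x i + D.len i / 2 ∈ Ioo (D.x i) (D.x i + D.len i) := ⟨by linarith, by linarith⟩
        have c1 := hc _ e1
        have c2 := hc _ e2
        rw [hT.map i _ e1, Gluing.move, if_pos hs] at c1
        rw [hT.map i _ e2, Gluing.move, if_pos hs] at c2
        linarith
      · intro hs
        refine ⟨D.y i + (D.x i + D.len i), fun z hz => ?_⟩
        rw [hT.map i z hz, Gluing.move, if_neg hs]
        ring
    have : {i | ReversesOn T (Ioo (D.x i) (D.x i + D.len i))} = {0, 3} := by
      ext i
      rw [mem_ofPred_eq, hflip]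
      fin_cases i <;> simp [hDdef]
    rw [this, ncard_pair (by decide)]

/-! ### The exchange of the circle -/

/-- The representative in `[0, 1)` of a point of the circle. -/
noncomputable def circleRep (y : UnitAddCircle) : ℝ := AddCircle.equivIco 1 0 y

lemma circleRep_mem (y : UnitAddCircle) : circleRep y ∈ Ico (0 : ℝ) 1 := by
  have h := (AddCircle.equivIco 1 0 y).2
  exact ⟨h.1, h.2.trans_eq (zero_add 1)⟩

lemma circleRep_coe {z : ℝ} (hz : z ∈ Ico (0 : ℝ) 1) : circleRep (z : UnitAddCircle) = z := by
  unfold circleRep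
  rw [AddCircle.equivIco_coe_eq (by simpa using hz)]

lemma coe_circleRep (y : UnitAddCircle) : (circleRep y : UnitAddCircle) = y :=
  (AddCircle.equivIco 1 0).symm_apply_apply y

lemma measurable_circleRep : Measurable circleRep :=
  measurable_subtype_coe.comp (AddCircle.measurableEquivIco 1 0).measurable

lemma coe_inj_of_mem_Ico {a z w : ℝ} (hz : z ∈ Ico a (a + 1)) (hw : w ∈ Ico a (a + 1))
    (h : (z : UnitAddCircle) = w) : z = w :=
  (AddCircle.coe_eq_coe_iff_of_mem_Ico hz hw).1 h

section
variable (l : Fin 4 → ℝ)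

/-- Left ends of the three arcs that are exchanged; the last one ends at `1`. -/
def arcLeft : Fin 3 → ℝ := ![0, l 0, l 0 + l 1 + l 2]

/-- Right ends of the three arcs that are exchanged. -/
def arcRight : Fin 3 → ℝ := ![l 0, l 0 + l 1 + l 2, 1]

/-- Lifts to the line of the isometries of the circle by which the three arcs are moved. -/
def arcMove : Fin 3 → ℝ → ℝ :=
  ![fun z => l 0 + l 2 + l 3 - z, fun z => l 2 + l 3 + z, fun z => l 2 + 1 - z]

/-- The exchanged arcs: the second one consists of the second and third subintervals of the
interval exchange and the point between them. -/
def arc (i : Fin 3) : Set UnitAddCircle :=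
  (fun x : ℝ => (x : UnitAddCircle)) '' Ioo (arcLeft l i) (arcRight l i)

/-- The map induced on the circle by the interval exchange with lengths `l` and signed permutation
`(-3, 4, 1, -2)`. -/
noncomputable def circleExchange : PartialMap UnitAddCircle where
  dom := ⋃ i, arc l i
  map y := arcMove l (if circleRep y < l 0 then 0 else if circleRep y < l 0 + l 1 + l 2 then 1
    else 2) (circleRep y)

variable {l}

lemma continuous_arcMove (i : Fin 3) : Continuous (arcMove l i) := by
  fin_cases i <;> simp [arcMove] <;> fun_prop

lemma dist_coe_arcMove (i : Fin 3) (z w : ℝ) :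
    dist (arcMove l i z : UnitAddCircle) (arcMove l i w) = dist (z : UnitAddCircle) w := by
  fin_cases i
  · change dist ((l 0 + l 2 + l 3 - z : ℝ) : UnitAddCircle) (l 0 + l 2 + l 3 - w : ℝ) = _
    rw [AddCircle.coe_sub, AddCircle.coe_sub, dist_sub_left]
  · change dist ((l 2 + l 3 + z : ℝ) : UnitAddCircle) (l 2 + l 3 + w : ℝ) = _
    simp only [AddCircle.coe_add, dist_add_left]
  · change dist ((l 2 + 1 - z : ℝ) : UnitAddCircle) (l 2 + 1 - w : ℝ) = _
    rw [AddCircle.coe_sub, AddCircle.coe_sub, dist_sub_left]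

/-- On the circle, each arc is moved by a rotation or a reflection. -/
lemma exists_circle_affine (i : Fin 3) : ∃ f : UnitAddCircle → UnitAddCircle, Continuous f ∧
    ∀ z : ℝ, (arcMove l i z : UnitAddCircle) = f z := by
  fin_cases i
  · exact ⟨fun y => ((l 0 + l 2 + l 3 : ℝ) : UnitAddCircle) - y, by fun_prop, fun z => by
      simp [arcMove]⟩
  · exact ⟨fun y => ((l 2 + l 3 : ℝ) : UnitAddCircle) + y, by fun_prop, fun z => by
      simp [arcMove]⟩
  · exact ⟨fun y => ((l 2 + 1 : ℝ) : UnitAddCircle) - y, by fun_prop, fun z => by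
      simp [arcMove]⟩

variable (hl : ∀ i, 0 < l i) (hsum : l 0 + l 1 + l 2 + l 3 = 1)

include hl hsum

lemma arc_bounds (i : Fin 3) : 0 ≤ arcLeft l i ∧ arcLeft l i < arcRight l i ∧ arcRight l i ≤ 1 := by
  have h0 := hl 0
  have h1 := hl 1
  have h2 := hl 2
  have h3 := hl 3
  fin_cases i <;> simp [arcLeft, arcRight] <;>
    (repeat' apply And.intro) <;> linarith

lemma circleExchange_coe {i : Fin 3} {z : ℝ} (hz : z ∈ Ioo (arcLeft l i) (arcRight l i)) :
    (circleExchange l).map (z : UnitAddCircle) = arcMove l i z := by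
  have hb := arc_bounds hl hsum i
  have h1 := hl 1
  have h2 := hl 2
  simp only [circleExchange]
  rw [circleRep_coe ⟨by linarith [hz.1], by linarith [hz.2]⟩]
  fin_cases i <;> simp [arcLeft, arcRight] at hz
  · simp [hz.2]
  · simp [hz.1.le.not_gt, hz.2]
  · rw [if_neg (by linarith), if_neg (by linarith)]
    rfl

/-- The lifted images tile an interval of length `1` that starts at `l 2`, so that different points
of it are different on the circle. -/
lemma arcMove_mem {i : Fin 3} {z : ℝ} (hz : z ∈ Ioo (arcLeft l i) (arcRight l i)) :
    arcMove l i z ∈ Ico (l 2) (l 2 + 1) := by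
  have h0 := hl 0
  have h1 := hl 1
  have h2 := hl 2
  have h3 := hl 3
  fin_cases i <;> simp [arcLeft, arcRight, arcMove] at hz ⊢ <;> constructor <;> linarith

lemma arcMove_inj {i k : Fin 3} {z w : ℝ} (hz : z ∈ Ioo (arcLeft l i) (arcRight l i))
    (hw : w ∈ Ioo (arcLeft l k) (arcRight l k)) (h : arcMove l i z = arcMove l k w) : z = w := by
  have h0 := hl 0
  have h1 := hl 1
  have h2 := hl 2
  have h3 := hl 3
  fin_cases i <;> fin_cases k <;> simp [arcLeft, arcRight, arcMove] at hz hw h <;> linarith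

lemma injOn_circleExchange : InjOn (circleExchange l).map (circleExchange l).dom := by
  intro y hy y' hy' h
  obtain ⟨i, z, hz, rfl⟩ := mem_iUnion.1 hy
  obtain ⟨k, w, hw, rfl⟩ := mem_iUnion.1 hy'
  beta_reduce at h
  rw [circleExchange_coe hl hsum hz, circleExchange_coe hl hsum hw] at h
  have := coe_inj_of_mem_Ico (arcMove_mem hl hsum hz) (arcMove_mem hl hsum hw) h
  rw [arcMove_inj hl hsum hz hw this]

omit hl hsum in
lemma isOpen_arc (i : Fin 3) : IsOpen (arc l i) :=
  QuotientAddGroup.isOpenMap_coe _ isOpen_Ioo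

omit hl hsum in
lemma isOpen_dom_circleExchange : IsOpen (circleExchange l).dom := isOpen_iUnion isOpen_arc

lemma continuousOn_circleExchange : ContinuousOn (circleExchange l).map (circleExchange l).dom := by
  intro y hy
  obtain ⟨i, hi⟩ := mem_iUnion.1 hy
  obtain ⟨f, hf, hfe⟩ := exists_circle_affine (l := l) i
  refine (hf.continuousAt.congr ?_).continuousWithinAt
  filter_upwards [(isOpen_arc i).mem_nhds hi]
  rintro _ ⟨z, hz, rfl⟩
  rw [← hfe]
  exact (circleExchange_coe hl hsum hz).symm

omit hl hsum in
lemma exists_mem_Icc_arc (y : UnitAddCircle) :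
    ∃ i, ∃ z ∈ Icc (arcLeft l i) (arcRight l i), (z : UnitAddCircle) = y := by
  obtain ⟨h0, h1⟩ := circleRep_mem y
  have hy := coe_circleRep y
  rcases le_total (circleRep y) (l 0) with ha | ha
  · exact ⟨0, circleRep y, ⟨h0, ha⟩, hy⟩
  rcases le_total (circleRep y) (l 0 + l 1 + l 2) with hb | hb
  · exact ⟨1, circleRep y, ⟨ha, hb⟩, hy⟩
  · exact ⟨2, circleRep y, ⟨hb, h1.le⟩, hy⟩

/-- The map jumps at the common ends of the three arcs, and flips the first and the third. -/
lemma isCET_circleExchange : IsCET 3 2 (circleExchange l) := by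
  have h0 := hl 0
  have h1 := hl 1
  have h2 := hl 2
  have h3 := hl 3
  have hb := arc_bounds hl hsum
  refine ⟨arc l, fun i => ⟨_, _, (hb i).2.1, by linarith [(hb i).1, (hb i).2.2], rfl⟩, ?_, ?_, rfl,
    mapsTo_univ _ _, injOn_circleExchange hl hsum, ?_, ?_, ?_⟩
  · intro i k hik
    rw [Set.disjoint_left]
    rintro _ ⟨z, hz, rfl⟩ ⟨w, hw, he⟩
    have hbi := hb i
    have hbk := hb k
    have := coe_inj_of_mem_Ico (a := 0) ⟨by linarith [hw.1], by linarith [hw.2]⟩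
      ⟨by linarith [hz.1], by linarith [hz.2]⟩ he
    subst this
    fin_cases i <;> fin_cases k <;> simp [arcLeft, arcRight] at hik hz hw <;> linarith
  · intro y _
    obtain ⟨i, z, hz, rfl⟩ := exists_mem_Icc_arc (l := l) y
    rw [← closure_Ioo (hb i).2.1.ne] at hz
    exact closure_mono (subset_iUnion (arc l) i)
      (image_closure_subset_closure_image (AddCircle.continuous_mk' 1) (mem_image_of_mem _ hz))
  · rintro i _ ⟨z, hz, rfl⟩ _ ⟨w, hw, rfl⟩
    beta_reduce
    rw [circleExchange_coe hl hsum hz, circleExchange_coe hl hsum hw, dist_coe_arcMove]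
  · intro U hU _ hSU g hg hgS
    refine Subset.antisymm (fun u hu => ?_) hSU
    set V : Set ℝ := {z | (z : UnitAddCircle) ∈ U} with hV
    have hgV : ContinuousOn (fun z : ℝ => g z) V :=
      hg.comp (AddCircle.continuous_mk' 1).continuousOn fun z hz => hz
    have hmem : ∀ i, ∀ z ∈ Ioo (arcLeft l i) (arcRight l i),
        (z : UnitAddCircle) ∈ (circleExchange l).dom := fun i z hz =>
      mem_iUnion.2 ⟨i, z, hz, rfl⟩
    have hval : ∀ i, ∀ z ∈ V, z = arcLeft l i ∨ z = arcRight l i →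
        g z = (arcMove l i z : UnitAddCircle) := fun i z hz hzi =>
      eqOn_ends_of_continuousOn (g := fun z : ℝ => g z)
        (f := fun z => (arcMove l i z : UnitAddCircle)) (hb i).2.1 hgV
        ((AddCircle.continuous_mk' 1).comp (continuous_arcMove i)) (fun z hz => hSU (hmem i z hz))
        (fun z hz => (hgS (hmem i z hz)).trans (circleExchange_coe hl hsum hz)) hz hzi
    have hone : ((1 : ℝ) : UnitAddCircle) = ((0 : ℝ) : UnitAddCircle) := by
      simp
    have hne : ∀ z w : ℝ, z ∈ Ico (l 2) (l 2 + 1) → w ∈ Ico (l 2) (l 2 + 1) → z ≠ w →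
        (z : UnitAddCircle) ≠ w := fun z w hz hw h he => h (coe_inj_of_mem_Ico hz hw he)
    -- the map jumps at the three common ends of the arcs
    have hjump0 : (0 : ℝ) ∉ V := by
      intro h
      have h' : (1 : ℝ) ∈ V := by
        rw [hV, mem_ofPred_eq, hone]
        exact h
      have e0 := hval 0 0 h (Or.inl rfl)
      have e1 := hval 2 1 h' (Or.inr rfl)
      rw [hone, e0] at e1
      refine hne _ _ ?_ ?_ ?_ e1 <;> simp [arcMove]
      · constructor <;> linarith
      · linarith
    have hjump1 : l 0 ∉ V := by
      intro h
      have e0 := hval 0 _ h (Or.inr rfl)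
      have e1 := hval 1 _ h (Or.inl rfl)
      rw [e0] at e1
      refine hne _ _ ?_ ?_ ?_ e1 <;> simp [arcMove]
      · constructor <;> linarith
      · constructor <;> linarith
      · intro h
        linarith
    have hjump2 : l 0 + l 1 + l 2 ∉ V := by
      intro h
      have e0 := hval 1 _ h (Or.inr rfl)
      have e1 := hval 2 _ h (Or.inl rfl)
      have e2 : ((arcMove l 1 (l 0 + l 1 + l 2) : ℝ) : UnitAddCircle) = (l 2 : ℝ) := by
        rw [show arcMove l 1 (l 0 + l 1 + l 2) = l 2 + 1 by simp [arcMove]; linarith]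
        simp
      rw [e0, e2] at e1
      refine hne _ _ ?_ ?_ ?_ e1 <;> simp [arcMove]
      · constructor <;> linarith
      · intro h
        linarith
    obtain ⟨i, z, hz, rfl⟩ := exists_mem_Icc_arc (l := l) u
    refine hmem i z ⟨lt_of_le_of_ne hz.1 ?_, lt_of_le_of_ne hz.2 ?_⟩
    · rintro rfl
      fin_cases i
      · exact hjump0 hu
      · exact hjump1 hu
      · exact hjump2 hu
    · rintro rfl
      fin_cases i
      · exact hjump1 hu
      · exact hjump2 hu
      · refine hjump0 ?_
        rw [hV, mem_ofPred_eq, ← hone]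
        exact hu
  · have : {i | ReversesOn (circleExchange l) (arc l i)} = {0, 2} := by
      ext i
      rw [mem_ofPred_eq]
      fin_cases i
      · simp only [Fin.zero_eta, mem_insert_iff, true_or, iff_true]
        refine ⟨((l 0 + l 2 + l 3 : ℝ) : UnitAddCircle), ?_⟩
        rintro _ ⟨z, hz, rfl⟩
        exact (circleExchange_coe hl hsum hz).trans (by simp [arcMove])
      · simp only [Fin.mk_one, mem_insert_iff, one_ne_zero, mem_singleton_iff, false_or]
        refine iff_of_false ?_ (by decide)
        rintro ⟨k, hk⟩
        -- a translation that is also a reflection would be constant after doubling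
        have hz : ∀ t : ℝ, 0 < t → t < l 1 + l 2 → l 0 + t ∈ Ioo (arcLeft l 1) (arcRight l 1) := by
          intro t ht ht'
          simp [arcLeft, arcRight]
          constructor <;> linarith
        have hz1 := hz ((l 1 + l 2) / 4) (by linarith) (by linarith)
        have hz2 := hz ((l 1 + l 2) / 2) (by linarith) (by linarith)
        have c1 := hk _ ⟨_, hz1, rfl⟩
        have c2 := hk _ ⟨_, hz2, rfl⟩
        beta_reduce at c1 c2
        rw [circleExchange_coe hl hsum hz1, eq_sub_iff_add_eq] at c1
        rw [circleExchange_coe hl hsum hz2, eq_sub_iff_add_eq, ← c1] at c2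
        rw [← AddCircle.coe_add, ← AddCircle.coe_add] at c2
        have := coe_inj_of_mem_Ico (a := l 2 + l 3 + 2 * l 0) ?_ ?_ c2
        · simp [arcMove] at this
          linarith
        · simp [arcMove]
          constructor <;> linarith
        · simp [arcMove]
          constructor <;> linarith
      · simp only [Fin.reduceFinMk, mem_insert_iff, mem_singleton_iff, or_true, iff_true]
        refine ⟨((l 2 + 1 : ℝ) : UnitAddCircle), ?_⟩
        rintro _ ⟨z, hz, rfl⟩
        exact (circleExchange_coe hl hsum hz).trans (by simp [arcMove])
    rw [this, ncard_pair (by decide)]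

end

/-! ### Dynamics of the exchange of the circle -/

section
variable {T : PartialMap ℝ} {S : PartialMap UnitAddCircle}

lemma IsEndpointIdentification.iterate (h : IsEndpointIdentification T S) {k : ℕ} {z : ℝ}
    (hk : T.InIterDom k z) :
    S.InIterDom k (z : UnitAddCircle) ∧ S.map^[k] (z : UnitAddCircle) = (T.map^[k] z : ℝ) := by
  induction k with
  | zero => exact ⟨fun j hj => absurd hj (Nat.not_lt_zero j), rfl⟩
  | succ k ih =>
    rw [inIterDom_succ'] at hk
    obtain ⟨h1, h2⟩ := ih hk.1
    obtain ⟨h3, h4⟩ := h.1 _ hk.2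
    refine ⟨inIterDom_succ'.2 ⟨h1, h2 ▸ h3⟩, ?_⟩
    rw [Function.iterate_succ_apply', Function.iterate_succ_apply', h2, h4]

lemma IsEndpointIdentification.coe_mem_orbit (h : IsEndpointIdentification T S) {p q : ℝ}
    (hq : q ∈ T.orbit p) : (q : UnitAddCircle) ∈ S.orbit p := by
  rcases hq with ⟨k, hk, rfl⟩ | ⟨k, hk, rfl⟩
  · exact Or.inl ⟨k, h.iterate hk⟩
  · exact Or.inr ⟨k, h.iterate hk⟩

lemma IsEndpointIdentification.isTransitive (h : IsEndpointIdentification T S)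
    (hT : IsTransitive (Icc 0 1) T) : IsTransitive univ S := by
  obtain ⟨p, -, hp⟩ := hT
  refine ⟨p, mem_univ _, fun y _ => ?_⟩
  have hy : circleRep y ∈ closure (T.orbit p) := hp (Ico_subset_Icc_self (circleRep_mem y))
  have := image_closure_subset_closure_image (AddCircle.continuous_mk' 1) (mem_image_of_mem _ hy)
  rw [← coe_circleRep y]
  refine closure_mono ?_ this
  rintro _ ⟨q, hq, rfl⟩
  exact h.coe_mem_orbit hq

/-- Orbits of points of the circle other than the identified endpoints are infinite. -/
lemma IsEndpointIdentification.infinite_orbit (h : IsEndpointIdentification T S)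
    (hT : IsSaturated T (Ioo 0 1)) {z : ℝ} (hz : z ∈ Ioo (0 : ℝ) 1) (hinf : (T.orbit z).Infinite) :
    (S.orbit (z : UnitAddCircle)).Infinite := by
  have hsub : T.orbit z ⊆ Ico 0 1 := (hT.orbit_subset hz).trans Ioo_subset_Ico_self
  refine (hinf.image (f := fun x : ℝ => (x : UnitAddCircle)) fun x hx y hy he => ?_).mono ?_
  · exact coe_inj_of_mem_Ico (a := 0) (by simpa using hsub hx) (by simpa using hsub hy) he
  · rintro _ ⟨q, hq, rfl⟩
    exact h.coe_mem_orbit hq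

end

section
variable {l : Fin 4 → ℝ} (hl : ∀ i, 0 < l i) (hsum : l 0 + l 1 + l 2 + l 3 = 1)

include hl hsum

/-- Away from the junction `l 0 + l 1` of the second and third subintervals, the exchanges of the
interval and of the circle have the same domain and the same values. -/
lemma exchange_iff_circleExchange {z : ℝ} (hz : z ∈ Ico (0 : ℝ) 1) (hne : z ≠ l 0 + l 1) :
    (z ∈ (exchange l (cycleVertex 0)).dom ↔ (z : UnitAddCircle) ∈ (circleExchange l).dom) ∧
    (z ∈ (exchange l (cycleVertex 0)).dom → (circleExchange l).map (z : UnitAddCircle) =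
      ((exchange l (cycleVertex 0)).map z : ℝ)) := by
  have h0 := hl 0
  have h1 := hl 1
  have h2 := hl 2
  have h3 := hl 3
  have hT := realizes_exchange (fun i => (hl i).le) (cycleVertex 0)
  generalize exchange l (cycleVertex 0) = T at hT
  rw [gluing_cycleVertex_zero] at hT
  have hS : ∀ i, z ∈ Ioo (arcLeft l i) (arcRight l i) →
      (z : UnitAddCircle) ∈ (circleExchange l).dom := fun i hi => mem_iUnion.2 ⟨i, z, hi, rfl⟩
  have hone : ((1 : ℝ) : UnitAddCircle) = 0 := AddCircle.coe_period 1
  refine ⟨⟨fun h => ?_, fun h => ?_⟩, fun h => ?_⟩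
  · rw [hT.dom] at h
    obtain ⟨i, hi⟩ := mem_iUnion.1 h
    fin_cases i <;> simp at hi
    · exact hS 0 (by simpa [arcLeft, arcRight] using hi)
    · exact hS 1 (by simp [arcLeft, arcRight]; constructor <;> linarith)
    · exact hS 1 (by simp [arcLeft, arcRight]; constructor <;> linarith)
    · exact hS 2 (by simp [arcLeft, arcRight]; constructor <;> linarith)
  · obtain ⟨i, w, hw, he⟩ := mem_iUnion.1 h
    have hb := arc_bounds hl hsum i
    have := coe_inj_of_mem_Ico (a := 0) ⟨by linarith [hw.1], by linarith [hw.2]⟩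
      (by simpa using hz) he
    subst this
    fin_cases i <;> simp [arcLeft, arcRight] at hw
    · exact hT.mem_dom (i := 0) (by simpa using hw)
    · rcases lt_or_gt_of_ne hne with h | h
      · exact hT.mem_dom (i := 1) (by simp; constructor <;> linarith)
      · exact hT.mem_dom (i := 2) (by simp; constructor <;> linarith)
    · exact hT.mem_dom (i := 3) (by simp; constructor <;> linarith)
  · rw [hT.dom] at h
    obtain ⟨i, hi⟩ := mem_iUnion.1 h
    rw [hT.map i z hi]
    fin_cases i <;> simp at hi
    · rw [circleExchange_coe hl hsum (i := 0) (by simpa [arcLeft, arcRight] using hi)]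
      congr 1
      simp [arcMove, Gluing.move]
      ring
    · rw [circleExchange_coe hl hsum (i := 1)
        (by simp [arcLeft, arcRight]; constructor <;> linarith)]
      congr 1
      simp [arcMove, Gluing.move]
      ring
    · rw [circleExchange_coe hl hsum (i := 1)
        (by simp [arcLeft, arcRight]; constructor <;> linarith)]
      have e : arcMove l 1 z = (z - (l 0 + l 1)) + 1 := by
        simp [arcMove]
        linarith
      rw [e, AddCircle.coe_add, hone, add_zero]
      simp [Gluing.move]
    · rw [circleExchange_coe hl hsum (i := 2)
        (by simp [arcLeft, arcRight]; constructor <;> linarith)]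
      congr 1
      simp [arcMove, Gluing.move]
      linarith

omit hsum in
lemma junction_mem : l 0 + l 1 ∈ Ioo (arcLeft l 1) (arcRight l 1) := by
  simp [arcLeft, arcRight, hl]

/-- The junction of the merged subintervals is mapped to the identified endpoints. -/
lemma circleExchange_junction :
    (circleExchange l).map ((l 0 + l 1 : ℝ) : UnitAddCircle) = 0 := by
  rw [circleExchange_coe hl hsum (junction_mem hl)]
  rw [show arcMove l 1 (l 0 + l 1) = 1 by simp [arcMove]; linarith]
  exact AddCircle.coe_period 1

lemma zero_notMem_dom_circleExchange : (0 : UnitAddCircle) ∉ (circleExchange l).dom := by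
  intro h
  obtain ⟨i, w, hw, he⟩ := mem_iUnion.1 h
  have hb := arc_bounds hl hsum i
  have := coe_inj_of_mem_Ico (a := 0) (w := 0) ⟨by linarith [hw.1], by linarith [hw.2]⟩
    (by simp) he
  linarith [hw.1]

lemma dom_exchange_subset : (exchange l (cycleVertex 0)).dom ⊆ Ioo 0 1 ∧
    l 0 + l 1 ∉ (exchange l (cycleVertex 0)).dom := by
  have h0 := hl 0
  have h1 := hl 1
  have h2 := hl 2
  have h3 := hl 3
  have hT := realizes_exchange (fun i => (hl i).le) (cycleVertex 0)
  rw [gluing_cycleVertex_zero] at hT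
  rw [hT.dom]
  constructor
  · refine iUnion_subset fun i z hz => ?_
    fin_cases i <;> simp at hz ⊢ <;> constructor <;> linarith
  · intro h
    obtain ⟨i, hi⟩ := mem_iUnion.1 h
    fin_cases i <;> simp at hi <;> linarith

lemma isEndpointIdentification_circleExchange :
    IsEndpointIdentification (exchange l (cycleVertex 0)) (circleExchange l) := by
  refine ⟨fun z hz => ?_, continuousOn_circleExchange hl hsum⟩
  obtain ⟨hd, hj⟩ := dom_exchange_subset hl hsum
  have := exchange_iff_circleExchange hl hsum (Ioo_subset_Ico_self (hd hz))
    (fun h => hj (h ▸ hz))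
  exact ⟨this.1.1 hz, this.2 hz⟩

/-- The orbit of the identified endpoints is infinite too, since it contains the junction. -/
lemma isMinimalExchange_circleExchange
    (h : IsMinimalExchange (Icc 0 1) (exchange l (cycleVertex 0))) :
    IsMinimalExchange univ (circleExchange l) := by
  have hid := isEndpointIdentification_circleExchange hl hsum
  have hD := isPartition_gluing hl (by rw [Fin.sum_univ_four]; exact hsum) (cycleVertex 0)
  have hT := realizes_exchange (fun i => (hl i).le) (cycleVertex 0)
  have hsat : IsSaturated (exchange l (cycleVertex 0)) (Ioo 0 1) := fun z hz =>
    iff_of_true (hD.map_mem hT hz) (hD.dom_subset hT hz)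
  have hinf : ∀ z ∈ Ioo (0 : ℝ) 1, ((circleExchange l).orbit (z : UnitAddCircle)).Infinite := by
    intro z hz
    exact hid.infinite_orbit hsat hz (h.2 z (by rwa [interior_Icc]))
  refine ⟨hid.isTransitive h.1, fun y _ => ?_⟩
  obtain ⟨h0, h1⟩ := circleRep_mem y
  rcases h0.eq_or_lt with h0 | h0
  · -- the identified endpoints are the image of the junction
    have hy : y = 0 := by
      rw [← coe_circleRep y, ← h0]
      rfl
    have hS := isSaturated_orbit (injOn_circleExchange hl hsum) y
    have hjd : ((l 0 + l 1 : ℝ) : UnitAddCircle) ∈ (circleExchange l).dom :=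
      mem_iUnion.2 ⟨1, _, junction_mem hl, rfl⟩
    have hj : ((l 0 + l 1 : ℝ) : UnitAddCircle) ∈ (circleExchange l).orbit y := by
      rw [← hS _ hjd, circleExchange_junction hl hsum, hy]
      exact mem_orbit_self _
    exact (hinf _ ⟨by linarith [hl 0, hl 1], by linarith [hl 2, hl 3]⟩).mono (hS.orbit_subset hj)
  · rw [← coe_circleRep y]
    exact hinf _ ⟨h0, h1⟩

lemma measurableSet_preimage_circleExchange {E : Set UnitAddCircle} (hE : MeasurableSet E) :
    MeasurableSet {y | y ∈ (circleExchange l).dom ∧ (circleExchange l).map y ∈ E} := by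
  have hd := isOpen_dom_circleExchange (l := l) |>.measurableSet
  have hc := (continuousOn_circleExchange hl hsum).domRestrict.measurable hE
  convert hd.subtype_image hc using 1
  ext y
  simp [and_comm]

omit hl hsum in
lemma map_coe_volume_Icc :
    (volume.restrict (Icc (0 : ℝ) 1)).map (fun x : ℝ => (x : UnitAddCircle)) = volume := by
  rw [Measure.restrict_congr_set Ioc_ae_eq_Icc.symm]
  have := (UnitAddCircle.measurePreserving_mk 0).map_eq
  rwa [zero_add] at this

/-- Invariant measures correspond to those of the interval exchange, since an invariant measure on
the circle vanishes at the identified endpoints, where the map is undefined, and hence at the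
junction, which is mapped to them. -/
lemma isUniquelyErgodic_circleExchange
    (h : IsUniquelyErgodic (Icc 0 1) (exchange l (cycleVertex 0))) :
    IsUniquelyErgodic univ (circleExchange l) := by
  have hD := isPartition_gluing hl (by rw [Fin.sum_univ_four]; exact hsum) (cycleVertex 0)
  have hT := realizes_exchange (fun i => (hl i).le) (cycleVertex 0)
  have hid := isEndpointIdentification_circleExchange hl hsum
  have hTmeas : ∀ {E : Set ℝ}, MeasurableSet E → MeasurableSet _ :=
    fun {E} hE => hT.measurableSet_preimage (E := E) hE
  have hTdom : MeasurableSet (exchange l (cycleVertex 0)).dom := by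
    simpa using hTmeas MeasurableSet.univ
  have hcoe : Measurable fun x : ℝ => (x : UnitAddCircle) := (AddCircle.continuous_mk' 1).measurable
  have hSmeas := fun {E : Set UnitAddCircle} (hE : MeasurableSet E) =>
    measurableSet_preimage_circleExchange hl hsum hE
  constructor
  · intro E hE
    rw [Measure.restrict_univ, ← map_coe_volume_Icc, Measure.map_apply hcoe (hSmeas hE),
      Measure.map_apply hcoe hE, ← h.1 _ (hcoe hE)]
    refine measure_congr ?_
    have hae : ∀ᵐ z ∂(volume.restrict (Icc (0 : ℝ) 1)), z ∈ (exchange l (cycleVertex 0)).dom :=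
      measure_eq_zero_iff_ae_notMem.1 (h.1.measure_compl_dom hTdom) |>.mono
        fun z hz => not_not.1 hz
    filter_upwards [hae] with z hz
    obtain ⟨h1, h2⟩ := hid.1 z hz
    refine propext (?_ : (_ ∧ _) ↔ (_ ∧ _))
    rw [h2]
    exact and_congr_left fun _ => iff_of_true h1 hz
  · intro ν _ _ hν
    have hrep := measurable_circleRep
    have hνdom := hν.measure_compl_dom isOpen_dom_circleExchange.measurableSet
    have hν0 : ν {0} = 0 := measure_mono_null
      (singleton_subset_iff.2 (zero_notMem_dom_circleExchange hl hsum)) hνdom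
    have hνj : ν {((l 0 + l 1 : ℝ) : UnitAddCircle)} = 0 := by
      rw [← hν _ (measurableSet_singleton 0)] at hν0
      refine measure_mono_null (singleton_subset_iff.2 ?_) hν0
      exact ⟨mem_iUnion.2 ⟨1, _, junction_mem hl, rfl⟩, circleExchange_junction hl hsum⟩
    have hinv : IsInvariant (exchange l (cycleVertex 0)) (ν.map circleRep) := by
      intro E hE
      rw [Measure.map_apply hrep (hTmeas hE), Measure.map_apply hrep hE, ← hν _ (hrep hE)]
      refine measure_congr ?_
      filter_upwards [measure_eq_zero_iff_ae_notMem.1 hνj] with y hy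
      have hne : circleRep y ≠ l 0 + l 1 := by
        intro he
        rw [← he, coe_circleRep] at hy
        exact hy rfl
      obtain ⟨h1, h2⟩ := exchange_iff_circleExchange hl hsum (circleRep_mem y) hne
      rw [coe_circleRep] at h1 h2
      refine propext (?_ : (_ ∧ _) ↔ (_ ∧ _))
      rw [← h1]
      refine and_congr_right fun hd => ?_
      change _ ↔ circleRep _ ∈ E
      rw [h2 hd, circleRep_coe (Ioo_subset_Ico_self (hD.map_mem hT hd))]
    obtain ⟨c, hc⟩ := h.2 (ν.map circleRep) inferInstance (by
      rw [Measure.map_apply hrep measurableSet_Icc.compl]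
      convert measure_empty (μ := ν)
      ext y
      simpa using ⟨(circleRep_mem y).1, (circleRep_mem y).2.le⟩) hinv
    refine ⟨c, ?_⟩
    have hback := congrArg (fun μ : Measure ℝ => μ.map fun x : ℝ => (x : UnitAddCircle)) hc
    beta_reduce at hback
    rw [Measure.map_map hcoe hrep, Measure.map_smul, map_coe_volume_Icc] at hback
    have hcomp : (fun x : ℝ => (x : UnitAddCircle)) ∘ circleRep = id := funext coe_circleRep
    rw [Measure.restrict_univ, ← hback, hcomp, Measure.map_id]

end

end ExchangeMaps

open ExchangeMaps in
theorem mainTheorem3 :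
    (∃ (γ : Fin 10 → SignedPerm 4) (σ : ℝ) (l : Fin 4 → ℝ) (S : PartialMap UnitAddCircle),
      (γ 0).entry = ![-3, 4, 1, -2] ∧
      IsSpecialCycle γ ![EdgeType.a, EdgeType.b, EdgeType.a, EdgeType.b, EdgeType.b,
        EdgeType.a, EdgeType.b, EdgeType.a, EdgeType.b] ∧
      productMatrix γ ![EdgeType.a, EdgeType.b, EdgeType.a, EdgeType.b, EdgeType.b,
        EdgeType.a, EdgeType.b, EdgeType.a, EdgeType.b] =
        !![2, 2, 3, 2; 0, 1, 1, 1; 1, 1, 2, 1; 1, 2, 3, 3] ∧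
      IsPerronFrobenius !![2, 2, 3, 2; 0, 1, 1, 1; 1, 1, 2, 1; 1, 2, 3, 3] σ l ∧
      IsIET 0 1 4 2 (exchange l (γ 0)) ∧
      IsMinimalExchange (Set.Icc 0 1) (exchange l (γ 0)) ∧
      IsUniquelyErgodic (Set.Icc 0 1) (exchange l (γ 0)) ∧
      IsSelfInduced γ σ l ∧
      IsEndpointIdentification (exchange l (γ 0)) S ∧
      IsCET 3 2 S ∧
      IsMinimalExchange Set.univ S ∧
      IsUniquelyErgodic Set.univ S) ∧
    (transitiveIETs 4 2).Nonempty ∧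
    (transitiveCETs 3 2).Nonempty := by
  obtain ⟨σ, h6, h7, hσ⟩ := exists_cubic_root
  have hl := perronVector_pos h6
  have hsum := sum_perronVector h6
  have hsum' := hsum
  rw [Fin.sum_univ_four] at hsum'
  have hIET := isIET_exchange hl hsum
  have hmin := isMinimalExchange_exchange h6 hσ
  have herg := isUniquelyErgodic_exchange h6 hσ
  have hCET := isCET_circleExchange hl hsum'
  have hmin' := isMinimalExchange_circleExchange hl hsum' hmin
  refine ⟨⟨cycleVertex, σ, perronVector σ, circleExchange (perronVector σ), cycleVertex_zero_entry,
    ⟨isCycle_cycleVertex, ?_⟩, productMatrix_cycleVertex, isPerronFrobenius h6 h7 hσ, hIET, hmin,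
    herg, isSelfInduced_cycle (by linarith) hl (mulVec_perronVector hσ),
    isEndpointIdentification_circleExchange hl hsum', hCET, hmin',
    isUniquelyErgodic_circleExchange hl hsum' herg⟩,
    ⟨_, 0, 1, le_rfl, zero_lt_one, hIET, hmin.1⟩, ⟨_, hCET, hmin'.1⟩⟩
  change EventuallyPositive (productMatrix cycleVertex cycleType)
  rw [productMatrix_cycleVertex]
  exact eventuallyPositive_cycleMatrix
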